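/- Let $N\ge 1$, $0<s<1$, let $F:\mathbb R^{N-1}\to\mathbb R$ be a $C^\infty$ function, let $E=\{(x',x_N)\in\mathbb R^N : x_N<F(x')\}$, and let $\Sigma=\partial E=\{(x',F(x')) : x'\in\mathbb R^{N-1}\}$, with surface measure $d\sigma=\sqrt{1+|\nabla F(x')|^2}\,dx'$ and exterior unit normal $\nu=(-\nabla F,1)/\sqrt{1+|\nabla F|^2}$. Suppose that $\Sigma$ is an entire $s$-minimal graph, that is, for every $p\in\Sigma$, $$\lim_{\delta\to0^+}\int_{\mathbb R^N\setminus B_\delta(p)}\frac{\chi_E(x)-\chi_{\mathbb R^N\setminus E}(x)}{|x-p|^{N+s}}\,dx=0 .$$ Then $\Sigma$ is stable: for every $h\in C_0^\infty(\Sigma)$ the fractional Jacobi operator $$\mathcal J^s_\Sigma[h](p)=\lim_{\delta\to0^+}\int_{\Sigma\setminus B_\delta(p)}\frac{h(x)-h(p)}{|p-x|^{N+s}}\,d\sigma(x)+h(p)\int_\Sigma\frac{\langle\nu(p)-\nu(x),\nu(p)\rangle}{|p-x|^{N+s}}\,d\sigma(x)$$ is well defined at every $p\in\Sigma$ (the integrals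 over $\Sigma\setminus B_\delta(p)$ and the second integral converge absolutely, and the limit exists and is finite), $\mathcal J^s_\Sigma[h]\,h$ is integrable on $\Sigma$, and $$-\int_\Sigma \mathcal J^s_\Sigma[h]\,h\,d\sigma\ \ge\ 0 .$$ -/

import Mathlib

open Set Filter Topology MeasureTheory Metric
open scoped ContDiff Gradient

noncomputable section

namespace NonlocalMinimal

/-- `ℝ^N` with `N = n + 1`, written as `ℝ^(N-1) × ℝ` with the Euclidean norm, inner product and
Lebesgue measure. A point is `x = (x', x_N)` with `x' = x.fst` and `x_N = x.snd`. -/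
abbrev Space (n : ℕ) : Type := WithLp 2 (EuclideanSpace ℝ (Fin n) × ℝ)

/-- The singular kernel `1 / |x - p|^(N + s)`, where `N = n + 1`. -/
def kernel {n : ℕ} (s : ℝ) (x p : Space n) : ℝ := 1 / ‖x - p‖ ^ ((n : ℝ) + 1 + s)

/-- The boundary of the (open) set `E` has nonlocal mean curvature `H` at `p`: the principal value
integral of `(χ_E - χ_{E^c}) / |x - p|^(N + s)` exists and equals `H`. -/
def HasNonlocalMeanCurvature {n : ℕ} (s : ℝ) (E : Set (Space n)) (p : Space n) (H : ℝ) : Prop :=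
  Tendsto (fun δ : ℝ => ∫ x in (ball p δ)ᶜ,
      (E.indicator (fun _ => (1 : ℝ)) x - Eᶜ.indicator (fun _ => (1 : ℝ)) x) * kernel s x p)
    (𝓝[>] 0) (𝓝 H)

/-- `∂E` satisfies the nonlocal minimal surface equation in all of `ℝ^N`. -/
def SatisfiesNonlocalMinimalEquation {n : ℕ} (s : ℝ) (E : Set (Space n)) : Prop :=
  ∀ p ∈ frontier E, HasNonlocalMeanCurvature s E p 0

/-- The region below the graph of `F`. -/
def subgraph {n : ℕ} (F : EuclideanSpace ℝ (Fin n) → ℝ) : Set (Space n) :=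
  {x | x.snd < F x.fst}

/-- The point `(x', F(x'))` of the graph of `F`. -/
def graphPoint {n : ℕ} (F : EuclideanSpace ℝ (Fin n) → ℝ) (x' : EuclideanSpace ℝ (Fin n)) :
    Space n :=
  WithLp.toLp 2 (x', F x')

/-- The boundary of the subgraph of a continuous function is its graph. -/
theorem frontier_subgraph {n : ℕ} {F : EuclideanSpace ℝ (Fin n) → ℝ} (hF : Continuous F) :
    frontier (subgraph F) = range (graphPoint F) := by
  have hfst : Continuous (fun x : Space n => x.fst) := by fun_prop
  have hsnd : Continuous (fun x : Space n => x.snd) := by fun_prop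
  have hopen : IsOpen (subgraph F) := isOpen_lt hsnd (hF.comp hfst)
  ext x
  rw [hopen.frontier_eq]
  constructor
  · rintro ⟨hx, hx'⟩
    have h1 : x.snd ≤ F x.fst :=
      closure_minimal (t := {y : Space n | y.snd ≤ F y.fst})
        (fun y (hy : y.snd < F y.fst) => le_of_lt hy) (isClosed_le hsnd (hF.comp hfst)) hx
    have h2 : x.snd = F x.fst := le_antisymm h1 (not_lt.mp hx')
    exact ⟨x.fst, by rw [graphPoint, ← h2]; rfl⟩
  · rintro ⟨x', rfl⟩
    refine ⟨?_, fun h => lt_irrefl _ (show F x' < F x' from h)⟩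
    have hc : Continuous (fun t : ℝ => (WithLp.toLp 2 (x', F x' + t) : Space n)) := by fun_prop
    have ht : Tendsto (fun t : ℝ => (WithLp.toLp 2 (x', F x' + t) : Space n)) (𝓝[<] 0)
        (𝓝 (graphPoint F x')) := by
      have := (hc.tendsto 0).mono_left (nhdsWithin_le_nhds (s := Iio (0 : ℝ)))
      simpa [graphPoint] using this
    refine mem_closure_of_tendsto ht ?_
    filter_upwards [self_mem_nhdsWithin] with t ht0
    have : t < 0 := ht0
    show F x' + t < F x'
    linarith

/-- The surface measure of the graph of `F`, carried to `ℝ^N`: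
`∫ g dσ = ∫ g(x', F(x')) √(1 + |∇F(x')|²) dx'`. -/
def surfaceMeasure {n : ℕ} (F : EuclideanSpace ℝ (Fin n) → ℝ) : Measure (Space n) :=
  (volume.withDensity (fun x' : EuclideanSpace ℝ (Fin n) =>
    ENNReal.ofReal (Real.sqrt (1 + ‖∇ F x'‖ ^ 2)))).map (graphPoint F)

/-- The unit normal `(-∇F(x'), 1) / √(1 + |∇F(x')|²)` of the graph of `F` at `x = (x', F(x'))`,
exterior to the subgraph. -/
def normal {n : ℕ} (F : EuclideanSpace ℝ (Fin n) → ℝ) (x : Space n) : Space n :=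
  (Real.sqrt (1 + ‖∇ F x.fst‖ ^ 2))⁻¹ • WithLp.toLp 2 (-∇ F x.fst, (1 : ℝ))

/-- `h`, restricted to the graph `Σ` of `F`, belongs to `C_0^∞(Σ)`; smoothness and compactness of
the support are read in the global chart `x' ↦ (x', F(x'))`. The values of `h` off `Σ` play no
role. -/
def IsTestFunction {n : ℕ} (F : EuclideanSpace ℝ (Fin n) → ℝ) (h : Space n → ℝ) : Prop :=
  ContDiff ℝ ∞ (fun x' => h (graphPoint F x')) ∧
    HasCompactSupport (fun x' => h (graphPoint F x'))

/-- The integral of `(h(x) - h(p)) / |p - x|^(N + s)` over the surface outside `B_δ(p)`. -/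
def truncatedDifference {n : ℕ} (σ : Measure (Space n)) (s : ℝ) (h : Space n → ℝ) (p : Space n)
    (δ : ℝ) : ℝ :=
  ∫ x in (ball p δ)ᶜ, (h x - h p) * kernel s x p ∂σ

/-- The integrand `⟨ν(p) - ν(x), ν(p)⟩ / |p - x|^(N + s)` of the zeroth order coefficient. -/
def normalDefect {n : ℕ} (ν : Space n → Space n) (s : ℝ) (p x : Space n) : ℝ :=
  inner ℝ (ν p - ν x) (ν p) * kernel s x p

/-- All integrals in the definition of the fractional Jacobi operator at `p` converge: the first
one as a principal value, the second one absolutely. -/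
def JacobiConverges {n : ℕ} (σ : Measure (Space n)) (ν : Space n → Space n) (s : ℝ)
    (h : Space n → ℝ) (p : Space n) : Prop :=
  (∀ δ > 0, IntegrableOn (fun x => (h x - h p) * kernel s x p) (ball p δ)ᶜ σ) ∧
    (∃ L : ℝ, Tendsto (truncatedDifference σ s h p) (𝓝[>] 0) (𝓝 L)) ∧
    Integrable (normalDefect ν s p) σ

/-- The fractional Jacobi operator, for a surface with surface measure `σ` and unit normal `ν`. -/
def jacobi {n : ℕ} (σ : Measure (Space n)) (ν : Space n → Space n) (s : ℝ) (h : Space n → ℝ)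
    (p : Space n) : ℝ :=
  limUnder (𝓝[>] 0) (truncatedDifference σ s h p) + h p * ∫ x, normalDefect ν s p x ∂σ

end NonlocalMinimal

end

open Set Filter Topology MeasureTheory Metric
open scoped ContDiff Gradient ENNReal

noncomputable section

namespace NonlocalMinimal

/-! Put W = √(1+|∇F|²), let u be h read in the chart, and let K(x,y) be the kernel between the graph
points over x and y. Vertical translations preserve the equation, so the last component 1/W of the
normal is a positive Jacobi field, and a symmetric operator with a positive null solution has a
quadratic form of one sign. In the chart, the ground state substitution h = (uW)·(1/W) gives −∫ J[h]
h dσ = ½ ∬ (u(x)W(x) − u(y)W(y))² K(x,y) dx dy. The pointwise identity behind this is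
`second_variation_identity`. It contains, besides the square, a sum over i in which the linear
equation for ∂_iF is tested with u²∂_iF; these terms integrate to zero by `weak_jacobi_equation`.
That equation comes from `weak_minimal_equation`, written with the primitive of the kernel along
vertical lines, by testing with a derivative and integrating by parts at fixed difference z = y − x.

Most of the work is convergence. No growth condition is imposed on F, so it must be shown that
(1+|x−p|)^(−(N+s)) is integrable on Σ; this is `exists_weighted_area_le`. It reduces to a bound for
the area of Σ in unit balls depending only on n and s, proved as the BV estimate for minimizers of
the s-perimeter: (a) E minimizes the s-perimeter in bounded sets (`perimeter_subgraph_le`), because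
the vertical translates of Σ foliate space and calibrate E; (b) a compactly supported slide of E by
±t changes the sum of the two perimeters from 2P to at most (2 + Ct²)P
(`IsSlideProfile.perimeter_image_add_le`), while P is bounded by comparison with E minus a ball; (c)
submodularity, with the interaction term kept, turns this into a bound Ct² for the interaction of
the two halves of the symmetric difference of E and its translate (`exists_interaction_le`), hence
into a bound Ct for its volume (`exists_volume_translate_le`); (d) division by t gives an L¹ bound
for ∇F under every unit ball (`exists_lintegral_fderiv_le`).

The principal value exists because numerator and distance agree with an odd linear form and an even
seminorm to second order (`exists_principal_value`). The bounds are uniform on compact sets, so the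
limit δ → 0 may be taken inside the outer integral. -/

section NormPowers

/-! ### Powers of the norm and volumes of thin shells. -/

variable {E : Type*} [NormedAddCommGroup E] [NormedSpace ℝ E] [FiniteDimensional ℝ E]
  [MeasurableSpace E] [BorelSpace E]

theorem integrableOn_ball_norm_rpow (μ : Measure E) [μ.IsAddHaarMeasure] {α : ℝ}
    (hα : -(Module.finrank ℝ E : ℝ) < α) (r : ℝ) :
    IntegrableOn (fun x : E => ‖x‖ ^ α) (ball 0 r) μ := by
  rcases subsingleton_or_nontrivial E with hE | hE
  · have : (fun x : E => ‖x‖ ^ α) = fun _ => (0 : ℝ) ^ α := by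
      ext x; rw [Subsingleton.elim x 0, norm_zero]
    rw [this]
    exact integrableOn_const (measure_ball_lt_top.ne)
  · rw [integrableOn_fun_norm_addHaar μ (f := fun y : ℝ => y ^ α)]
    rcases le_or_gt r 0 with hr | hr
    · simp [Ioo_eq_empty (not_lt.2 hr)]
    have hd : 1 ≤ Module.finrank ℝ E := Module.finrank_pos
    have h1 : IntegrableOn (fun y : ℝ => y ^ ((Module.finrank ℝ E : ℝ) - 1 + α)) (Ioo 0 r) := by
      have := (intervalIntegral.intervalIntegrable_rpow' (a := 0) (b := r)
        (r := (Module.finrank ℝ E : ℝ) - 1 + α) (by linarith))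
      rw [intervalIntegrable_iff_integrableOn_Ioo_of_le hr.le] at this
      exact this
    refine h1.congr_fun (fun y hy => ?_) measurableSet_Ioo
    have hy0 : 0 < y := hy.1
    simp only [smul_eq_mul]
    rw [Real.rpow_add hy0, ← Real.rpow_natCast, Nat.cast_sub hd, Nat.cast_one]

theorem integrableOn_compl_ball_norm_rpow (μ : Measure E) [μ.IsAddHaarMeasure] {α : ℝ}
    (hα : α < -(Module.finrank ℝ E : ℝ)) {r : ℝ} (hr : 0 < r) :
    IntegrableOn (fun x : E => ‖x‖ ^ α) (ball 0 r)ᶜ μ := by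
  have h1 := (integrable_one_add_norm (E := E) (μ := μ) (r := -α) (by linarith)).const_mul
    ((1 + r⁻¹) ^ (-α))
  refine Integrable.mono' h1.integrableOn ?_ ?_
  · exact (measurable_norm.pow_const α).aestronglyMeasurable
  · refine (ae_restrict_iff' measurableSet_ball.compl).2 (ae_of_all _ fun x hx => ?_)
    have hx' : r ≤ ‖x‖ := by simpa using hx
    have hx0 : 0 < ‖x‖ := hr.trans_le hx'
    rw [neg_neg, Real.norm_of_nonneg (by positivity)]
    have h2 : 1 + ‖x‖ ≤ (1 + r⁻¹) * ‖x‖ := by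
      have : 1 ≤ r⁻¹ * ‖x‖ := by
        rw [← inv_mul_cancel₀ hr.ne']; gcongr
      linarith
    have hα0 : α ≤ 0 := by
      have : (0 : ℝ) ≤ Module.finrank ℝ E := by positivity
      linarith
    calc ‖x‖ ^ α = (1 + r⁻¹) ^ (-α) * ((1 + r⁻¹) * ‖x‖) ^ α := by
          rw [Real.mul_rpow (by positivity) hx0.le, ← mul_assoc, ← Real.rpow_add (by positivity)]
          simp
      _ ≤ _ := by
          gcongr ?_ * ?_
          exact Real.rpow_le_rpow_of_nonpos (by positivity) h2 hα0

/-- Scaling reduces the shell to b^d − a^d ≤ (b−a)·d·b^(d−1) times the measure of the unit ball of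
`p`, which lies in the norm ball. The constant therefore does not depend on `p`: the lemma serves
Euclidean shells and also the ellipsoidal shells of tangent spaces, uniformly in the base point. -/
theorem measure_seminorm_shell_le (μ : Measure E) [μ.IsAddHaarMeasure] (p : Seminorm ℝ E)
    (hp : ∀ x, ‖x‖ ≤ p x) {a b : ℝ} (ha : 0 < a) (hab : a ≤ b) :
    μ (p.ball 0 b \ p.ball 0 a) ≤
      ENNReal.ofReal ((b - a) * Module.finrank ℝ E * b ^ (Module.finrank ℝ E - 1)) *
        μ (ball 0 1) := by
  have hcont : Continuous p := by
    have : ContinuousOn p univ := p.convexOn.continuousOn isOpen_univ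
    simpa [continuousOn_univ] using this
  have hmeas : ∀ r, MeasurableSet (p.ball 0 r) := fun r => by
    rw [Seminorm.ball_zero_eq]
    exact (isOpen_lt hcont continuous_const).measurableSet
  have hle : p.ball 0 1 ⊆ ball 0 1 := fun x hx => by
    rw [Seminorm.mem_ball_zero] at hx
    rw [mem_ball_zero_iff]
    exact (hp x).trans_lt hx
  have hfin : ∀ r, μ (p.ball 0 r) ≠ ⊤ := fun r => by
    refine ((measure_mono fun x hx => ?_).trans_lt (measure_ball_lt_top (μ := μ) (x := 0)
      (r := r))).ne
    rw [Seminorm.mem_ball_zero] at hx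
    rw [mem_ball_zero_iff]
    exact (hp x).trans_lt hx
  have hscale : ∀ r : ℝ, 0 < r → μ (p.ball 0 r) =
      ENNReal.ofReal (r ^ Module.finrank ℝ E) * μ (p.ball 0 1) := fun r hr => by
    have := Seminorm.smul_ball_zero (p := p) (k := r) (r := 1) hr.ne'
    rw [mul_one, Real.norm_of_nonneg hr.le] at this
    rw [← this, Measure.addHaar_smul, abs_of_nonneg (by positivity)]
  have hsub : p.ball 0 a ⊆ p.ball 0 b := fun x hx => by
    rw [Seminorm.mem_ball_zero] at hx ⊢
    exact hx.trans_le hab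
  have hmono : ENNReal.ofReal ((b - a) * Module.finrank ℝ E * b ^ (Module.finrank ℝ E - 1)) *
        μ (p.ball 0 1) ≤ ENNReal.ofReal ((b - a) * Module.finrank ℝ E *
          b ^ (Module.finrank ℝ E - 1)) * μ (ball 0 1) := by gcongr
  refine le_trans ?_ hmono
  rcases hab.eq_or_lt with rfl | hlt
  · simp
  have hb : 0 < b := ha.trans hlt
  have key := abs_pow_sub_pow_le b a (Module.finrank ℝ E)
  rw [abs_of_nonneg (sub_nonneg.2 hab), abs_of_nonneg ha.le, abs_of_nonneg hb.le, max_eq_left hab]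
    at key
  rw [measure_sdiff hsub (hmeas a).nullMeasurableSet (hfin a), hscale b hb, hscale a ha,
    ← ENNReal.sub_mul (fun _ _ => (hfin 1)), ← ENNReal.ofReal_sub _ (by positivity)]
  gcongr
  exact (le_abs_self _).trans key

end NormPowers

/-- Write the power as exp(−q log(1+u)) and insert log(1+u) ≥ u − 2u² and exp v ≤ 1 + v + v² for |v|
≤ 1. The linear term is exact, which later allows it to cancel between t and −t. -/
theorem one_add_rpow_neg_le (q : ℝ) (hq : 0 ≤ q) {u : ℝ} (hu : |u| ≤ 1 / 2)
    (hqu : q * |u| ≤ 1 / 2) : (1 + u) ^ (-q) ≤ 1 - q * u + (2 * q + 4 * q ^ 2) * u ^ 2 := by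
  have hu' := abs_le.1 hu
  have h1 : 0 < 1 + u := by linarith
  have hlog : u - 2 * u ^ 2 ≤ Real.log (1 + u) := by
    have h2 := Real.one_sub_inv_le_log_of_pos h1
    refine le_trans ?_ h2
    have : 1 - (1 + u)⁻¹ = u - u ^ 2 * (1 + u)⁻¹ := by field_simp; ring
    rw [this]
    have : (1 + u)⁻¹ ≤ 2 := by
      rw [inv_le_comm₀ h1 two_pos]; linarith
    nlinarith [sq_nonneg u]
  set v := q * (-u + 2 * u ^ 2) with hv
  have hu2 : u ^ 2 ≤ |u| * (1 / 2) := by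
    rw [← sq_abs]; nlinarith [abs_nonneg u]
  have hv1 : |v| ≤ 2 * q * |u| := by
    rw [hv, abs_mul, abs_of_nonneg hq]
    have : |-u + 2 * u ^ 2| ≤ 2 * |u| := by
      refine (abs_add_le _ _).trans ?_
      rw [abs_neg, abs_of_nonneg (by positivity : 0 ≤ 2 * u ^ 2)]
      linarith
    nlinarith
  have hexp : (1 + u) ^ (-q) ≤ Real.exp v := by
    rw [Real.rpow_def_of_pos h1, Real.exp_le_exp, hv]
    nlinarith
  have h3 := (abs_le.1 (Real.abs_exp_sub_one_sub_id_le (x := v) (by linarith))).2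
  have h4 : v ^ 2 ≤ 4 * q ^ 2 * u ^ 2 := by
    have := pow_le_pow_left₀ (abs_nonneg v) hv1 2
    calc v ^ 2 = |v| ^ 2 := (sq_abs v).symm
      _ ≤ (2 * q * |u|) ^ 2 := this
      _ = 4 * q ^ 2 * u ^ 2 := by rw [mul_pow, sq_abs]; ring
  rw [hv] at h3 h4
  linarith

/-! ### The space ℝ^N, the singular kernel and the fractional perimeter of balls. -/

variable {n : ℕ}

theorem finrank_space : Module.finrank ℝ (Space n) = n + 1 := by
  rw [(WithLp.linearEquiv 2 ℝ (EuclideanSpace ℝ (Fin n) × ℝ)).finrank_eq]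
  simp

theorem norm_fst_le (z : Space n) : ‖z.fst‖ ≤ ‖z‖ := by
  have := WithLp.prod_norm_sq_eq_of_L2 z
  exact le_of_sq_le_sq (by nlinarith [sq_nonneg ‖z.snd‖]) (norm_nonneg _)

theorem abs_snd_le (z : Space n) : |z.snd| ≤ ‖z‖ := by
  have := WithLp.prod_norm_sq_eq_of_L2 z
  rw [← Real.norm_eq_abs]
  exact le_of_sq_le_sq (by nlinarith [sq_nonneg ‖z.fst‖]) (norm_nonneg _)

theorem norm_le_norm_fst_add (z : Space n) : ‖z‖ ≤ ‖z.fst‖ + |z.snd| := by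
  have := WithLp.prod_norm_sq_eq_of_L2 z
  rw [Real.norm_eq_abs] at this
  refine le_of_sq_le_sq ?_ (by positivity)
  nlinarith [norm_nonneg z.fst, abs_nonneg z.snd,
    mul_nonneg (norm_nonneg z.fst) (abs_nonneg z.snd)]

theorem measurePreserving_toLp :
    MeasurePreserving (WithLp.toLp 2 : EuclideanSpace ℝ (Fin n) × ℝ → Space n) volume volume :=
  WithLp.volume_preserving_toLp _ _

theorem measurableEmbedding_toLp :
    MeasurableEmbedding (WithLp.toLp 2 : EuclideanSpace ℝ (Fin n) × ℝ → Space n) :=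
  (WithLp.homeomorphProd 2 (EuclideanSpace ℝ (Fin n)) ℝ).symm.measurableEmbedding

theorem lintegral_space {f : Space n → ℝ≥0∞} (hf : Measurable f) :
    ∫⁻ x, f x = ∫⁻ x' : EuclideanSpace ℝ (Fin n), ∫⁻ τ : ℝ, f (WithLp.toLp 2 (x', τ)) := by
  rw [← measurePreserving_toLp.lintegral_comp_emb measurableEmbedding_toLp, Measure.volume_eq_prod,
    lintegral_prod]
  exact (hf.comp measurableEmbedding_toLp.measurable).aemeasurable

theorem integral_space {f : Space n → ℝ} (hf : Integrable f) :
    ∫ x, f x = ∫ x' : EuclideanSpace ℝ (Fin n), ∫ τ : ℝ, f (WithLp.toLp 2 (x', τ)) := by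
  rw [← measurePreserving_toLp.integral_comp measurableEmbedding_toLp, Measure.volume_eq_prod,
    integral_prod]
  rw [← Measure.volume_eq_prod]
  exact (measurePreserving_toLp.integrable_comp_emb measurableEmbedding_toLp).2 hf

/-- The kernel `|z|^{-(N+s)}`, with value `0` at the origin. -/
def radial (s : ℝ) (z : Space n) : ℝ := ‖z‖ ^ (-((n : ℝ) + 1 + s))

theorem kernel_eq_radial (s : ℝ) (x p : Space n) : kernel s x p = radial s (x - p) := by
  rw [kernel, radial, Real.rpow_neg (norm_nonneg _), one_div]

theorem radial_nonneg (s : ℝ) (z : Space n) : 0 ≤ radial s z :=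
  Real.rpow_nonneg (norm_nonneg _) _

theorem radial_neg (s : ℝ) (z : Space n) : radial s (-z) = radial s z := by
  rw [radial, radial, norm_neg]

/-- A real power of 0 with nonzero exponent is 0, so coincident points carry no mass and pointwise
inequalities may be checked on the diagonal too. -/
theorem radial_zero {s : ℝ} (hs : 0 < s) : radial s (0 : Space n) = 0 := by
  rw [radial, norm_zero, Real.zero_rpow]
  have : (0 : ℝ) ≤ n := n.cast_nonneg
  linarith

theorem radial_le_of_norm_le {s : ℝ} (hs : 0 < s) {z : Space n} {r : ℝ} (hr : 0 < r)
    (hz : r ≤ ‖z‖) : radial s z ≤ r ^ (-((n : ℝ) + 1 + s)) := by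
  have : (0 : ℝ) ≤ n := n.cast_nonneg
  exact Real.rpow_le_rpow_of_nonpos hr hz (by linarith)

theorem measurable_radial (s : ℝ) : Measurable (radial s : Space n → ℝ) :=
  measurable_norm.pow_const _

theorem integrableOn_radial_compl_ball {s : ℝ} (hs : 0 < s) {r : ℝ} (hr : 0 < r) :
    IntegrableOn (radial s) (ball (0 : Space n) r)ᶜ :=
  integrableOn_compl_ball_norm_rpow _ (by rw [finrank_space]; push_cast; linarith) hr

/-- The factor `min 1 ‖z‖` gains one power at the origin: the exponent −(n+s) exceeds −(n+1) exactly
because s < 1. -/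
theorem integrable_min_mul_radial {s : ℝ} (hs0 : 0 < s) (hs1 : s < 1) :
    Integrable (fun z : Space n => min 1 ‖z‖ * radial s z) := by
  have hmeas : AEStronglyMeasurable (fun z : Space n => min 1 ‖z‖ * radial s z) :=
    ((measurable_const.min measurable_norm).mul (measurable_radial s)).aestronglyMeasurable
  rw [← integrableOn_univ, ← union_compl_self (ball (0 : Space n) 1), integrableOn_union]
  constructor
  · refine Integrable.mono' (integrableOn_ball_norm_rpow volume (α := -((n : ℝ) + s))
      (by rw [finrank_space]; push_cast; linarith) 1) hmeas.restrict (ae_of_all _ fun z => ?_)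
    rw [Real.norm_of_nonneg (mul_nonneg (by positivity) (radial_nonneg s z))]
    rcases eq_or_ne z 0 with rfl | hz
    · simp only [norm_zero, zero_le_one, inf_of_le_right, zero_mul]; positivity
    · have hz' := norm_pos_iff.2 hz
      calc min 1 ‖z‖ * radial s z ≤ ‖z‖ * radial s z :=
            mul_le_mul_of_nonneg_right (min_le_right _ _) (radial_nonneg _ _)
        _ = ‖z‖ ^ (-((n : ℝ) + s)) := by
            rw [radial, ← Real.rpow_one_add' hz'.le]
            · ring_nf
            · have : (0 : ℝ) ≤ n := n.cast_nonneg
              linarith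
  · refine Integrable.mono' (integrableOn_radial_compl_ball hs0 one_pos) hmeas.restrict
      (ae_of_all _ fun z => ?_)
    rw [Real.norm_of_nonneg (mul_nonneg (by positivity) (radial_nonneg s z))]
    exact mul_le_of_le_one_left (radial_nonneg _ _) (min_le_left _ _)

/-- A short translation uncovers only points of the shell r − |z| ≤ |x − p| < r; for a long one the
whole ball is a sufficient bound. -/
theorem exists_volume_ball_diff_le (n : ℕ) {r : ℝ} (hr : 0 < r) :
    ∃ C : ℝ, 0 ≤ C ∧ ∀ p z : Space n,
      volume (ball p r \ ball (p + z) r) ≤ ENNReal.ofReal (C * min 1 ‖z‖) := by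
  obtain ⟨V, hV⟩ : ∃ V : ℝ≥0∞, V = volume (ball (0 : Space n) 1) := ⟨_, rfl⟩
  obtain ⟨V', hV'⟩ : ∃ V : ℝ≥0∞, V = volume (ball (0 : Space n) r) := ⟨_, rfl⟩
  have hVt : V ≠ ⊤ := hV ▸ measure_ball_lt_top.ne
  have hVt' : V' ≠ ⊤ := hV' ▸ measure_ball_lt_top.ne
  set c1 : ℝ := (n + 1 : ℕ) * r ^ n * V.toReal
  set c2 : ℝ := V'.toReal
  have hc1 : 0 ≤ c1 := by positivity
  have hc2 : 0 ≤ c2 := by positivity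
  -- `c1` serves the short translations. If ‖z‖ ≥ min 1 r then (1 + r⁻¹)·min 1 ‖z‖ ≥ 1, so the
  -- second term covers the full volume `c2`.
  refine ⟨c1 + c2 * (1 + r⁻¹), by positivity, fun p z => ?_⟩
  have hball : volume (ball p r) = V' := by
    rw [hV', Measure.addHaar_ball_center]
  rcases lt_or_ge ‖z‖ (min 1 r) with hz | hz
  · obtain ⟨hz1, hzr⟩ := lt_min_iff.1 hz
    rcases eq_or_ne z 0 with rfl | hz0
    · simp
    have hz' := norm_pos_iff.2 hz0
    have hsub : ball p r \ ball (p + z) r ⊆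
        (fun x => x - p) ⁻¹' ((normSeminorm ℝ (Space n)).ball 0 r \
          (normSeminorm ℝ (Space n)).ball 0 (r - ‖z‖)) := by
      rintro x ⟨hx1, hx2⟩
      simp only [mem_ball, dist_eq_norm, not_lt] at hx1 hx2
      simp only [ball_normSeminorm, mem_preimage, Set.mem_sdiff, mem_ball_zero_iff, not_lt]
      refine ⟨hx1, ?_⟩
      have : ‖x - (p + z)‖ ≤ ‖x - p‖ + ‖z‖ := by
        rw [← sub_sub]; exact norm_sub_le _ _
      linarith
    refine (measure_mono hsub).trans ?_
    simp only [sub_eq_add_neg (b := p)]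
    rw [measure_preimage_add_right]
    refine (measure_seminorm_shell_le volume _ (fun x => le_rfl) (sub_pos.2 hzr)
      (by linarith)).trans ?_
    rw [← hV, ← ENNReal.ofReal_toReal hVt, ← ENNReal.ofReal_mul (by
      have : 0 ≤ r - (r - ‖z‖) := by linarith
      positivity), finrank_space]
    refine ENNReal.ofReal_le_ofReal ?_
    rw [min_eq_right hz1.le, add_tsub_cancel_right]
    have : (r - (r - ‖z‖)) * ((n + 1 : ℕ) : ℝ) * r ^ n * V.toReal = c1 * ‖z‖ := by
      simp only [c1]; ring
    rw [this]
    have : 0 ≤ c2 * (1 + r⁻¹) := by positivity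
    nlinarith
  · refine (measure_mono Set.sdiff_subset).trans ?_
    rw [hball, ← ENNReal.ofReal_toReal hVt']
    refine ENNReal.ofReal_le_ofReal ?_
    have h1 : 1 ≤ (1 + r⁻¹) * min 1 ‖z‖ := by
      rcases le_total 1 r with h | h
      · rw [min_eq_left h] at hz
        rw [min_eq_left hz]
        have : 0 < r⁻¹ := by positivity
        linarith
      · rw [min_eq_right h] at hz
        have : r ≤ min 1 ‖z‖ := le_min h hz
        calc 1 ≤ (1 + r⁻¹) * r := by rw [add_mul, inv_mul_cancel₀ hr.ne']; linarith
          _ ≤ _ := by gcongr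
    have h2 : 0 ≤ c1 * min 1 ‖z‖ := by positivity
    change c2 ≤ _
    nlinarith

/-- For fixed z = x − y the points x that contribute form B minus B + z, of volume at most
C·min(1,|z|), and this compensates the singularity of the kernel. -/
theorem exists_lintegral_ball_compl_le (n : ℕ) {s : ℝ} (hs0 : 0 < s) (hs1 : s < 1) {r : ℝ}
    (hr : 0 < r) : ∃ C : ℝ≥0∞, C ≠ ⊤ ∧ ∀ p : Space n,
      ∫⁻ x in ball p r, ∫⁻ y in (ball p r)ᶜ, ENNReal.ofReal (radial s (x - y)) ≤ C := by
  obtain ⟨C, hC0, hC⟩ := exists_volume_ball_diff_le n hr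
  refine ⟨∫⁻ z : Space n, ENNReal.ofReal (C * (min 1 ‖z‖ * radial s z)), ?_, fun p => ?_⟩
  · exact ((integrable_min_mul_radial hs0 hs1).const_mul C).lintegral_lt_top.ne
  have hkm : Measurable fun z : Space n => ENNReal.ofReal (radial s z) :=
    (measurable_radial s).ennreal_ofReal
  calc ∫⁻ x in ball p r, ∫⁻ y in (ball p r)ᶜ, ENNReal.ofReal (radial s (x - y))
      = ∫⁻ x, ∫⁻ y, (ball p r).indicator 1 x * ((ball p r)ᶜ.indicator 1 y *
          ENNReal.ofReal (radial s (x - y))) := by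
        rw [← lintegral_indicator measurableSet_ball]
        refine lintegral_congr fun x => ?_
        by_cases hx : x ∈ ball p r
        · simp only [indicator_of_mem hx, Pi.one_apply, one_mul]
          rw [← lintegral_indicator measurableSet_ball.compl]
          refine lintegral_congr fun y => ?_
          by_cases hy : y ∈ (ball p r)ᶜ
          · simp only [indicator_of_mem hy, Pi.one_apply, one_mul]
          · simp only [indicator_of_notMem hy, zero_mul]
        · simp only [indicator_of_notMem hx, zero_mul, lintegral_zero]
    _ = ∫⁻ x, ∫⁻ z, (ball p r).indicator 1 x * ((ball p r)ᶜ.indicator 1 (x - z) *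
          ENNReal.ofReal (radial s z)) := by
        refine lintegral_congr fun x => ?_
        rw [← lintegral_sub_left_eq_self _ x]
        simp only [sub_sub_cancel]
    _ = ∫⁻ z, ∫⁻ x, (ball p r).indicator 1 x * ((ball p r)ᶜ.indicator 1 (x - z) *
          ENNReal.ofReal (radial s z)) := by
        refine lintegral_lintegral_swap (Measurable.aemeasurable ?_)
        refine ((measurable_one.indicator measurableSet_ball).comp measurable_fst).mul ?_
        exact ((measurable_one.indicator measurableSet_ball.compl).comp
          (measurable_fst.sub measurable_snd)).mul (hkm.comp measurable_snd)
    _ ≤ ∫⁻ z, ENNReal.ofReal (C * (min 1 ‖z‖ * radial s z)) := by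
        refine lintegral_mono fun z => ?_
        have h1 : ∀ x, (ball p r).indicator (1 : Space n → ℝ≥0∞) x *
            ((ball p r)ᶜ.indicator 1 (x - z) * ENNReal.ofReal (radial s z)) =
            (ball p r \ ball (p + z) r).indicator 1 x * ENNReal.ofReal (radial s z) := fun x => by
          rw [← mul_assoc]
          congr 1
          have h2 : x - z ∈ ball p r ↔ x ∈ ball (p + z) r := by
            simp only [mem_ball, dist_eq_norm]; rw [sub_sub, add_comm z p]
          by_cases hx : x ∈ ball p r <;> by_cases hy : x ∈ ball (p + z) r <;>
            simp only [indicator, Set.mem_sdiff, mem_compl_iff, h2, hx, hy] <;> simp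
        simp only [h1]
        rw [lintegral_mul_const _ (measurable_one.indicator
          (measurableSet_ball.diff measurableSet_ball)), lintegral_indicator_one
          (measurableSet_ball.diff measurableSet_ball), ← mul_assoc,
          ENNReal.ofReal_mul (by positivity)]
        gcongr
        exact hC p z

/-- The power is the relative change of the kernel when |z|² is multiplied by 1 + 2tα + t²β, and the
two linear factors are the Jacobians at the two points. Terms of first order are odd in t and cancel
in the sum, leaving an error of order L²t². -/
theorem second_difference_le {q L t α β a b : ℝ} (hq : 0 ≤ q) (hL : 0 ≤ L) 
    (htL : |t| * L * (6 * (1 + q)) ≤ 1) (hα : |α| ≤ L) (hβ0 : 0 ≤ β) (hβ : β ≤ L ^ 2)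
    (ha : |a| ≤ L) (hb : |b| ≤ L) :
    (1 + (2 * t * α + t ^ 2 * β)) ^ (-q) * ((1 + t * a) * (1 + t * b)) +
      (1 + (2 * (-t) * α + (-t) ^ 2 * β)) ^ (-q) * ((1 + -t * a) * (1 + -t * b)) ≤
      2 + 2 * (18 * (2 * q + 4 * q ^ 2) + 1 + 4 * q) * L ^ 2 * t ^ 2 := by
  have h0 : 0 ≤ |t| * L := by positivity
  have h1 : |t| * L ≤ 1 / 6 := by nlinarith
  have h2 : q * (|t| * L) ≤ 1 / 6 := by nlinarith
  have hone : ∀ τ : ℝ, |τ| = |t| → (1 + (2 * τ * α + τ ^ 2 * β)) ^ (-q) ≤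
      1 - 2 * q * α * τ + 9 * (2 * q + 4 * q ^ 2) * L ^ 2 * t ^ 2 := by
    intro τ hτ
    have hτ2 : τ ^ 2 = t ^ 2 := by rw [← sq_abs, hτ, sq_abs]
    have hu : |2 * τ * α + τ ^ 2 * β| ≤ 3 * (|t| * L) := by
      refine (abs_add_le _ _).trans ?_
      rw [abs_mul, abs_mul, hτ, abs_of_nonneg (mul_nonneg (sq_nonneg τ) hβ0), hτ2, ← sq_abs t,
        abs_two]
      have : |t| * |α| ≤ |t| * L := by gcongr
      have : |t| ^ 2 * β ≤ |t| ^ 2 * L ^ 2 := by gcongr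
      nlinarith
    have h3 := one_add_rpow_neg_le q hq (u := 2 * τ * α + τ ^ 2 * β) (by linarith) (by nlinarith)
    have h4 : (2 * τ * α + τ ^ 2 * β) ^ 2 ≤ 9 * L ^ 2 * t ^ 2 := by
      have := pow_le_pow_left₀ (abs_nonneg _) hu 2
      rw [sq_abs] at this
      calc _ ≤ _ := this
        _ = _ := by rw [mul_pow, mul_pow, sq_abs]; ring
    -- The contribution −qτ²β of the linear term has the favourable sign and is dropped.
    have h5 : 0 ≤ q * (τ ^ 2 * β) := by positivity
    have h6 : (2 * q + 4 * q ^ 2) * (2 * τ * α + τ ^ 2 * β) ^ 2 ≤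
      (2 * q + 4 * q ^ 2) * (9 * L ^ 2 * t ^ 2) := by gcongr
    linarith
  have hJ : ∀ τ c : ℝ, |τ| = |t| → |c| ≤ L → 0 ≤ 1 + τ * c := by
    intro τ c hτ hc
    have : |τ * c| ≤ |t| * L := by rw [abs_mul, hτ]; gcongr
    have := (abs_le.1 this).1
    linarith
  have hp := mul_le_mul_of_nonneg_right (hone t rfl)
    (mul_nonneg (hJ t a rfl ha) (hJ t b rfl hb))
  have hm := mul_le_mul_of_nonneg_right (hone (-t) (abs_neg t))
    (mul_nonneg (hJ (-t) a (abs_neg t) ha) (hJ (-t) b (abs_neg t) hb))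
  refine (add_le_add hp hm).trans ?_
  set c := 9 * (2 * q + 4 * q ^ 2) * L ^ 2 with hc
  have hc0 : 0 ≤ c := by positivity
  have hab : |a * b| ≤ L ^ 2 := by rw [abs_mul, sq]; gcongr
  have hαab : |α * (a + b)| ≤ 2 * L ^ 2 := by
    rw [abs_mul]
    calc |α| * |a + b| ≤ L * (L + L) := by
          gcongr
          exact (abs_add_le _ _).trans (add_le_add ha hb)
      _ = 2 * L ^ 2 := by ring
  have hid : (1 - 2 * q * α * t + c * t ^ 2) * ((1 + t * a) * (1 + t * b)) +
      (1 - 2 * q * α * -t + c * t ^ 2) * ((1 + -t * a) * (1 + -t * b)) =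
      2 + 2 * t ^ 2 * (c + a * b + c * (t ^ 2 * (a * b)) + 2 * q * (-(α * (a + b)))) := by ring
  rw [hid]
  have h7 : t ^ 2 * (a * b) ≤ 1 := by
    have h8 : (|t| * L) ^ 2 ≤ 1 := by nlinarith
    rw [mul_pow, sq_abs] at h8
    have := (abs_le.1 hab).2
    nlinarith [sq_nonneg t]
  have h9 : c * (t ^ 2 * (a * b)) ≤ c := mul_le_of_le_one_right hc0 h7
  have h10 : 2 * q * (-(α * (a + b))) ≤ 2 * q * (2 * L ^ 2) := by
    gcongr
    exact (neg_le_abs _).trans hαab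
  -- Each of the two copies of `c` gives 9(2q+4q²)L², whence the 18; the term ab gives 1 and the
  -- term with α(a+b) gives 4q.
  have h11 : c + a * b + c * (t ^ 2 * (a * b)) + 2 * q * (-(α * (a + b))) ≤
      (18 * (2 * q + 4 * q ^ 2) + 1 + 4 * q) * L ^ 2 := by
    have := (abs_le.1 hab).2
    rw [hc] at h9 ⊢
    linarith
  have := mul_le_mul_of_nonneg_left h11 (by positivity : 0 ≤ 2 * t ^ 2)
  linarith

/-! ### Sliding deformations and the perimeter of slid sets. -/

section Slide

variable {E : Type*} [NormedAddCommGroup E] [InnerProductSpace ℝ E] [FiniteDimensional ℝ E]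
  [MeasurableSpace E] [BorelSpace E]

/-- The displacement `x ↦ x + t η(x) e` in direction `e`. -/
def slide (η : E → ℝ) (e : E) (t : ℝ) (x : E) : E := x + (t * η x) • e

structure IsSlideProfile (η : E → ℝ) (e : E) (L : ℝ) (Ω : Set (E)) : Prop where
  differentiable : Differentiable ℝ η
  lipschitz : ∀ x y, |η x - η y| ≤ L * ‖x - y‖
  fderiv_le : ∀ x, |fderiv ℝ η x e| ≤ L
  abs_le_one : ∀ x, |η x| ≤ 1
  eq_zero : ∀ x ∉ Ω, η x = 0
  norm_le_one : ‖e‖ ≤ 1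
  nonneg : 0 ≤ L

namespace IsSlideProfile

variable {η : E → ℝ} {e : E} {L t : ℝ} {Ω : Set (E)}

theorem injective (h : IsSlideProfile η e L Ω) (ht : |t| * L < 1) :
    Function.Injective (slide η e t) := by
  intro x y hxy
  have h1 : x - y = (t * (η y - η x)) • e := by
    have : x + (t * η x) • e = y + (t * η y) • e := hxy
    rw [mul_sub, sub_smul, sub_eq_sub_iff_add_eq_add, this, add_comm]
  by_contra hne
  have h3 : 0 < ‖x - y‖ := norm_pos_iff.2 (sub_ne_zero.2 hne)
  have h4 : ‖x - y‖ ≤ |t| * L * ‖x - y‖ := by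
    calc ‖x - y‖ = |t| * |η y - η x| * ‖e‖ := by
          rw [h1, norm_smul, Real.norm_eq_abs, abs_mul]
      _ ≤ |t| * (L * ‖x - y‖) * 1 := by
          gcongr
          · have := h.nonneg; positivity
          · rw [abs_sub_comm]; exact h.lipschitz x y
          · exact h.norm_le_one
      _ = _ := by ring
  nlinarith

/-- Along the line y + re the equation for a preimage is r + tη(y+re) = 0, a bounded continuous
perturbation of r, so the intermediate value theorem applies. -/
theorem surjective (h : IsSlideProfile η e L Ω) : Function.Surjective (slide η e t) := by
  intro y
  have hc : Continuous fun r : ℝ => r + t * η (y + r • e) := by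
    have := h.differentiable.continuous
    fun_prop
  have hb : ∀ r : ℝ, |t * η (y + r • e)| ≤ |t| := fun r => by
    rw [abs_mul]; exact mul_le_of_le_one_right (abs_nonneg t) (h.abs_le_one _)
  have hs := hc.surjective
    (tendsto_atTop_mono (f := fun r : ℝ => r - |t|)
      (fun r => by have := (abs_le.1 (hb r)).1; linarith)
      (tendsto_atTop_add_const_right _ _ tendsto_id))
    (tendsto_atBot_mono (f := fun r : ℝ => r + |t|)
      (fun r => by have := (abs_le.1 (hb r)).2; linarith)
      (tendsto_atBot_add_const_right _ _ tendsto_id))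
  obtain ⟨r, hr⟩ := hs 0
  refine ⟨y + r • e, ?_⟩
  have hr' : r + t * η (y + r • e) = 0 := hr
  rw [slide, add_assoc, ← add_smul, hr', zero_smul, add_zero]

theorem continuous (h : IsSlideProfile η e L Ω) : Continuous (slide η e t) := by
  have := h.differentiable.continuous
  unfold slide
  fun_prop

/-- The map fixes every point off Ω, so by injectivity no point of Ω can land there. -/
theorem mem_iff (h : IsSlideProfile η e L Ω) (ht : |t| * L < 1) (x : E) :
    slide η e t x ∈ Ω ↔ x ∈ Ω := by
  by_cases hx : x ∈ Ω
  · refine iff_of_true ?_ hx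
    by_contra hx'
    have h1 : slide η e t (slide η e t x) = slide η e t x := by
      conv_lhs => rw [slide]
      rw [h.eq_zero _ hx']; simp
    exact hx' ((h.injective ht h1).symm ▸ hx)
  · have : slide η e t x = x := by rw [slide, h.eq_zero x hx]; simp
    rw [this]

theorem lintegral_comp (h : IsSlideProfile η e L Ω) (ht : |t| * L < 1) (g : E → ℝ≥0∞) :
    ∫⁻ x, g x = ∫⁻ x, ENNReal.ofReal (1 + t * fderiv ℝ η x e) * g (slide η e t x) := by
  have hd : ∀ x ∈ (univ : Set (E)), HasFDerivWithinAt (slide η e t)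
      (ContinuousLinearMap.id ℝ (E) + (t • fderiv ℝ η x).smulRight e) univ x := fun x _ => by
    have h1 := (((h.differentiable x).hasFDerivAt.const_mul t).smul_const e)
    exact ((hasFDerivAt_id x).add h1).hasFDerivWithinAt
  have h2 := lintegral_image_eq_lintegral_abs_det_fderiv_mul volume MeasurableSet.univ hd
    (h.injective ht).injOn g
  rw [image_univ, h.surjective.range_eq, Measure.restrict_univ] at h2
  rw [h2]
  refine lintegral_congr fun x => ?_
  congr 2
  -- The derivative is the identity plus a rank-one map, whose determinant is explicit.
  have h3 : (ContinuousLinearMap.id ℝ (E) + (t • fderiv ℝ η x).smulRight e).det =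
      1 + t * fderiv ℝ η x e := by
    have := LinearMap.transvection.det (t • fderiv ℝ η x).toLinearMap e
    rw [ContinuousLinearMap.det]
    exact this
  rw [h3, abs_of_nonneg]
  have : |t * fderiv ℝ η x e| ≤ |t| * L := by
    rw [abs_mul]; gcongr; exact h.fderiv_le x
  have := (abs_le.1 this).1
  linarith

end IsSlideProfile

open Classical in
/-- The indicator of the pairs of points separated by `G`, at least one of which lies in `Ω`. -/
def separates (Ω G : Set (E)) (x y : E) : ℝ≥0∞ :=
  if (x ∈ Ω ∨ y ∈ Ω) ∧ ¬(x ∈ G ↔ y ∈ G) then 1 else 0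

/-- Twice the part of the perimeter of `G` with respect to `κ` that is seen from `Ω`. -/
def perimeter (κ : E → ℝ≥0∞) (Ω G : Set (E)) : ℝ≥0∞ :=
  ∫⁻ x, ∫⁻ y, separates Ω G x y * κ (x - y)

theorem measurable_separates {Ω G : Set (E)} (hΩ : MeasurableSet Ω) (hG : MeasurableSet G) :
    Measurable fun q : E × E => separates Ω G q.1 q.2 := by
  unfold separates
  refine Measurable.ite ?_ measurable_const measurable_const
  have h1 : MeasurableSet {q : E × E | q.1 ∈ Ω} := measurable_fst hΩ
  have h2 : MeasurableSet {q : E × E | q.2 ∈ Ω} := measurable_snd hΩ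
  have h3 : MeasurableSet {q : E × E | q.1 ∈ G} := measurable_fst hG
  have h4 : MeasurableSet {q : E × E | q.2 ∈ G} := measurable_snd hG
  exact (h1.union h2).inter (h3.iff h4).compl

/-- A change of variables in both points moves the deformation from the set to the kernel. The pairs
integrated over no longer depend on t, so t and −t can be compared pair by pair. -/
theorem IsSlideProfile.perimeter_image {η : E → ℝ} {e : E} {L t : ℝ}
    {Ω : Set (E)} (h : IsSlideProfile η e L Ω) (ht : |t| * L < 1) (κ : E → ℝ≥0∞)
    (G : Set (E)) :
    perimeter κ Ω (slide η e t '' G) = ∫⁻ x, ∫⁻ y, separates Ω G x y *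
      (κ (slide η e t x - slide η e t y) * (ENNReal.ofReal (1 + t * fderiv ℝ η x e) *
        ENNReal.ofReal (1 + t * fderiv ℝ η y e))) := by
  rw [perimeter, h.lintegral_comp ht]
  refine lintegral_congr fun x => ?_
  rw [h.lintegral_comp ht, ← lintegral_const_mul' _ _ ENNReal.ofReal_ne_top]
  refine lintegral_congr fun y => ?_
  have hG : ∀ z, slide η e t z ∈ slide η e t '' G ↔ z ∈ G := fun z =>
    (h.injective ht).mem_set_image
  have h1 : separates Ω (slide η e t '' G) (slide η e t x) (slide η e t y) = separates Ω G x y := by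
    classical
    exact if_congr (by rw [h.mem_iff ht, h.mem_iff ht, hG, hG]) rfl rfl
  rw [h1]
  ring

theorem IsSlideProfile.measurable_jacobian {η : E → ℝ} {e : E} (t : ℝ) :
    Measurable fun x => 1 + t * fderiv ℝ η x e :=
  ((measurable_fderiv_apply_const ℝ η e).const_mul t).const_add 1

end Slide

/-- The kernel `|z|^{-(N+s)}` with values in `[0, ∞]`. -/
def eradial (s : ℝ) (z : Space n) : ℝ≥0∞ := ENNReal.ofReal (radial s z)

theorem measurable_eradial (s : ℝ) : Measurable (eradial s : Space n → ℝ≥0∞) :=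
  (measurable_radial s).ennreal_ofReal

theorem IsSlideProfile.radial_second_difference_le {η : Space n → ℝ} {e : Space n} {L t s : ℝ}
    {Ω : Set (Space n)} (h : IsSlideProfile η e L Ω) {q : ℝ} (hs : 0 < s)
    (hq : q = ((n : ℝ) + 1 + s) / 2) (ht : |t| * L * (6 * (1 + q)) ≤ 1) (x y : Space n) :
    radial s (slide η e t x - slide η e t y) *
        ((1 + t * fderiv ℝ η x e) * (1 + t * fderiv ℝ η y e)) +
      radial s (slide η e (-t) x - slide η e (-t) y) *
        ((1 + -t * fderiv ℝ η x e) * (1 + -t * fderiv ℝ η y e)) ≤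
      (2 + 2 * (18 * (2 * q + 4 * q ^ 2) + 1 + 4 * q) * L ^ 2 * t ^ 2) * radial s (x - y) := by
  rcases eq_or_ne x y with rfl | hxy
  · simp [radial_zero hs]
  have hq0 : 0 ≤ q := by rw [hq]; positivity
  set z := x - y with hz
  have hz0 : 0 < ‖z‖ := norm_pos_iff.2 (sub_ne_zero.2 hxy)
  set d := η x - η y with hd
  have hdL : |d| ≤ L * ‖z‖ := h.lipschitz x y
  -- `α` and `β` are the coefficients in |z + τde|² = |z|²(1 + 2τα + τ²β); the Lipschitz bound |d| ≤
  -- L|z| gives |α| ≤ L and β ≤ L².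
  set α := d * inner ℝ z e / ‖z‖ ^ 2 with hα
  set β := d ^ 2 * ‖e‖ ^ 2 / ‖z‖ ^ 2 with hβ
  have hαL : |α| ≤ L := by
    rw [hα, abs_div, abs_of_nonneg (sq_nonneg ‖z‖), div_le_iff₀ (by positivity), abs_mul]
    calc |d| * |inner ℝ z e| ≤ (L * ‖z‖) * (‖z‖ * 1) := by
          gcongr
          · exact (abs_nonneg d).trans hdL
          · exact (abs_real_inner_le_norm z e).trans (by gcongr; exact h.norm_le_one)
      _ = L * ‖z‖ ^ 2 := by ring
  have hβ0 : 0 ≤ β := by positivity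
  have hβL : β ≤ L ^ 2 := by
    rw [hβ, div_le_iff₀ (by positivity), ← sq_abs d, ← mul_pow, ← mul_pow]
    refine pow_le_pow_left₀ (by positivity) ?_ 2
    calc |d| * ‖e‖ ≤ (L * ‖z‖) * 1 := by
          gcongr
          · have := h.nonneg; positivity
          · exact h.norm_le_one
      _ = _ := by ring
  have hkey : ∀ τ : ℝ, 0 ≤ 1 + (2 * τ * α + τ ^ 2 * β) ∧
      radial s (slide η e τ x - slide η e τ y) =
      radial s z * (1 + (2 * τ * α + τ ^ 2 * β)) ^ (-q) := by
    intro τ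
    have h1 : slide η e τ x - slide η e τ y = z + (τ * d) • e := by
      rw [slide, slide, hz, hd, mul_sub, sub_smul]; abel
    have h2 : ‖z + (τ * d) • e‖ ^ 2 = ‖z‖ ^ 2 * (1 + (2 * τ * α + τ ^ 2 * β)) := by
      rw [norm_add_sq_real, inner_smul_right, norm_smul, mul_pow, Real.norm_eq_abs, sq_abs, hα, hβ]
      field_simp
      ring
    have h3 : 0 ≤ 1 + (2 * τ * α + τ ^ 2 * β) := by
      have : 0 ≤ ‖z‖ ^ 2 * (1 + (2 * τ * α + τ ^ 2 * β)) := h2 ▸ sq_nonneg _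
      exact nonneg_of_mul_nonneg_right this (by positivity)
    refine ⟨h3, ?_⟩
    have h4 : ∀ w : Space n, radial s w = (‖w‖ ^ 2) ^ (-q) := fun w => by
      rw [radial, ← Real.rpow_natCast, ← Real.rpow_mul (norm_nonneg _), hq]
      congr 1; push_cast; ring
    rw [h1, h4, h4, h2, Real.mul_rpow (by positivity) h3]
  rw [(hkey t).2, (hkey (-t)).2, mul_assoc, mul_assoc (radial s z), ← mul_add, mul_comm (radial s z)]
  exact mul_le_mul_of_nonneg_right (second_difference_le hq0 h.nonneg ht hαL hβ0 hβL
    (h.fderiv_le x) (h.fderiv_le y)) (radial_nonneg s z)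

/-- An upper bound for the second variation in integrated form. Pairing t with −t removes the first
order term, so no expansion of a single perimeter is needed. -/
theorem IsSlideProfile.perimeter_image_add_le {η : Space n → ℝ} {e : Space n} {L t s : ℝ}
    {Ω : Set (Space n)} (h : IsSlideProfile η e L Ω) (hΩ : MeasurableSet Ω) {q : ℝ} (hs : 0 < s)
    (hq : q = ((n : ℝ) + 1 + s) / 2) (ht : |t| * L * (6 * (1 + q)) ≤ 1)
    {G : Set (Space n)} (hG : MeasurableSet G) :
    perimeter (eradial s) Ω (slide η e t '' G) + perimeter (eradial s) Ω (slide η e (-t) '' G) ≤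
      ENNReal.ofReal (2 + 2 * (18 * (2 * q + 4 * q ^ 2) + 1 + 4 * q) * L ^ 2 * t ^ 2) *
        perimeter (eradial s) Ω G := by
  have hq0 : 0 ≤ q := by rw [hq]; positivity
  have h0 : 0 ≤ |t| * L := mul_nonneg (abs_nonneg t) h.nonneg
  have ht1 : |t| * L < 1 := by nlinarith
  have ht2 : |-t| * L < 1 := by rwa [abs_neg]
  have hJ : ∀ τ, |τ| * L < 1 → ∀ x, 0 ≤ 1 + τ * fderiv ℝ η x e := fun τ hτ x => by
    have h1 : |τ * fderiv ℝ η x e| ≤ |τ| * L := by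
      rw [abs_mul]; gcongr; exact h.fderiv_le x
    have := (abs_le.1 h1).1
    linarith
  have hmeas : ∀ τ, Measurable fun q : Space n × Space n => separates Ω G q.1 q.2 *
      (eradial s (slide η e τ q.1 - slide η e τ q.2) *
        (ENNReal.ofReal (1 + τ * fderiv ℝ η q.1 e) *
          ENNReal.ofReal (1 + τ * fderiv ℝ η q.2 e))) := fun τ => by
    have hsl : Measurable (slide η e τ) := h.continuous.measurable
    exact (measurable_separates hΩ hG).mul (((measurable_eradial s).comp
      ((hsl.comp measurable_fst).sub (hsl.comp measurable_snd))).mul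
      (((measurable_jacobian τ).comp measurable_fst).ennreal_ofReal.mul
      ((measurable_jacobian τ).comp measurable_snd).ennreal_ofReal))
  rw [h.perimeter_image ht1, h.perimeter_image ht2, perimeter,
    ← lintegral_add_left (hmeas t).lintegral_prod_right',
    ← lintegral_const_mul' _ _ ENNReal.ofReal_ne_top]
  refine lintegral_mono fun x => ?_
  dsimp only
  have hx : Measurable fun y => _ := (hmeas t).comp (measurable_prodMk_left (x := x))
  dsimp only [Function.comp_def] at hx
  rw [← lintegral_add_left hx,
    ← lintegral_const_mul' _ _ ENNReal.ofReal_ne_top]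
  refine lintegral_mono fun y => ?_
  rw [← mul_add]
  refine le_trans ?_ (mul_left_comm (separates Ω G x y) _ _).le
  gcongr
  unfold eradial
  rw [← ENNReal.ofReal_mul (hJ t ht1 x), ← ENNReal.ofReal_mul (hJ (-t) ht2 x),
    ← ENNReal.ofReal_mul (radial_nonneg _ _), ← ENNReal.ofReal_mul (radial_nonneg _ _),
    ← ENNReal.ofReal_add, ← ENNReal.ofReal_mul]
  · exact ENNReal.ofReal_le_ofReal (h.radial_second_difference_le hs hq ht x y)
  · positivity
  · exact mul_nonneg (radial_nonneg _ _) (mul_nonneg (hJ t ht1 x) (hJ t ht1 y))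
  · exact mul_nonneg (radial_nonneg _ _) (mul_nonneg (hJ _ ht2 x) (hJ _ ht2 y))

/-! ### Lipschitz and Taylor bounds, uniform on balls. -/

section LocalBounds

variable {V G : Type*} [NormedAddCommGroup V] [NormedSpace ℝ V] [FiniteDimensional ℝ V]
  [NormedAddCommGroup G] [NormedSpace ℝ G]

theorem exists_lipschitz_bound {f : V → G} (hf : ContDiff ℝ 1 f) (R : ℝ) :
    ∃ C, 0 ≤ C ∧ ∀ x y, ‖x‖ ≤ R → ‖y‖ ≤ R → ‖f y - f x‖ ≤ C * ‖y - x‖ := by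
  have hK : IsCompact (closedBall (0 : V) R) := isCompact_closedBall 0 R
  obtain ⟨C, hC⟩ := hK.exists_bound_of_continuousOn (hf.continuous_fderiv one_ne_zero).continuousOn
  refine ⟨max C 0, le_max_right _ _, fun x y hx hy => ?_⟩
  exact (convex_closedBall (0 : V) R).norm_image_sub_le_of_norm_fderiv_le
    (fun z _ => hf.differentiable one_ne_zero z) (fun z hz => (hC z hz).trans (le_max_left _ _))
    (by simpa using hx) (by simpa using hy)

theorem exists_taylor_bound {f : V → G} (hf : ContDiff ℝ 2 f) (R : ℝ) :
    ∃ C, 0 ≤ C ∧ ∀ x z, ‖x‖ ≤ R → ‖z‖ ≤ 1 → ‖f (x + z) - f x - fderiv ℝ f x z‖ ≤ C * ‖z‖ ^ 2 := by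
  have h1 : ContDiff ℝ 1 (fderiv ℝ f) := hf.fderiv_right (by norm_num)
  obtain ⟨C, hC0, hC⟩ := exists_lipschitz_bound h1 (R + 1)
  refine ⟨C, hC0, fun x z hx hz => ?_⟩
  have h2 := (convex_closedBall x ‖z‖).norm_image_sub_le_of_norm_fderiv_le' (f := f)
    (φ := fderiv ℝ f x) (C := C * ‖z‖) (x := x) (y := x + z)
    (fun w _ => hf.differentiable two_ne_zero w) (fun w hw => ?_) (by simp) (by simp)
  · rw [add_sub_cancel_left] at h2
    exact h2.trans_eq (by ring)
  · rw [mem_closedBall, dist_eq_norm] at hw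
    have hw' : ‖w‖ ≤ R + 1 := by
      calc ‖w‖ = ‖x + (w - x)‖ := by rw [add_sub_cancel]
        _ ≤ R + 1 := (norm_add_le _ _).trans (add_le_add hx (hw.trans hz))
    exact (hC x w (by linarith) hw').trans (by gcongr)

end LocalBounds

/-! ### The truncated nonlocal mean curvature of a graph. -/

/-- The horizontal space `ℝ^{N-1}`. -/
abbrev Base (n : ℕ) : Type := EuclideanSpace ℝ (Fin n)

theorem abs_sign_le_one (a : ℝ) : |Real.sign a| ≤ 1 := by
  rcases Real.sign_apply_eq a with h | h | h <;> rw [h] <;> norm_num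

theorem measurable_sign : Measurable Real.sign := by
  unfold Real.sign
  exact Measurable.ite measurableSet_Iio measurable_const
    (Measurable.ite measurableSet_Ioi measurable_const measurable_const)

theorem measurable_fst : Measurable fun x : Space n => x.fst :=
  (by fun_prop : Continuous fun x : Space n => x.fst).measurable

theorem measurable_snd : Measurable fun x : Space n => x.snd :=
  (by fun_prop : Continuous fun x : Space n => x.snd).measurable

theorem volume_graph_eq_zero {G : Base n → ℝ} (hG : Measurable G) :
    volume {z : Space n | z.snd = G z.fst} = 0 := by
  have hm : MeasurableSet {z : Space n | z.snd = G z.fst} :=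
    measurableSet_eq_fun measurable_snd (hG.comp measurable_fst)
  rw [← lintegral_indicator_one hm, lintegral_space (measurable_one.indicator hm)]
  have h1 : ∀ x' : Base n, ∫⁻ τ : ℝ, {z : Space n | z.snd = G z.fst}.indicator (1 : Space n → ℝ≥0∞)
      (WithLp.toLp 2 (x', τ)) = 0 := fun x' => by
    have h2 : ∀ τ : ℝ, {z : Space n | z.snd = G z.fst}.indicator (1 : Space n → ℝ≥0∞)
        (WithLp.toLp 2 (x', τ)) = ({G x'} : Set ℝ).indicator 1 τ := fun τ => by
      by_cases h : τ = G x' <;> simp [indicator, h]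
    simp only [h2]
    rw [lintegral_indicator_one (measurableSet_singleton _)]
    simp
  simp [h1]

/-- Half the difference of the sides of the graph of `F` seen from its point over `x`, truncated at
distance `δ`. -/
def truncatedCurvature (s : ℝ) (F : Base n → ℝ) (δ : ℝ) (x : Base n) : ℝ :=
  ∫ z in (ball (0 : Space n) δ)ᶜ, Real.sign (F (x + z.fst) - F x - z.snd) * radial s z

theorem measurable_sign_mul_radial {F : Base n → ℝ} (hF : Measurable F) (s : ℝ) (x : Base n) :
    Measurable fun z : Space n => Real.sign (F (x + z.fst) - F x - z.snd) * radial s z :=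
  (measurable_sign.comp (((hF.comp (measurable_fst.const_add x)).sub_const _).sub
    measurable_snd)).mul (measurable_radial s)

theorem norm_sign_mul_radial_le (s a : ℝ) (z : Space n) :
    ‖Real.sign a * radial s z‖ ≤ radial s z := by
  rw [norm_mul, Real.norm_eq_abs, Real.norm_of_nonneg (radial_nonneg s z)]
  exact mul_le_of_le_one_left (radial_nonneg s z) (abs_sign_le_one a)

theorem integrableOn_sign_mul_radial {F : Base n → ℝ} (hF : Measurable F) {s : ℝ} (hs : 0 < s)
    {δ : ℝ} (hδ : 0 < δ) (x : Base n) :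
    IntegrableOn (fun z : Space n => Real.sign (F (x + z.fst) - F x - z.snd) * radial s z)
      (ball 0 δ)ᶜ :=
  (integrableOn_radial_compl_ball hs hδ).mono' (measurable_sign_mul_radial hF s x).aestronglyMeasurable
    (ae_of_all _ fun z => norm_sign_mul_radial_le s _ z)

/-- The sign integrand and χ_E − χ_{E^c} disagree only on the graph, where they are 0 and −1, and
the graph is a null set. -/
theorem tendsto_truncatedCurvature {s : ℝ} {F : Base n → ℝ} (hF : Continuous F)
    (hmin : SatisfiesNonlocalMinimalEquation s (subgraph F)) (x : Base n) :
    Tendsto (fun δ => truncatedCurvature s F δ x) (𝓝[>] 0) (𝓝 0) := by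
  have h1 := hmin (graphPoint F x) (by rw [frontier_subgraph hF]; exact mem_range_self x)
  refine h1.congr fun δ => ?_
  rw [truncatedCurvature, ← integral_indicator measurableSet_ball.compl,
    ← integral_indicator measurableSet_ball.compl, ← integral_add_left_eq_self _ (graphPoint F x)]
  have hnull := volume_graph_eq_zero (n := n) (G := fun z => F (x + z) - F x)
    ((hF.measurable.comp (measurable_const_add x)).sub_const _)
  refine integral_congr_ae ?_
  filter_upwards [compl_mem_ae_iff.2 hnull] with z hz
  have hz' : z.snd ≠ F (x + z.fst) - F x := hz
  have hball : graphPoint F x + z ∈ (ball (graphPoint F x) δ)ᶜ ↔ z ∈ (ball (0 : Space n) δ)ᶜ := by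
    simp [dist_eq_norm]
  have hmem : graphPoint F x + z ∈ subgraph F ↔ F x + z.snd < F (x + z.fst) := Iff.rfl
  by_cases hzb : z ∈ (ball (0 : Space n) δ)ᶜ
  · rw [indicator_of_mem hzb, indicator_of_mem (hball.2 hzb), kernel_eq_radial, add_sub_cancel_left]
    congr 1
    by_cases hE : graphPoint F x + z ∈ subgraph F
    · rw [indicator_of_mem hE, indicator_of_notMem (by simpa using hE), sub_zero, Real.sign_of_pos]
      have := hmem.1 hE
      linarith
    · rw [indicator_of_notMem hE, indicator_of_mem (by simpa using hE), zero_sub, Real.sign_of_neg]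
      have := (not_lt.1 (mt hmem.2 hE)).lt_of_ne (fun h => hz' (by linarith))
      linarith
  · rw [indicator_of_notMem hzb, indicator_of_notMem (mt hball.1 hzb)]

/-- Over x' the region has height 2C|x'|² and the kernel is at most |x'|^(−(n+1+s)), so the slice
has mass at most 2C|x'|^(1−s−n), integrable near 0 in ℝ^n since s < 1. Only the height of the slice
matters, hence the uniformity in `l`. -/
theorem lintegral_near_plane_lt_top {s : ℝ} (hs0 : 0 < s) (hs1 : s < 1) {C : ℝ} (hC : 0 ≤ C) :
    ∃ M : ℝ, 0 ≤ M ∧ ∀ l : Base n →L[ℝ] ℝ, ∫⁻ z in ball (0 : Space n) 1,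
      {z : Space n | |z.snd - l z.fst| ≤ C * ‖z.fst‖ ^ 2}.indicator (eradial s) z ≤
        ENNReal.ofReal M := by
  have hint : IntegrableOn (fun z : Base n => 2 * C * ‖z‖ ^ (1 - s - n)) (ball 0 1) :=
    (integrableOn_ball_norm_rpow (E := Base n) volume (α := 1 - s - n)
      (by rw [finrank_euclideanSpace_fin]; linarith) 1).const_mul (2 * C)
  refine ⟨∫ z in ball (0 : Base n) 1, 2 * C * ‖z‖ ^ (1 - s - n), by positivity, fun l => ?_⟩
  rw [ofReal_integral_eq_lintegral_ofReal hint (ae_of_all _ fun z => by positivity)]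
  have hl : Measurable l := l.continuous.measurable
  have hm : MeasurableSet {z : Space n | |z.snd - l z.fst| ≤ C * ‖z.fst‖ ^ 2} :=
    measurableSet_le (measurable_snd.sub (hl.comp measurable_fst)).abs
      ((measurable_fst.norm.pow_const 2).const_mul C)
  rw [← lintegral_indicator measurableSet_ball,
    lintegral_space (((measurable_eradial s).indicator hm).indicator measurableSet_ball),
    ← lintegral_indicator measurableSet_ball]
  refine lintegral_mono fun x' => ?_
  have hn : (0 : ℝ) ≤ n := n.cast_nonneg
  by_cases hx : x' ∈ ball (0 : Base n) 1
  swap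
  · rw [indicator_of_notMem hx, nonpos_iff_eq_zero, lintegral_eq_zero_of_ae_eq_zero]
    refine ae_of_all _ fun τ => indicator_of_notMem (fun h => hx ?_) _
    have h' : ‖(WithLp.toLp 2 (x', τ) : Space n)‖ < 1 := mem_ball_zero_iff.1 h
    exact mem_ball_zero_iff.2 ((norm_fst_le (WithLp.toLp 2 (x', τ) : Space n)).trans_lt h')
  rw [indicator_of_mem hx]
  have hle : ∀ τ : ℝ, (ball (0 : Space n) 1).indicator
      ({z : Space n | |z.snd - l z.fst| ≤ C * ‖z.fst‖ ^ 2}.indicator (eradial s))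
      (WithLp.toLp 2 (x', τ)) ≤
      (Icc (l x' - C * ‖x'‖ ^ 2) (l x' + C * ‖x'‖ ^ 2)).indicator
        (fun _ => ENNReal.ofReal (‖x'‖ ^ (-((n : ℝ) + 1 + s)))) τ := by
    intro τ
    refine (indicator_le_self _ _ _).trans ?_
    by_cases hτ : |τ - l x'| ≤ C * ‖x'‖ ^ 2
    · rw [indicator_of_mem (show (WithLp.toLp 2 (x', τ) : Space n) ∈ _ from hτ), indicator_of_mem
        (by have := abs_le.1 hτ; constructor <;> linarith)]
      refine ENNReal.ofReal_le_ofReal ?_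
      rcases eq_or_ne x' 0 with rfl | hx0
      · have : τ = 0 := by simpa using hτ
        subst this
        refine (radial_zero hs0).le.trans (by positivity)
      · exact radial_le_of_norm_le hs0 (norm_pos_iff.2 hx0) (norm_fst_le (WithLp.toLp 2 (x', τ)))
    · rw [indicator_of_notMem (show (WithLp.toLp 2 (x', τ) : Space n) ∉ _ from hτ)]
      exact zero_le
  refine (lintegral_mono hle).trans ?_
  rw [lintegral_indicator_const measurableSet_Icc, Real.volume_Icc,
    ← ENNReal.ofReal_mul (by positivity)]
  refine ENNReal.ofReal_le_ofReal ?_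
  rcases eq_or_ne x' 0 with rfl | hx0
  · simp; positivity
  · have hx' := norm_pos_iff.2 hx0
    have : ‖x'‖ ^ (1 - s - n) = ‖x'‖ ^ (-((n : ℝ) + 1 + s)) * ‖x'‖ ^ 2 := by
      rw [← Real.rpow_natCast, ← Real.rpow_add hx']
      congr 1; push_cast; ring
    rw [this]
    exact le_of_eq (by ring)

/-- Beyond unit distance the kernel is integrable. Closer in, the contributions of z and −z cancel
unless z is within the quadratic Taylor error of the tangent plane, and that region has finite mass
uniformly in δ and in the tangent plane. -/
theorem exists_truncatedCurvature_bound {s : ℝ} (hs0 : 0 < s) (hs1 : s < 1) {F : Base n → ℝ}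
    (hF : ContDiff ℝ 2 F) (R : ℝ) :
    ∃ M, ∀ x : Base n, ‖x‖ ≤ R → ∀ δ ∈ Ioc (0 : ℝ) 1, |truncatedCurvature s F δ x| ≤ M := by
  obtain ⟨C, hC0, hC⟩ := exists_taylor_bound hF R
  obtain ⟨M, hM0, hM⟩ := lintegral_near_plane_lt_top (n := n) hs0 hs1 hC0
  refine ⟨(∫ z in (ball (0 : Space n) 1)ᶜ, radial s z) + M, fun x hx δ hδ => ?_⟩
  set h : Space n → ℝ := fun z => Real.sign (F (x + z.fst) - F x - z.snd) * radial s z with hh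
  have hmeas : Measurable h := measurable_sign_mul_radial hF.continuous.measurable s x
  set A : Set (Space n) := ball 0 1 \ ball 0 δ with hA
  have hAm : MeasurableSet A := measurableSet_ball.diff measurableSet_ball
  have hsplit : (ball (0 : Space n) δ)ᶜ = (ball 0 1)ᶜ ∪ A := by
    ext z
    have : ‖z‖ < δ → ‖z‖ < 1 := fun h => h.trans_le hδ.2
    simp only [hA, mem_compl_iff, mem_ball_zero_iff, Set.mem_union, Set.mem_sdiff]
    tauto
  have hint := integrableOn_sign_mul_radial hF.continuous.measurable hs0 hδ.1 x
  have hint1 : IntegrableOn h (ball 0 1)ᶜ := hint.mono_set (by rw [hsplit]; exact subset_union_left)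
  have hintA : IntegrableOn h A := hint.mono_set (by rw [hsplit]; exact subset_union_right)
  have hdisj : Disjoint (ball (0 : Space n) 1)ᶜ A := by
    rw [Set.disjoint_left]; rintro z hz ⟨hz', _⟩; exact hz hz'
  have heq : truncatedCurvature s F δ x = (∫ z in (ball (0 : Space n) 1)ᶜ, h z) + ∫ z in A, h z := by
    rw [truncatedCurvature, hsplit, setIntegral_union hdisj hAm hint1 hintA]
  have hfar : |∫ z in (ball (0 : Space n) 1)ᶜ, h z| ≤ ∫ z in (ball (0 : Space n) 1)ᶜ, radial s z :=
    norm_integral_le_of_norm_le (integrableOn_radial_compl_ball hs0 one_pos)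
      (ae_of_all _ fun z => norm_sign_mul_radial_le s _ z)
  have hnegA : ∀ z, -z ∈ A ↔ z ∈ A := fun z => by simp [hA]
  have hneg : ∫ z in A, h (-z) = ∫ z in A, h z := by
    rw [← integral_indicator hAm, ← integral_indicator hAm, ← integral_neg_eq_self]
    refine integral_congr_ae (ae_of_all _ fun z => ?_)
    by_cases hz : z ∈ A
    · simp only [indicator_of_mem hz, indicator_of_mem ((hnegA z).2 hz), neg_neg]
    · simp only [indicator_of_notMem hz, indicator_of_notMem (mt (hnegA z).1 hz)]
  have hintA' : IntegrableOn (fun z => h (-z)) A := by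
    rw [← integrable_indicator_iff hAm] at hintA ⊢
    refine hintA.comp_neg.congr (ae_of_all _ fun z => ?_)
    by_cases hz : z ∈ A
    · simp only [indicator_of_mem hz, indicator_of_mem ((hnegA z).2 hz)]
    · simp only [indicator_of_notMem hz, indicator_of_notMem (mt (hnegA z).1 hz)]
  set bad : Set (Space n) := {z | |z.snd - fderiv ℝ F x z.fst| ≤ C * ‖z.fst‖ ^ 2} with hbad
  have hpt : ∀ z ∈ A, ‖h z + h (-z)‖ₑ ≤ 2 * bad.indicator (eradial s) z := by
    intro z hz
    have hz1 : ‖z.fst‖ ≤ 1 := (norm_fst_le z).trans (mem_ball_zero_iff.1 hz.1).le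
    by_cases hb : z ∈ bad
    · rw [indicator_of_mem hb, eradial, two_mul, ← ENNReal.ofReal_add (radial_nonneg _ _)
        (radial_nonneg _ _), ← ofReal_norm]
      refine ENNReal.ofReal_le_ofReal ((norm_add_le _ _).trans (add_le_add ?_ ?_))
      · exact norm_sign_mul_radial_le s _ z
      · exact (norm_sign_mul_radial_le s _ (-z)).trans_eq (radial_neg s z)
    · have h1 := abs_le.1 (hC x z.fst hx hz1)
      have h2 := abs_le.1 (hC x (-z.fst) hx (by rwa [norm_neg]))
      rw [norm_neg, map_neg] at h2
      have hb' : C * ‖z.fst‖ ^ 2 < |z.snd - fderiv ℝ F x z.fst| := not_le.1 hb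
      have hsum : h z + h (-z) = 0 := by
        simp only [hh, radial_neg, WithLp.neg_fst, WithLp.neg_snd]
        rw [← add_mul]
        rcases lt_abs.1 hb' with h3 | h3
        · rw [Real.sign_of_neg (by linarith), Real.sign_of_pos (by linarith)]; ring
        · rw [Real.sign_of_pos (by linarith), Real.sign_of_neg (by linarith)]; ring
      rw [hsum]; simp
  have hnear : |∫ z in A, h z| ≤ M := by
    have h1 : 2 * ∫ z in A, h z = ∫ z in A, (h z + h (-z)) := by
      rw [integral_add hintA hintA', hneg]; ring
    have h2 : ‖∫ z in A, (h z + h (-z))‖ₑ ≤ 2 * ENNReal.ofReal M := by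
      refine (enorm_integral_le_lintegral_enorm _).trans ?_
      calc ∫⁻ z in A, ‖h z + h (-z)‖ₑ ≤ ∫⁻ z in A, 2 * bad.indicator (eradial s) z :=
            setLIntegral_mono' hAm hpt
        _ = 2 * ∫⁻ z in A, bad.indicator (eradial s) z := lintegral_const_mul' _ _ (by simp)
        _ ≤ 2 * ∫⁻ z in ball 0 1, bad.indicator (eradial s) z := by
            gcongr
            exact Set.sdiff_subset
        _ ≤ _ := by gcongr; exact hM _
    have h3 : 2 * ENNReal.ofReal M = ENNReal.ofReal (2 * M) := by
      rw [ENNReal.ofReal_mul two_pos.le, ENNReal.ofReal_ofNat]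
    rw [← h1, ← ofReal_norm, norm_mul, h3, ENNReal.ofReal_le_ofReal_iff (by positivity)] at h2
    rw [← Real.norm_eq_abs]
    rw [Real.norm_of_nonneg two_pos.le] at h2
    linarith
  rw [heq]
  exact (abs_add_le _ _).trans (add_le_add hfar hnear)

/-! ### Shears of product measures and the truncated kernel. -/

section Shear

variable {E : Type*} [NormedAddCommGroup E] [MeasurableSpace E] [BorelSpace E]
  [SecondCountableTopology E] {μ : Measure E} [SFinite μ] [μ.IsAddLeftInvariant]

theorem integrable_prod_shear_iff {G : Type*} [NormedAddCommGroup G] {f : E × E → G} :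
    Integrable (fun q : E × E => f (q.1, q.1 + q.2)) (μ.prod μ) ↔ Integrable f (μ.prod μ) :=
  (measurePreserving_prod_add μ μ).integrable_comp_emb
    (MeasurableEquiv.shearAddRight E).measurableEmbedding

theorem integral_prod_shear {G : Type*} [NormedAddCommGroup G] [NormedSpace ℝ G] (f : E × E → G) :
    ∫ q : E × E, f (q.1, q.1 + q.2) ∂(μ.prod μ) = ∫ q, f q ∂(μ.prod μ) :=
  (measurePreserving_prod_add μ μ).integral_comp
    (MeasurableEquiv.shearAddRight E).measurableEmbedding f

theorem integrable_mul_comp_sub {u v : E → ℝ} (hu : Integrable u μ) (hv : Integrable v μ) :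
    Integrable (fun q : E × E => u q.1 * v (q.2 - q.1)) (μ.prod μ) := by
  rw [← integrable_prod_shear_iff]
  simpa using hu.mul_prod hv

end Shear

/-- The kernel `|z|^{-(N+s)}` truncated at distance `δ`. -/
def truncRadial (s δ : ℝ) (z : Space n) : ℝ := (ball (0 : Space n) δ)ᶜ.indicator (radial s) z

theorem truncRadial_nonneg (s δ : ℝ) (z : Space n) : 0 ≤ truncRadial s δ z :=
  indicator_nonneg (fun z _ => radial_nonneg s z) z

theorem truncRadial_le (s δ : ℝ) (z : Space n) : truncRadial s δ z ≤ radial s z :=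
  indicator_le_self' (fun z _ => radial_nonneg s z) z

theorem truncRadial_neg (s δ : ℝ) (z : Space n) : truncRadial s δ (-z) = truncRadial s δ z := by
  simp only [truncRadial, indicator, mem_compl_iff, mem_ball_zero_iff, norm_neg, radial_neg]

theorem measurable_truncRadial (s δ : ℝ) : Measurable (truncRadial s δ : Space n → ℝ) :=
  (measurable_radial s).indicator measurableSet_ball.compl

theorem integrable_truncRadial {s δ : ℝ} (hs : 0 < s) (hδ : 0 < δ) :
    Integrable (truncRadial s δ : Space n → ℝ) :=
  (integrable_indicator_iff measurableSet_ball.compl).2 (integrableOn_radial_compl_ball hs hδ)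

theorem tendsto_truncRadial {s : ℝ} (hs : 0 < s) (z : Space n) :
    Tendsto (fun δ => truncRadial s δ z) (𝓝[>] 0) (𝓝 (radial s z)) := by
  rcases eq_or_ne z 0 with rfl | hz
  · rw [radial_zero hs]
    refine tendsto_const_nhds.congr' ?_
    filter_upwards [self_mem_nhdsWithin] with δ (hδ : 0 < δ)
    rw [truncRadial, indicator_of_notMem]
    simpa using hδ
  · refine tendsto_const_nhds.congr' ?_
    have : ∀ᶠ δ : ℝ in 𝓝[>] 0, δ < ‖z‖ :=
      nhdsWithin_le_nhds (Iio_mem_nhds (norm_pos_iff.2 hz))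
    filter_upwards [this] with δ hδ
    rw [truncRadial, indicator_of_mem]
    simpa using hδ.le

theorem truncatedCurvature_eq (s : ℝ) (F : Base n → ℝ) (δ : ℝ) (x : Base n) :
    truncatedCurvature s F δ x =
      ∫ z : Space n, Real.sign (F (x + z.fst) - F x - z.snd) * truncRadial s δ z := by
  rw [truncatedCurvature, ← integral_indicator measurableSet_ball.compl]
  congr 1 with z
  by_cases hz : z ∈ (ball (0 : Space n) δ)ᶜ
  · simp only [truncRadial, indicator_of_mem hz]
  · simp only [truncRadial, indicator_of_notMem hz, mul_zero]

theorem measurable_truncatedCurvature (s : ℝ) {F : Base n → ℝ} (hF : Measurable F) (δ : ℝ) :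
    Measurable (truncatedCurvature s F δ) := by
  have h : StronglyMeasurable fun q : Base n × Space n =>
      Real.sign (F (q.1 + q.2.fst) - F q.1 - q.2.snd) * truncRadial s δ q.2 := by
    refine Measurable.stronglyMeasurable ?_
    have h1 : Measurable fun q : Base n × Space n => q.2.fst := measurable_fst.comp _root_.measurable_snd
    have h2 : Measurable fun q : Base n × Space n => q.2.snd := measurable_snd.comp _root_.measurable_snd
    exact (measurable_sign.comp (((hF.comp (_root_.measurable_fst.add h1)).sub
      (hF.comp _root_.measurable_fst)).sub h2)).mul
      ((measurable_truncRadial s δ).comp _root_.measurable_snd)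
  rw [show truncatedCurvature s F δ = _ from funext fun x => truncatedCurvature_eq s F δ x]
  exact h.integral_prod_right.measurable

/-! ### Calibration: the subgraph minimizes the fractional perimeter. -/

theorem measurableSet_subgraph {F : Base n → ℝ} (hF : Measurable F) :
    MeasurableSet (subgraph F) :=
  measurableSet_lt measurable_snd (hF.comp measurable_fst)

theorem perimeter_eq_lintegral_prod {κ : Space n → ℝ≥0∞} (hκ : Measurable κ)
    {Ω G : Set (Space n)} (hΩ : MeasurableSet Ω) (hG : MeasurableSet G) :
    perimeter κ Ω G = ∫⁻ q : Space n × Space n, separates Ω G q.1 q.2 * κ (q.1 - q.2)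
      ∂(volume.prod volume) := by
  have hm : Measurable fun q : Space n × Space n => separates Ω G q.1 q.2 * κ (q.1 - q.2) :=
    (measurable_separates hΩ hG).mul (hκ.comp (_root_.measurable_fst.sub _root_.measurable_snd))
  rw [lintegral_prod _ hm.aemeasurable, perimeter]

/-- The sign compares the heights of x and y above the graph. On pairs separated by E it equals
χ_E(x) − χ_E(y), so it calibrates E; being at most 1 in modulus, it pairs with χ_G(x) − χ_G(y) to at
most the separation by G. Pairs with no point in Ω contribute nothing because G = E there. -/
theorem calibration_inequality {F : Base n → ℝ} {Ω G : Set (Space n)}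
    (hG : ∀ x ∉ Ω, x ∈ G ↔ x ∈ subgraph F) (x y : Space n) :
    (separates Ω (subgraph F) x y).toReal ≤ (separates Ω G x y).toReal +
      Real.sign (y.snd - F y.fst - (x.snd - F x.fst)) *
        (((subgraph F).indicator 1 x - G.indicator (1 : Space n → ℝ) x) -
          ((subgraph F).indicator 1 y - G.indicator (1 : Space n → ℝ) y)) := by
  have hs := abs_le.1 (abs_sign_le_one (y.snd - F y.fst - (x.snd - F x.fst)))
  have hE : ∀ z, z ∈ subgraph F ↔ z.snd < F z.fst := fun z => Iff.rfl
  have h1 : x ∈ subgraph F → y ∉ subgraph F →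
      Real.sign (y.snd - F y.fst - (x.snd - F x.fst)) = 1 := fun hx hy => by
    rw [hE] at hx hy
    exact Real.sign_of_pos (by linarith)
  have h2 : x ∉ subgraph F → y ∈ subgraph F →
      Real.sign (y.snd - F y.fst - (x.snd - F x.fst)) = -1 := fun hx hy => by
    rw [hE] at hx hy
    exact Real.sign_of_neg (by linarith)
  have hGx := hG x
  have hGy := hG y
  clear hE hG
  generalize Real.sign (y.snd - F y.fst - (x.snd - F x.fst)) = σ at *
  generalize subgraph F = E at *
  by_cases hxE : x ∈ E <;> by_cases hyE : y ∈ E <;>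
    by_cases hxG : x ∈ G <;> by_cases hyG : y ∈ G <;>
    by_cases hxΩ : x ∈ Ω <;> by_cases hyΩ : y ∈ Ω <;>
    simp_all [separates] <;> linarith

/-- The calibration inequality is integrated against the truncated kernel, for which everything
converges absolutely. The level sets of x_N − F(x') are vertical translates of Σ with the same
truncated curvature over x', so the correction is that curvature weighted by χ_E − χ_G. Swapping x
and y reverses the sign function, which produces the factor 2. -/
theorem perimeter_truncRadial_le {s : ℝ} (hs : 0 < s) {F : Base n → ℝ} (hF : Measurable F)
    {Ω G : Set (Space n)} (hΩ : MeasurableSet Ω) (hΩb : volume Ω ≠ ⊤) (hGm : MeasurableSet G)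
    (hG : ∀ x ∉ Ω, x ∈ G ↔ x ∈ subgraph F) {δ : ℝ} (hδ : 0 < δ) :
    perimeter (fun z => ENNReal.ofReal (truncRadial s δ z)) Ω (subgraph F) ≤
      perimeter (fun z => ENNReal.ofReal (truncRadial s δ z)) Ω G + ENNReal.ofReal (-2 *
        ∫ x, ((subgraph F).indicator 1 x - G.indicator (1 : Space n → ℝ) x) *
          truncatedCurvature s F δ x.fst) := by
  have hEm := measurableSet_subgraph hF
  have hκm : Measurable fun z : Space n => ENNReal.ofReal (truncRadial s δ z) :=
    (measurable_truncRadial s δ).ennreal_ofReal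
  have hκi := integrable_truncRadial (n := n) hs hδ
  set ξ : Space n → ℝ := fun x => (subgraph F).indicator 1 x - G.indicator (1 : Space n → ℝ) x with hξ
  set f : Space n × Space n → ℝ := fun q =>
    Real.sign (q.2.snd - F q.2.fst - (q.1.snd - F q.1.fst)) with hf
  have hfm : Measurable f := measurable_sign.comp
    (((measurable_snd.comp _root_.measurable_snd).sub (hF.comp (measurable_fst.comp _root_.measurable_snd))).sub
      ((measurable_snd.comp _root_.measurable_fst).sub (hF.comp (measurable_fst.comp _root_.measurable_fst))))
  have hξm : Measurable ξ := (measurable_one.indicator hEm).sub (measurable_one.indicator hGm)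
  have hξΩ : ∀ x, ‖ξ x‖ ≤ Ω.indicator 1 x := fun x => by
    have := hG x
    by_cases hx : x ∈ Ω <;> by_cases hxE : x ∈ subgraph F <;> by_cases hxG : x ∈ G <;>
      simp_all
  have hΩi : Integrable (Ω.indicator (1 : Space n → ℝ)) :=
    (integrable_indicator_iff hΩ).2 (integrableOn_const hΩb)
  have hdom : Integrable (fun q : Space n × Space n => Ω.indicator (1 : Space n → ℝ) q.1 *
      truncRadial s δ (q.2 - q.1)) (volume.prod volume) := integrable_mul_comp_sub hΩi hκi
  have hdom' := hdom.swap
  have hκ2 : Measurable fun q : Space n × Space n => truncRadial s δ (q.1 - q.2) :=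
    (measurable_truncRadial s δ).comp (_root_.measurable_fst.sub _root_.measurable_snd)
  have hsym : ∀ x y : Space n, truncRadial s δ (x - y) = truncRadial s δ (y - x) := fun x y => by
    rw [← neg_sub, truncRadial_neg]
  have hsepi : ∀ H : Set (Space n), MeasurableSet H → Integrable (fun q : Space n × Space n =>
      (separates Ω H q.1 q.2).toReal * truncRadial s δ (q.1 - q.2)) (volume.prod volume) := by
    intro H hH
    refine (hdom.add hdom').mono' ((measurable_separates hΩ hH).ennreal_toReal.mul
      hκ2).aestronglyMeasurable (ae_of_all _ fun q => ?_)
    have h0 := truncRadial_nonneg s δ (q.1 - q.2)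
    rw [norm_mul, Real.norm_of_nonneg ENNReal.toReal_nonneg, Real.norm_of_nonneg h0]
    simp only [Pi.add_apply, Function.comp_apply, Prod.fst_swap, Prod.snd_swap]
    rw [← hsym q.1 q.2, ← add_mul]
    gcongr
    unfold separates
    by_cases h1 : q.1 ∈ Ω <;> by_cases h2 : q.2 ∈ Ω <;> by_cases h3 : q.1 ∈ H <;>
      by_cases h4 : q.2 ∈ H <;> simp [h1, h2, h3, h4]
  have hper : ∀ H : Set (Space n), MeasurableSet H →
      perimeter (fun z => ENNReal.ofReal (truncRadial s δ z)) Ω H = ENNReal.ofReal (∫ q : Space n × Space n,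
        (separates Ω H q.1 q.2).toReal * truncRadial s δ (q.1 - q.2) ∂(volume.prod volume)) := by
    intro H hH
    rw [perimeter_eq_lintegral_prod hκm hΩ hH, ofReal_integral_eq_lintegral_ofReal (hsepi H hH)
      (ae_of_all _ fun q => mul_nonneg ENNReal.toReal_nonneg (truncRadial_nonneg _ _ _))]
    refine lintegral_congr fun q => ?_
    rw [ENNReal.ofReal_mul ENNReal.toReal_nonneg, ENNReal.ofReal_toReal]
    unfold separates
    split_ifs <;> simp
  have hI1 : Integrable (fun q : Space n × Space n => f q * ξ q.1 * truncRadial s δ (q.1 - q.2))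
      (volume.prod volume) := by
    refine hdom.mono' ((hfm.mul (hξm.comp _root_.measurable_fst)).mul hκ2).aestronglyMeasurable
      (ae_of_all _ fun q => ?_)
    rw [norm_mul, norm_mul, Real.norm_of_nonneg (truncRadial_nonneg s δ _), hsym]
    gcongr
    · exact truncRadial_nonneg _ _ _
    · exact (mul_le_of_le_one_left (norm_nonneg _) (abs_sign_le_one _)).trans (hξΩ q.1)
  have hanti : ∀ q : Space n × Space n, f q.swap = - f q := fun q => by
    simp only [hf, Prod.fst_swap, Prod.snd_swap]
    rw [← Real.sign_neg, neg_sub]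
  have hI2 : Integrable (fun q : Space n × Space n => f q * ξ q.2 * truncRadial s δ (q.1 - q.2))
      (volume.prod volume) := by
    refine hI1.swap.neg.congr (ae_of_all _ fun q => ?_)
    simp only [Pi.neg_apply, Function.comp_apply, hanti, Prod.fst_swap, Prod.snd_swap, hsym q.2 q.1]
    ring
  have hE1 : ∫ q : Space n × Space n, f q * ξ q.1 * truncRadial s δ (q.1 - q.2)
      ∂(volume.prod volume) = -∫ x, ξ x * truncatedCurvature s F δ x.fst := by
    rw [integral_prod _ hI1, ← integral_neg]
    refine integral_congr_ae (ae_of_all _ fun x => ?_)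
    dsimp only
    rw [truncatedCurvature_eq, ← integral_const_mul, ← integral_neg,
      ← integral_add_left_eq_self _ x]
    refine integral_congr_ae (ae_of_all _ fun z => ?_)
    simp only [hf, WithLp.add_fst, WithLp.add_snd]
    rw [hsym, add_sub_cancel_left, show x.snd + z.snd - F (x.fst + z.fst) - (x.snd - F x.fst) =
      -(F (x.fst + z.fst) - F x.fst - z.snd) by ring, Real.sign_neg]
    ring
  have hE2 : ∫ q : Space n × Space n, f q * ξ q.2 * truncRadial s δ (q.1 - q.2)
      ∂(volume.prod volume) = ∫ x, ξ x * truncatedCurvature s F δ x.fst := by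
    rw [← neg_inj, ← hE1, ← integral_neg, ← integral_prod_swap]
    refine integral_congr_ae (ae_of_all _ fun q => ?_)
    simp only [hanti, Prod.fst_swap, Prod.snd_swap, hsym q.2 q.1]
    ring
  rw [hper _ hEm, hper _ hGm]
  refine (ENNReal.ofReal_le_ofReal ?_).trans ENNReal.ofReal_add_le
  have h3 : -2 * ∫ x, ξ x * truncatedCurvature s F δ x.fst = ∫ q : Space n × Space n,
      (f q * ξ q.1 * truncRadial s δ (q.1 - q.2) - f q * ξ q.2 * truncRadial s δ (q.1 - q.2))
      ∂(volume.prod volume) := by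
    rw [integral_sub hI1 hI2, hE1, hE2]; ring
  have hI12 := hI1.sub hI2
  simp only [Pi.sub_def] at hI12
  rw [h3, ← integral_add (hsepi G hGm) hI12]
  refine integral_mono (hsepi _ hEm) ((hsepi G hGm).add hI12) fun q => ?_
  have h4 := mul_le_mul_of_nonneg_right (calibration_inequality hG q.1 q.2)
    (truncRadial_nonneg s δ (q.1 - q.2))
  refine h4.trans_eq ?_
  simp only [hf, hξ]
  ring

/-- The subgraph of an entire `s`-minimal graph minimizes the `s`-perimeter in bounded sets. -/
theorem perimeter_subgraph_le {s : ℝ} (hs0 : 0 < s) (hs1 : s < 1) {F : Base n → ℝ}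
    (hF : ContDiff ℝ 2 F) (hmin : SatisfiesNonlocalMinimalEquation s (subgraph F))
    {Ω G : Set (Space n)} (hΩ : MeasurableSet Ω) (hΩb : Bornology.IsBounded Ω)
    (hGm : MeasurableSet G) (hG : ∀ x ∉ Ω, x ∈ G ↔ x ∈ subgraph F) :
    perimeter (eradial s) Ω (subgraph F) ≤ perimeter (eradial s) Ω G := by
  have hEm := measurableSet_subgraph hF.continuous.measurable
  have hΩv : volume Ω ≠ ⊤ := hΩb.measure_lt_top.ne
  set ξ : Space n → ℝ := fun x => (subgraph F).indicator 1 x - G.indicator (1 : Space n → ℝ) x with hξ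
  have hξm : Measurable ξ := (measurable_one.indicator hEm).sub (measurable_one.indicator hGm)
  have hξΩ : ∀ x, ‖ξ x‖ ≤ Ω.indicator 1 x := fun x => by
    have := hG x
    by_cases hx : x ∈ Ω <;> by_cases hxE : x ∈ subgraph F <;> by_cases hxG : x ∈ G <;>
      simp_all
  have hΩi : Integrable (Ω.indicator (1 : Space n → ℝ)) :=
    (integrable_indicator_iff hΩ).2 (integrableOn_const hΩv)
  obtain ⟨R, hR⟩ := hΩb.exists_norm_le
  obtain ⟨M, hM⟩ := exists_truncatedCurvature_bound hs0 hs1 hF R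
  -- The truncated curvatures tend to 0 and are uniformly bounded over the bounded set Ω, off which
  -- `ξ` vanishes.
  have hlim : Tendsto (fun δ => -2 * ∫ x, ξ x * truncatedCurvature s F δ x.fst) (𝓝[>] 0) (𝓝 0) := by
    have h1 : Tendsto (fun δ => ∫ x, ξ x * truncatedCurvature s F δ x.fst) (𝓝[>] 0)
        (𝓝 (∫ x, ξ x * (0 : ℝ))) := by
      refine tendsto_integral_filter_of_dominated_convergence (fun x => Ω.indicator 1 x * M) ?_ ?_
        (hΩi.mul_const M) ?_
      · exact Eventually.of_forall fun δ => (hξm.mul ((measurable_truncatedCurvature s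
          hF.continuous.measurable δ).comp measurable_fst)).aestronglyMeasurable
      · filter_upwards [Ioc_mem_nhdsGT one_pos] with δ hδ
        refine ae_of_all _ fun x => ?_
        rw [norm_mul]
        by_cases hx : x ∈ Ω
        · refine mul_le_mul (hξΩ x) ?_ (norm_nonneg _) ((norm_nonneg _).trans (hξΩ x))
          · exact hM _ ((norm_fst_le x).trans (hR x hx)) δ hδ
        · have h0 := hξΩ x
          rw [indicator_of_notMem hx] at h0
          rw [indicator_of_notMem hx, le_antisymm h0 (norm_nonneg _)]
          simp
      · exact ae_of_all _ fun x => (tendsto_truncatedCurvature hF.continuous hmin x.fst).const_mul _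
    simpa using h1.const_mul (-2)
  obtain ⟨δ, hδ0, hδ⟩ : ∃ δ : ℕ → ℝ, (∀ k, 0 < δ k) ∧ Tendsto δ atTop (𝓝[>] 0) :=
    ⟨fun k => 1 / ((k : ℝ) + 1), fun k => by positivity,
      tendsto_nhdsWithin_iff.2 ⟨tendsto_one_div_add_atTop_nhds_zero_nat,
        Eventually.of_forall fun k => by rw [mem_Ioi]; positivity⟩⟩
  have hκm : ∀ δ, Measurable fun z : Space n => ENNReal.ofReal (truncRadial s δ z) := fun δ =>
    (measurable_truncRadial s δ).ennreal_ofReal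
  -- Finiteness of the perimeter of E is not yet known; Fatou does not need it.
  have hfatou : perimeter (eradial s) Ω (subgraph F) ≤ liminf (fun k =>
      perimeter (fun z => ENNReal.ofReal (truncRadial s (δ k) z)) Ω (subgraph F)) atTop := by
    rw [perimeter_eq_lintegral_prod (measurable_eradial s) hΩ hEm]
    simp only [perimeter_eq_lintegral_prod (hκm _) hΩ hEm]
    refine le_trans (lintegral_mono fun q => ?_) (lintegral_liminf_le fun k =>
      (measurable_separates hΩ hEm).mul ((hκm (δ k)).comp
        (_root_.measurable_fst.sub _root_.measurable_snd)))
    have h1 : Tendsto (fun k => separates Ω (subgraph F) q.1 q.2 *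
        ENNReal.ofReal (truncRadial s (δ k) (q.1 - q.2))) atTop
        (𝓝 (separates Ω (subgraph F) q.1 q.2 * eradial s (q.1 - q.2))) := by
      refine ENNReal.Tendsto.const_mul ?_ (Or.inr ?_)
      · exact ENNReal.tendsto_ofReal ((tendsto_truncRadial hs0 _).comp hδ)
      · unfold separates; split_ifs <;> simp
    exact h1.liminf_eq.ge
  refine hfatou.trans ?_
  have hub : Tendsto (fun k => perimeter (eradial s) Ω G +
      ENNReal.ofReal (-2 * ∫ x, ξ x * truncatedCurvature s F (δ k) x.fst)) atTop
      (𝓝 (perimeter (eradial s) Ω G + 0)) := by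
    refine tendsto_const_nhds.add ?_
    simpa using ENNReal.tendsto_ofReal (hlim.comp hδ)
  rw [add_zero] at hub
  rw [← hub.liminf_eq]
  refine liminf_le_liminf (Eventually.of_forall fun k => ?_)
  refine (perimeter_truncRadial_le hs0 hF.continuous.measurable hΩ hΩv hGm hG (hδ0 k)).trans ?_
  gcongr
  unfold perimeter
  gcongr
  exact ENNReal.ofReal_le_ofReal (truncRadial_le _ _ _)

/-! ### Competitors, interaction and the translation estimate. -/

theorem exists_slideProfile (E : Type*) [NormedAddCommGroup E] [InnerProductSpace ℝ E]
    [FiniteDimensional ℝ E] : ∃ L : ℝ, 1 ≤ L ∧ ∀ p e : E, ‖e‖ ≤ 1 →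
    ∃ η : E → ℝ, IsSlideProfile η e L (ball p 3) ∧ ∀ x ∈ closedBall p 2, η x = 1 := by
  -- The inner radius is 2 so that a point of the unit ball, moved by a vector of length at most 1,
  -- stays where the profile is 1.
  let b : ContDiffBump (0 : E) := ⟨2, 3, by norm_num, by norm_num⟩
  have hb : ContDiff ℝ 1 b := b.contDiff
  obtain ⟨L, hL⟩ := (hb.continuous_fderiv one_ne_zero).bounded_above_of_compact_support
    (b.hasCompactSupport.fderiv (𝕜 := ℝ))
  have hbd : Differentiable ℝ b := hb.differentiable one_ne_zero
  refine ⟨max L 1, le_max_right _ _, fun p e he => ⟨fun x => b (x - p), ?_, ?_⟩⟩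
  · have hd : ∀ x, HasFDerivAt (fun x => b (x - p)) (fderiv ℝ b (x - p)) x := fun x => by
      have := (hbd (x - p)).hasFDerivAt.comp x ((hasFDerivAt_id x).sub_const p)
      rwa [ContinuousLinearMap.comp_id] at this
    refine ⟨fun x => (hd x).differentiableAt, fun x y => ?_, fun x => ?_, fun x => ?_,
      fun x hx => ?_, he, le_max_of_le_right zero_le_one⟩
    · have := convex_univ.norm_image_sub_le_of_norm_fderiv_le (𝕜 := ℝ) (f := b) (C := max L 1)
        (x := y - p) (y := x - p)
        (fun z _ => hbd z) (fun z _ => (hL z).trans (le_max_left _ _)) (mem_univ _) (mem_univ _)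
      simpa using this
    · rw [(hd x).fderiv]
      have h1 := (fderiv ℝ b (x - p)).le_opNorm e
      have h2 : ‖fderiv ℝ b (x - p)‖ * ‖e‖ ≤ max L 1 * 1 :=
        mul_le_mul ((hL _).trans (le_max_left _ _)) he (norm_nonneg _)
          (le_max_of_le_right zero_le_one)
      rw [mul_one] at h2
      exact h1.trans h2
    · rw [abs_of_nonneg b.nonneg]; exact b.le_one
    · refine b.zero_of_le_dist ?_
      simpa [dist_eq_norm] using hx
  · intro x hx
    refine b.one_of_mem_closedBall ?_
    simpa [dist_eq_norm] using hx

/-- A set emptied in the ball separates, among pairs meeting the ball, only pairs with one point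
inside and one outside; their mass is that of the perimeter of the ball. As a competitor it bounds
the perimeter of every minimizer in terms of n and s alone. -/
theorem exists_perimeter_sdiff_ball_le (n : ℕ) {s : ℝ} (hs0 : 0 < s) (hs1 : s < 1) :
    ∃ C : ℝ, 0 ≤ C ∧ ∀ (p : Space n) (G : Set (Space n)), MeasurableSet G →
      perimeter (eradial s) (ball p 3) (G \ ball p 3) ≤ ENNReal.ofReal C := by
  obtain ⟨C, hC, hp⟩ := exists_lintegral_ball_compl_le n hs0 hs1 (r := 3) (by norm_num)
  refine ⟨2 * C.toReal, by positivity, fun p G hG => ?_⟩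
  set B : Set (Space n) := ball p 3
  have hB : MeasurableSet B := measurableSet_ball
  have hk : Measurable fun q : Space n × Space n => eradial s (q.1 - q.2) :=
    (measurable_eradial s).comp (_root_.measurable_fst.sub _root_.measurable_snd)
  have h1 : Measurable fun q : Space n × Space n => B.indicator (1 : Space n → ℝ≥0∞) q.1 *
      (Bᶜ.indicator 1 q.2 * eradial s (q.1 - q.2)) :=
    ((measurable_one.indicator hB).comp _root_.measurable_fst).mul
      (((measurable_one.indicator hB.compl).comp _root_.measurable_snd).mul hk)
  have h2 : Measurable fun q : Space n × Space n => Bᶜ.indicator (1 : Space n → ℝ≥0∞) q.1 *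
      (B.indicator 1 q.2 * eradial s (q.1 - q.2)) :=
    ((measurable_one.indicator hB.compl).comp _root_.measurable_fst).mul
      (((measurable_one.indicator hB).comp _root_.measurable_snd).mul hk)
  have hI : ∫⁻ x, ∫⁻ y, B.indicator (1 : Space n → ℝ≥0∞) x *
      (Bᶜ.indicator 1 y * eradial s (x - y)) ≤ C := by
    refine le_trans (le_of_eq ?_) (hp p)
    rw [← lintegral_indicator hB]
    refine lintegral_congr fun x => ?_
    by_cases hx : x ∈ B
    · simp only [indicator_of_mem hx, Pi.one_apply, one_mul]
      rw [← lintegral_indicator hB.compl]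
      refine lintegral_congr fun y => ?_
      by_cases hy : y ∈ Bᶜ
      · simp only [indicator_of_mem hy, Pi.one_apply, one_mul, eradial]
      · simp only [indicator_of_notMem hy, zero_mul]
    · simp only [indicator_of_notMem hx, zero_mul, lintegral_zero]
  have hI2 : ∫⁻ x, ∫⁻ y, Bᶜ.indicator (1 : Space n → ℝ≥0∞) x *
      (B.indicator 1 y * eradial s (x - y)) ≤ C := by
    rw [lintegral_lintegral_swap h2.aemeasurable]
    refine le_trans (le_of_eq ?_) hI
    refine lintegral_congr fun x => lintegral_congr fun y => ?_
    rw [eradial, eradial, ← neg_sub, radial_neg]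
    ring
  have hsum : ∫⁻ x, ∫⁻ y, (B.indicator (1 : Space n → ℝ≥0∞) x *
      (Bᶜ.indicator 1 y * eradial s (x - y)) + Bᶜ.indicator (1 : Space n → ℝ≥0∞) x *
        (B.indicator 1 y * eradial s (x - y))) ≤ C + C := by
    refine le_trans (le_of_eq ?_) (add_le_add hI hI2)
    rw [← lintegral_add_left h1.lintegral_prod_right']
    refine lintegral_congr fun x => ?_
    have h3 : Measurable fun y => B.indicator (1 : Space n → ℝ≥0∞) x *
      (Bᶜ.indicator 1 y * eradial s (x - y)) :=
      ((measurable_one.indicator hB.compl).mul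
        ((measurable_eradial s).comp (measurable_id.const_sub x))).const_mul _
    rw [lintegral_add_left h3]
  have hC2 : C + C = ENNReal.ofReal (2 * C.toReal) := by
    rw [ENNReal.ofReal_mul two_pos.le, ENNReal.ofReal_toReal hC, ENNReal.ofReal_ofNat, two_mul]
  rw [← hC2, perimeter]
  have hpt : ∀ x y : Space n, separates B (G \ B) x y * eradial s (x - y) ≤
      B.indicator (1 : Space n → ℝ≥0∞) x * (Bᶜ.indicator 1 y * eradial s (x - y)) +
        Bᶜ.indicator (1 : Space n → ℝ≥0∞) x * (B.indicator 1 y * eradial s (x - y)) := by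
    intro x y
    have hle : separates B (G \ B) x y ≤ 1 := by unfold separates; split_ifs <;> simp
    by_cases hx : x ∈ B <;> by_cases hy : y ∈ B
    · simp [separates, hx, hy]
    · simpa [hx, hy] using mul_le_of_le_one_left zero_le hle
    · simpa [hx, hy] using mul_le_of_le_one_left zero_le hle
    · simp [separates, hx, hy]
  exact (lintegral_mono fun x => lintegral_mono (hpt x)).trans hsum

/-- Submodularity of the perimeter, with the interaction of the two differences. -/
theorem perimeter_union_add_perimeter_inter_le {κ : Space n → ℝ≥0∞} (hκ : Measurable κ)
    {Ω G H A D : Set (Space n)} (hΩ : MeasurableSet Ω) (hG : MeasurableSet G)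
    (hH : MeasurableSet H) (hA : MeasurableSet A) (hD : MeasurableSet D) (hAG : A ⊆ G \ H)
    (hDH : D ⊆ H \ G) (hAΩ : A ⊆ Ω) :
    perimeter κ Ω (G ∪ H) + perimeter κ Ω (G ∩ H) + 2 * ∫⁻ q in A ×ˢ D, κ (q.1 - q.2)
      ∂((volume : Measure (Space n)).prod volume) ≤ perimeter κ Ω G + perimeter κ Ω H := by
  have hk : Measurable fun q : Space n × Space n => κ (q.1 - q.2) :=
    hκ.comp (_root_.measurable_fst.sub _root_.measurable_snd)
  have hm : ∀ K : Set (Space n), MeasurableSet K → Measurable fun q : Space n × Space n =>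
      separates Ω K q.1 q.2 * κ (q.1 - q.2) := fun K hK => (measurable_separates hΩ hK).mul hk
  have hsum : Measurable fun q : Space n × Space n => separates Ω (G ∪ H) q.1 q.2 * κ (q.1 - q.2) +
      separates Ω (G ∩ H) q.1 q.2 * κ (q.1 - q.2) := (hm _ (hG.union hH)).add (hm _ (hG.inter hH))
  rw [perimeter_eq_lintegral_prod hκ hΩ hG, perimeter_eq_lintegral_prod hκ hΩ hH,
    perimeter_eq_lintegral_prod hκ hΩ (hG.union hH), perimeter_eq_lintegral_prod hκ hΩ (hG.inter hH),
    ← lintegral_indicator (hA.prod hD), ← lintegral_const_mul' _ _ (by simp),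
    ← lintegral_add_left (hm _ (hG.union hH)), ← lintegral_add_left (hm _ hG),
    ← lintegral_add_left hsum]
  refine lintegral_mono fun q => ?_
  obtain ⟨x, y⟩ := q
  dsimp only
  have hx := @hAG x
  have hy := @hDH y
  have hxΩ := @hAΩ x
  have hind : (A ×ˢ D).indicator (fun q : Space n × Space n => κ (q.1 - q.2)) (x, y) =
      (A ×ˢ D).indicator 1 (x, y) * κ (x - y) := by
    by_cases h : (x, y) ∈ A ×ˢ D <;> simp only [indicator, h] <;> simp
  rw [hind, ← mul_assoc, ← add_mul, ← add_mul, ← add_mul]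
  gcongr ?_ * _
  simp only [Set.mem_sdiff] at hx hy
  -- For x in G \ H and y in H \ G, both G and H separate the pair while neither the union nor the
  -- intersection does: this is the gain of 2.
  by_cases h : x ∈ A ∧ y ∈ D
  · obtain ⟨h1, h2⟩ := hx h.1
    obtain ⟨h3, h4⟩ := hy h.2
    have := hxΩ h.1
    have h5 : (x, y) ∈ A ×ˢ D := h
    rw [indicator_of_mem h5]
    simp [separates, h1, h2, h3, h4, this]
    norm_num
  · have h5 : (x, y) ∉ A ×ˢ D := h
    rw [indicator_of_notMem h5, mul_zero, add_zero]
    unfold separates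
    by_cases hΩ' : x ∈ Ω ∨ y ∈ Ω
    · by_cases hxG : x ∈ G <;> by_cases hxH : x ∈ H <;> by_cases hyG : y ∈ G <;>
        by_cases hyH : y ∈ H <;> simp [hΩ', hxG, hxH, hyG, hyH]
    · simp [hΩ']

theorem IsSlideProfile.mem_image_iff_of_notMem {E : Type*} [NormedAddCommGroup E]
    [InnerProductSpace ℝ E] [FiniteDimensional ℝ E] [MeasurableSpace E] [BorelSpace E]
    {η : E → ℝ} {e : E} {L t : ℝ} {Ω : Set E}
    (h : IsSlideProfile η e L Ω) (ht : |t| * L < 1) (G : Set E) {x : E} (hx : x ∉ Ω) :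
    x ∈ slide η e t '' G ↔ x ∈ G := by
  have h1 : slide η e t x = x := by rw [slide, h.eq_zero x hx]; simp
  conv_lhs => rw [← h1]
  exact (h.injective ht).mem_set_image

theorem IsSlideProfile.mem_image_iff_sub_mem {E : Type*} [NormedAddCommGroup E]
    [InnerProductSpace ℝ E] [FiniteDimensional ℝ E] [MeasurableSpace E] [BorelSpace E]
    {η : E → ℝ} {e : E} {L t : ℝ} {Ω : Set E}
    (h : IsSlideProfile η e L Ω) (ht : |t| * L < 1) (G : Set E) {x : E}
    (hx : η (x - t • e) = 1) : x ∈ slide η e t '' G ↔ x - t • e ∈ G := by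
  have h1 : slide η e t (x - t • e) = x := by rw [slide, hx]; simp
  conv_lhs => rw [← h1]
  exact (h.injective ht).mem_set_image

theorem IsSlideProfile.measurableSet_image {E : Type*} [NormedAddCommGroup E]
    [InnerProductSpace ℝ E] [FiniteDimensional ℝ E] [MeasurableSpace E] [BorelSpace E]
    {η : E → ℝ} {e : E} {L t : ℝ} {Ω : Set E}
    (h : IsSlideProfile η e L Ω) (ht : |t| * L < 1) {G : Set E} (hG : MeasurableSet G) :
    MeasurableSet (slide η e t '' G) :=
  hG.image_of_continuousOn_injOn h.continuous.continuousOn (h.injective ht).injOn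

/-- Three copies of the finite P are added to both sides in place of a subtraction in `ℝ≥0∞`:
minimality pays for U, I and S', and the second variation bounds S + S'. -/
theorem two_mul_interaction_le {P U I S S' X c : ℝ≥0∞} (hP : P ≠ ⊤) (hU : P ≤ U) (hI : P ≤ I)
    (hS' : P ≤ S') (hsub : U + I + 2 * X ≤ P + S) (hsum : S + S' ≤ (2 + c) * P) :
    2 * X ≤ c * P := by
  have h1 : (P + P + P) + 2 * X ≤ (P + P + P) + c * P := by
    calc (P + P + P) + 2 * X = (P + P + 2 * X) + P := by ring
      _ ≤ (U + I + 2 * X) + S' := by gcongr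
      _ ≤ (P + S) + S' := by gcongr
      _ = P + (S + S') := by ring
      _ ≤ P + (2 + c) * P := by gcongr
      _ = _ := by ring
  exact (ENNReal.add_le_add_iff_left (by simp [hP])).1 h1

/-- E is compared with its union and intersection with the slid set S, with the slide S' in the
opposite direction, and with E minus the ball, which bounds P. The excess Ct²P left by the second
variation controls the interaction term of submodularity. The set `H` is S, a pure translate of E
inside the unit ball. -/
theorem exists_interaction_le (n : ℕ) {s : ℝ} (hs0 : 0 < s) (hs1 : s < 1) :
    ∃ C t₀ : ℝ, 0 ≤ C ∧ 0 < t₀ ∧ t₀ ≤ 1 ∧ ∀ F : Base n → ℝ, ContDiff ℝ 2 F →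
      SatisfiesNonlocalMinimalEquation s (subgraph F) → ∀ p e : Space n, ‖e‖ ≤ 1 →
      ∀ t ∈ Ioc 0 t₀, ∃ H : Set (Space n), MeasurableSet H ∧
        (∀ x ∈ ball p 1, x ∈ H ↔ x - t • e ∈ subgraph F) ∧
        ∫⁻ q in (ball p 1 ∩ (subgraph F \ H)) ×ˢ (ball p 1 ∩ (H \ subgraph F)),
          eradial s (q.1 - q.2) ∂((volume : Measure (Space n)).prod volume) ≤
            ENNReal.ofReal (C * t ^ 2) := by
  obtain ⟨L, hL1, hprof⟩ := exists_slideProfile (Space n)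
  obtain ⟨P₀, hP₀, hper⟩ := exists_perimeter_sdiff_ball_le n hs0 hs1
  set q : ℝ := ((n : ℝ) + 1 + s) / 2 with hq
  have hq0 : 0 ≤ q := by rw [hq]; positivity
  set c : ℝ := 2 * (18 * (2 * q + 4 * q ^ 2) + 1 + 4 * q) * L ^ 2 with hc
  have hc0 : 0 ≤ c := by positivity
  have hD : 1 ≤ L * (6 * (1 + q)) := by nlinarith
  -- The threshold for t is the smallness demanded by `second_difference_le`; the constant is the
  -- second variation constant times the universal bound for P.
  refine ⟨c * P₀, 1 / (L * (6 * (1 + q))), by positivity, by positivity,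
    (div_le_one (by linarith)).2 hD, ?_⟩
  intro F hF hmin p e he t ht
  obtain ⟨η, hη, hη1⟩ := hprof p e he
  have htD : |t| * L * (6 * (1 + q)) ≤ 1 := by
    rw [abs_of_pos ht.1, mul_assoc]
    exact (le_div_iff₀ (by linarith)).1 ht.2
  have htL0 : 0 ≤ |t| * L := by positivity
  have htL : |t| * L < 1 := by nlinarith
  have htL' : |-t| * L < 1 := by rwa [abs_neg]
  have hEm := measurableSet_subgraph hF.continuous.measurable
  set E := subgraph F with hE
  set S := slide η e t '' E
  set S' := slide η e (-t) '' E
  have hSm : MeasurableSet S := hη.measurableSet_image htL hEm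
  have hSm' : MeasurableSet S' := hη.measurableSet_image htL' hEm
  have hS : ∀ x ∉ ball p 3, x ∈ S ↔ x ∈ E := fun x hx => hη.mem_image_iff_of_notMem htL E hx
  have hS' : ∀ x ∉ ball p 3, x ∈ S' ↔ x ∈ E := fun x hx => hη.mem_image_iff_of_notMem htL' E hx
  have hcomp : ∀ G, MeasurableSet G → (∀ x ∉ ball p 3, x ∈ G ↔ x ∈ E) →
      perimeter (eradial s) (ball p 3) E ≤ perimeter (eradial s) (ball p 3) G := fun G hG h =>
    perimeter_subgraph_le hs0 hs1 hF hmin measurableSet_ball isBounded_ball hG h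
  have hPE : perimeter (eradial s) (ball p 3) E ≤ ENNReal.ofReal P₀ :=
    (hcomp (E \ ball p 3) (hEm.diff measurableSet_ball) (fun x hx => by simp only [Set.mem_sdiff]; tauto)).trans
      (hper p E hEm)
  refine ⟨S, hSm, fun x hx => hη.mem_image_iff_sub_mem htL E (hη1 _ ?_), ?_⟩
  · rw [mem_ball, dist_eq_norm] at hx
    rw [mem_closedBall, dist_eq_norm, sub_right_comm]
    have h1 : ‖t • e‖ ≤ 1 := by
      have h2 : t ≤ 1 := by nlinarith [abs_of_pos ht.1]
      rw [norm_smul, Real.norm_of_nonneg ht.1.le]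
      nlinarith [norm_nonneg e, ht.1]
    linarith [norm_sub_le (x - p) (t • e)]
  have hA : ball p 1 ∩ (E \ S) ⊆ ball p 3 := fun x hx => ball_subset_ball (by norm_num) hx.1
  have hsub := perimeter_union_add_perimeter_inter_le (measurable_eradial s)
    (measurableSet_ball (x := p) (ε := 3)) hEm hSm
    ((measurableSet_ball (x := p) (ε := 1)).inter (hEm.diff hSm))
    ((measurableSet_ball (x := p) (ε := 1)).inter (hSm.diff hEm)) inter_subset_right inter_subset_right hA
  have hsum := hη.perimeter_image_add_le measurableSet_ball hs0 hq htD hEm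
  rw [ENNReal.ofReal_add two_pos.le (by positivity), ENNReal.ofReal_ofNat, ← hc] at hsum
  have h2 := two_mul_interaction_le (hPE.trans_lt ENNReal.ofReal_lt_top).ne
    (hcomp _ (hEm.union hSm) fun x hx => by rw [Set.mem_union, hS x hx, or_self])
    (hcomp _ (hEm.inter hSm) fun x hx => by rw [Set.mem_inter_iff, hS x hx, and_self])
    (hcomp _ hSm' hS') hsub hsum
  refine (le_mul_of_one_le_left zero_le one_le_two).trans (h2.trans ?_)
  rw [mul_right_comm c P₀, ENNReal.ofReal_mul (by positivity : 0 ≤ c * t ^ 2)]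
  gcongr

/-- Let a and d be the volumes in the unit ball of E \ H and H \ E. The kernel is at least
2^(−(N+s)) on distinct points of that ball, so the interaction bound gives ad ≤ Ct². Also a − d is a
difference of volumes of a set and its translate in the ball, hence |a − d| ≤ Ct. Then (a+d)² =
(a−d)² + 4ad yields a linear bound for a + d. -/
theorem exists_volume_translate_le (n : ℕ) {s : ℝ} (hs0 : 0 < s) (hs1 : s < 1) :
    ∃ C t₀ : ℝ, 0 ≤ C ∧ 0 < t₀ ∧ ∀ F : Base n → ℝ, ContDiff ℝ 2 F →
      SatisfiesNonlocalMinimalEquation s (subgraph F) → ∀ p e : Space n, ‖e‖ ≤ 1 →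
      ∀ t ∈ Ioc 0 t₀, volume (ball p 1 ∩ {x | ¬(x ∈ subgraph F ↔ x - t • e ∈ subgraph F)}) ≤
        ENNReal.ofReal (C * t) := by
  obtain ⟨C₁, t₀, hC₁, ht₀, ht₀1, hint⟩ := exists_interaction_le n hs0 hs1
  obtain ⟨C₂, hC₂, hball⟩ := exists_volume_ball_diff_le n one_pos
  set k : ℝ := (2 : ℝ) ^ (-((n : ℝ) + 1 + s)) with hk
  have hk0 : 0 < k := by positivity
  refine ⟨Real.sqrt (C₂ ^ 2 + 4 * (C₁ / k)), t₀, Real.sqrt_nonneg _, ht₀, ?_⟩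
  intro F hF hmin p e he t ht
  obtain ⟨H, hHm, hH, hI⟩ := hint F hF hmin p e he t ht
  have hEm := measurableSet_subgraph hF.continuous.measurable
  set E := subgraph F
  set B : Set (Space n) := ball p 1 with hB
  have hBm : MeasurableSet B := measurableSet_ball
  have hfin : ∀ K : Set (Space n), volume (B ∩ K) ≠ ⊤ := fun K =>
    ((measure_mono inter_subset_left).trans_lt measure_ball_lt_top).ne
  set a := (volume (B ∩ (E \ H))).toReal with ha
  set d := (volume (B ∩ (H \ E))).toReal with hd
  have hnorm : ‖t • e‖ ≤ t := by
    rw [norm_smul, Real.norm_of_nonneg ht.1.le]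
    exact mul_le_of_le_one_right ht.1.le he
  have hmin1 : ∀ v : Space n, ‖v‖ ≤ t → C₂ * min 1 ‖v‖ ≤ C₂ * t := fun v hv => by
    gcongr; exact (min_le_right _ _).trans hv
  have hprod : a * d ≤ C₁ / k * t ^ 2 := by
    have h1 : ENNReal.ofReal k * (volume (B ∩ (E \ H)) * volume (B ∩ (H \ E))) ≤
        ENNReal.ofReal (C₁ * t ^ 2) := by
      refine le_trans ?_ hI
      rw [← Measure.prod_prod, ← setLIntegral_const]
      refine setLIntegral_mono' ((hBm.inter (hEm.diff hHm)).prod (hBm.inter (hHm.diff hEm)))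
        fun q hq => ENNReal.ofReal_le_ofReal ?_
      obtain ⟨⟨h1, h2, h3⟩, ⟨h4, h5, h6⟩⟩ := hq
      have hne : q.1 - q.2 ≠ 0 := fun h => h3 (by rw [sub_eq_zero.1 h]; exact h5)
      rw [hB, mem_ball] at h1 h4
      have hlt : ‖q.1 - q.2‖ ≤ 2 := by
        rw [← dist_eq_norm]
        linarith [dist_triangle_right q.1 q.2 p]
      exact Real.rpow_le_rpow_of_nonpos (norm_pos_iff.2 hne) hlt
        (by have : (0 : ℝ) ≤ n := n.cast_nonneg
            linarith)
    rw [← ENNReal.ofReal_toReal (hfin (E \ H)), ← ENNReal.ofReal_toReal (hfin (H \ E)),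
      ← ENNReal.ofReal_mul (by positivity), ← ENNReal.ofReal_mul hk0.le,
      ENNReal.ofReal_le_ofReal_iff (by have := ht.1; positivity)] at h1
    rw [div_mul_eq_mul_div, le_div_iff₀ hk0]
    linarith
  -- Translating back, the set E is unchanged and only the ball moves, which costs O(t) in volume.
  have hshift : volume (B ∩ H) = volume (E ∩ ball (p - t • e) 1) := by
    have h1 : B ∩ H = (fun x => x + -(t • e)) ⁻¹' (E ∩ ball (p - t • e) 1) := by
      ext x
      have h2 : x ∈ B ↔ x + -(t • e) ∈ ball (p - t • e) 1 := by
        simp only [hB, mem_ball, dist_eq_norm]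
        rw [← sub_eq_add_neg, sub_sub_sub_cancel_right]
      rw [mem_preimage, Set.mem_inter_iff, Set.mem_inter_iff, ← h2, ← sub_eq_add_neg]
      constructor
      · rintro ⟨h3, h4⟩; exact ⟨(hH x h3).1 h4, h3⟩
      · rintro ⟨h3, h4⟩; exact ⟨h4, (hH x h4).2 h3⟩
    rw [h1, measure_preimage_add_right]
  have hle1 : volume (B ∩ E) ≤ volume (B ∩ H) + ENNReal.ofReal (C₂ * t) := by
    rw [hshift]
    calc volume (B ∩ E) ≤ volume ((E ∩ ball (p - t • e) 1) ∪ (B \ ball (p + -(t • e)) 1)) := by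
          refine measure_mono fun x hx => ?_
          rw [← sub_eq_add_neg]
          by_cases h : x ∈ ball (p - t • e) 1
          · exact Or.inl ⟨hx.2, h⟩
          · exact Or.inr ⟨hx.1, h⟩
      _ ≤ _ := (measure_union_le _ _).trans (by
          gcongr
          exact (hball _ _).trans (ENNReal.ofReal_le_ofReal (hmin1 _ (by rwa [norm_neg]))))
  have hle2 : volume (B ∩ H) ≤ volume (B ∩ E) + ENNReal.ofReal (C₂ * t) := by
    rw [hshift]
    calc volume (E ∩ ball (p - t • e) 1) ≤
        volume ((B ∩ E) ∪ (ball (p - t • e) 1 \ ball (p - t • e + t • e) 1)) := by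
          refine measure_mono fun x hx => ?_
          rw [sub_add_cancel]
          by_cases h : x ∈ ball p 1
          · exact Or.inl ⟨h, hx.1⟩
          · exact Or.inr ⟨hx.2, h⟩
      _ ≤ _ := (measure_union_le _ _).trans (by
          gcongr
          exact (hball _ _).trans (ENNReal.ofReal_le_ofReal (hmin1 _ hnorm)))
  have hsplit : ∀ K K' : Set (Space n), MeasurableSet K' →
      volume (B ∩ K) = volume (B ∩ (K ∩ K')) + volume (B ∩ (K \ K')) := fun K K' hK' => by
    rw [← measure_inter_add_sdiff (B ∩ K) hK', inter_assoc, inter_sdiff_assoc]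
  have had : |a - d| ≤ C₂ * t := by
    have hC₂t : 0 ≤ C₂ * t := mul_nonneg hC₂ ht.1.le
    rw [hsplit E H hHm, hsplit H E hEm, inter_comm H E] at hle1 hle2
    rw [add_assoc, ENNReal.add_le_add_iff_left (hfin _)] at hle1 hle2
    have h1 := ENNReal.toReal_mono (ENNReal.add_ne_top.2 ⟨hfin _, ENNReal.ofReal_ne_top⟩) hle1
    have h2 := ENNReal.toReal_mono (ENNReal.add_ne_top.2 ⟨hfin _, ENNReal.ofReal_ne_top⟩) hle2
    rw [ENNReal.toReal_add (hfin _) ENNReal.ofReal_ne_top, ENNReal.toReal_ofReal hC₂t] at h1 h2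
    rw [abs_le]
    constructor <;> linarith
  have hfinal : a + d ≤ Real.sqrt (C₂ ^ 2 + 4 * (C₁ / k)) * t := by
    refine le_of_sq_le_sq ?_ (by have := ht.1; positivity)
    rw [mul_pow, Real.sq_sqrt (by positivity)]
    have h1 := pow_le_pow_left₀ (abs_nonneg _) had 2
    rw [sq_abs, mul_pow] at h1
    nlinarith
  calc volume (B ∩ {x | ¬(x ∈ E ↔ x - t • e ∈ E)})
      ≤ volume ((B ∩ (E \ H)) ∪ (B ∩ (H \ E))) := by
        refine measure_mono ?_
        rintro x ⟨hx, hx'⟩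
        have hx'' : ¬(x ∈ E ↔ x ∈ H) := by rw [hH x hx]; exact hx'
        by_cases h1 : x ∈ E <;> by_cases h2 : x ∈ H
        · exact absurd (iff_of_true h1 h2) hx''
        · exact Or.inl ⟨hx, h1, h2⟩
        · exact Or.inr ⟨hx, h2, h1⟩
        · exact absurd (iff_of_false h1 h2) hx''
    _ ≤ volume (B ∩ (E \ H)) + volume (B ∩ (H \ E)) := measure_union_le _ _
    _ = ENNReal.ofReal (a + d) := by
        rw [ENNReal.ofReal_add ENNReal.toReal_nonneg ENNReal.toReal_nonneg,
          ENNReal.ofReal_toReal (hfin _), ENNReal.ofReal_toReal (hfin _)]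
    _ ≤ _ := ENNReal.ofReal_le_ofReal hfinal

/-! ### From the translation estimate to area bounds. -/

theorem continuous_graphPoint {F : Base n → ℝ} (hF : Continuous F) : Continuous (graphPoint F) := by
  unfold graphPoint
  fun_prop

/-- The horizontal vector `(e, 0)`. -/
def horizontal (e : Base n) : Space n := WithLp.toLp 2 (e, 0)

theorem norm_horizontal (e : Base n) : ‖horizontal e‖ = ‖e‖ := by
  have := WithLp.prod_norm_sq_eq_of_L2 (horizontal e)
  rw [show (horizontal e).fst = e from rfl, show (horizontal e).snd = 0 from rfl, norm_zero] at this
  nlinarith [norm_nonneg e, norm_nonneg (horizontal e), sq_nonneg (‖horizontal e‖ - ‖e‖)]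

/-- Over x the symmetric difference of E and its translate contains the interval between F(x) and
F(x−te), which lies in the ball for small t; its length divided by t tends to |∂_eF(x)|. -/
theorem fderiv_le_liminf_volume {F : Base n → ℝ} (hF : ContDiff ℝ 2 F) (p : Space n) (e x : Base n)
    (hx : graphPoint F x ∈ ball p 1) {t : ℕ → ℝ} (ht : Tendsto t atTop (𝓝[>] 0)) :
    ENNReal.ofReal |fderiv ℝ F x e| ≤ liminf (fun k => ENNReal.ofReal (t k)⁻¹ *
      volume {τ : ℝ | (WithLp.toLp 2 (x, τ) : Space n) ∈ ball p 1 ∧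
        ¬(τ < F x ↔ τ < F (x - t k • e))}) atTop := by
  have ht0 : Tendsto t atTop (𝓝 0) := (tendsto_nhdsWithin_iff.1 ht).1
  have htpos : ∀ᶠ k in atTop, 0 < t k := (tendsto_nhdsWithin_iff.1 ht).2
  have hderiv : HasDerivAt (fun r : ℝ => F (x - r • e)) (fderiv ℝ F x (-e)) 0 := by
    have h1 : HasDerivAt (fun r : ℝ => x - r • e) (-e) 0 := by
      simpa using ((hasDerivAt_id (0 : ℝ)).smul_const e).const_sub x
    have h2 : HasFDerivAt F (fderiv ℝ F x) (x - (0 : ℝ) • e) := by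
      rw [zero_smul, sub_zero]
      exact (hF.differentiable two_ne_zero x).hasFDerivAt
    exact h2.comp_hasDerivAt 0 h1
  have hslope : Tendsto (fun k => ENNReal.ofReal ((t k)⁻¹ * |F (x - t k • e) - F x|)) atTop
      (𝓝 (ENNReal.ofReal |fderiv ℝ F x e|)) := by
    have h1 := (hderiv.tendsto_slope_zero_right.comp ht).abs
    rw [map_neg, abs_neg] at h1
    refine ENNReal.tendsto_ofReal (h1.congr' ?_)
    filter_upwards [htpos] with k hk
    simp [abs_mul, abs_of_pos hk]
  rw [← hslope.liminf_eq]
  refine liminf_le_liminf ?_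
  have hcont : Continuous fun τ : ℝ => (WithLp.toLp 2 (x, τ) : Space n) := by fun_prop
  obtain ⟨ε, hε, hball⟩ := Metric.isOpen_iff.1 (isOpen_ball.preimage hcont) (F x) hx
  have hFt : Tendsto (fun k => F (x - t k • e)) atTop (𝓝 (F x)) := by
    have : Tendsto (fun k => x - t k • e) atTop (𝓝 (x - (0 : ℝ) • e)) :=
      tendsto_const_nhds.sub (ht0.smul_const e)
    rw [zero_smul, sub_zero] at this
    exact (hF.continuous.tendsto x).comp this
  filter_upwards [htpos, hFt (Metric.ball_mem_nhds _ hε)] with k hk hk2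
  rw [ENNReal.ofReal_mul (by positivity)]
  gcongr
  rw [← max_sub_min_eq_abs, ← Real.volume_Ico]
  refine measure_mono fun τ hτ => ⟨hball ?_, ?_⟩
  · rw [mem_preimage, Metric.mem_ball, Real.dist_eq] at hk2
    rw [Metric.mem_ball, Real.dist_eq]
    have h1 := abs_lt.1 hk2
    obtain ⟨h2, h3⟩ := hτ
    rw [abs_lt]
    rcases le_total (F (x - t k • e)) (F x) with h | h
    · rw [min_eq_right h] at h2
      rw [max_eq_left h] at h3
      constructor <;> linarith
    · rw [min_eq_left h] at h2
      rw [max_eq_right h] at h3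
      constructor <;> linarith
  · obtain ⟨h2, h3⟩ := hτ
    rcases le_total (F (x - t k • e)) (F x) with h | h
    · rw [min_eq_right h] at h2
      rw [max_eq_left h] at h3
      intro h4; exact absurd (h4.1 h3) (not_lt.2 h2)
    · rw [min_eq_left h] at h2
      rw [max_eq_right h] at h3
      intro h4; exact absurd (h4.2 h3) (not_lt.2 h2)

/-- Horizontal translations in `exists_volume_translate_le`, divided by t: Fubini over vertical
lines and Fatou in t. -/
theorem exists_lintegral_fderiv_le (n : ℕ) {s : ℝ} (hs0 : 0 < s) (hs1 : s < 1) :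
    ∃ C : ℝ, 0 ≤ C ∧ ∀ F : Base n → ℝ, ContDiff ℝ 2 F →
      SatisfiesNonlocalMinimalEquation s (subgraph F) → ∀ (p : Space n) (e : Base n), ‖e‖ ≤ 1 →
      ∫⁻ x in {x | graphPoint F x ∈ ball p 1}, ENNReal.ofReal |fderiv ℝ F x e| ≤
        ENNReal.ofReal C := by
  obtain ⟨C, t₀, hC, ht₀, hvol⟩ := exists_volume_translate_le n hs0 hs1
  refine ⟨C, hC, fun F hF hmin p e he => ?_⟩
  obtain ⟨t, ht, htl⟩ : ∃ t : ℕ → ℝ, (∀ k, t k ∈ Ioc 0 t₀) ∧ Tendsto t atTop (𝓝[>] 0) := by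
    refine ⟨fun k => t₀ * (1 / ((k : ℝ) + 1)), fun k => ⟨by positivity, ?_⟩,
      tendsto_nhdsWithin_iff.2 ⟨?_, Eventually.of_forall fun k => by rw [mem_Ioi]; positivity⟩⟩
    · refine mul_le_of_le_one_right ht₀.le ((div_le_one (by positivity)).2 ?_)
      have : (0 : ℝ) ≤ k := k.cast_nonneg
      linarith
    · simpa using tendsto_one_div_add_atTop_nhds_zero_nat.const_mul t₀
  have hEm := measurableSet_subgraph hF.continuous.measurable
  have hBm : MeasurableSet {x | graphPoint F x ∈ ball p 1} :=
    (continuous_graphPoint hF.continuous).measurable measurableSet_ball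
  set D : ℕ → Set (Space n) := fun k =>
    ball p 1 ∩ {x | ¬(x ∈ subgraph F ↔ x - t k • horizontal e ∈ subgraph F)} with hD
  have hDm : ∀ k, MeasurableSet (D k) := fun k => by
    refine measurableSet_ball.inter (MeasurableSet.compl ?_)
    exact hEm.iff ((measurable_id.sub_const _) hEm)
  have hDset : ∀ k (x : Base n), {τ : ℝ | (WithLp.toLp 2 (x, τ) : Space n) ∈ ball p 1 ∧
        ¬(τ < F x ↔ τ < F (x - t k • e))} = {τ : ℝ | (WithLp.toLp 2 (x, τ) : Space n) ∈ D k} := by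
    intro k x
    ext τ
    have h1 : ((WithLp.toLp 2 (x, τ) : Space n) - t k • horizontal e ∈ subgraph F) ↔
        τ < F (x - t k • e) := by
      change τ - t k * 0 < F (x - t k • e) ↔ _
      rw [mul_zero, sub_zero]
    have h2 : ((WithLp.toLp 2 (x, τ) : Space n) ∈ subgraph F) ↔ τ < F x := Iff.rfl
    simp only [hD, Set.mem_inter_iff, Set.mem_ofPred_eq, h1, h2]
  have hmeasD : ∀ k, Measurable fun x : Base n =>
      volume {τ : ℝ | (WithLp.toLp 2 (x, τ) : Space n) ∈ D k} := fun k =>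
    measurable_measure_prodMk_left (measurableEmbedding_toLp.measurable (hDm k))
  have hvolD : ∀ k, ∫⁻ x : Base n, volume {τ : ℝ | (WithLp.toLp 2 (x, τ) : Space n) ∈ D k} =
      volume (D k) := fun k => by
    rw [← measurePreserving_toLp.measure_preimage (hDm k).nullMeasurableSet,
      Measure.volume_eq_prod, Measure.prod_apply (measurableEmbedding_toLp.measurable (hDm k))]
    rfl
  calc ∫⁻ x in {x | graphPoint F x ∈ ball p 1}, ENNReal.ofReal |fderiv ℝ F x e|
      ≤ ∫⁻ x in {x | graphPoint F x ∈ ball p 1}, liminf (fun k => ENNReal.ofReal (t k)⁻¹ *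
          volume {τ : ℝ | (WithLp.toLp 2 (x, τ) : Space n) ∈ D k}) atTop := by
        refine setLIntegral_mono' hBm fun x hx => ?_
        simp only [← hDset]
        exact fderiv_le_liminf_volume hF p e x hx htl
    _ ≤ ∫⁻ x, liminf (fun k => ENNReal.ofReal (t k)⁻¹ *
          volume {τ : ℝ | (WithLp.toLp 2 (x, τ) : Space n) ∈ D k}) atTop :=
        setLIntegral_le_lintegral _ _
    _ ≤ liminf (fun k => ∫⁻ x : Base n, ENNReal.ofReal (t k)⁻¹ *
          volume {τ : ℝ | (WithLp.toLp 2 (x, τ) : Space n) ∈ D k}) atTop :=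
        lintegral_liminf_le fun k => (hmeasD k).const_mul _
    _ ≤ liminf (fun _ : ℕ => ENNReal.ofReal C) atTop := by
        refine liminf_le_liminf (Eventually.of_forall fun k => ?_)
        have htk := (ht k).1
        rw [lintegral_const_mul _ (hmeasD k), hvolD k]
        refine (mul_le_mul_right (hvol F hF hmin p (horizontal e) (by rwa [norm_horizontal]) (t k)
          (ht k)) _).trans ?_
        rw [← ENNReal.ofReal_mul (by positivity)]
        refine ENNReal.ofReal_le_ofReal (le_of_eq ?_)
        field_simp
    _ = ENNReal.ofReal C := by simp

/-- The density of the surface measure of the graph of `F`. -/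
def areaDensity (F : Base n → ℝ) (x : Base n) : ℝ := Real.sqrt (1 + ‖∇ F x‖ ^ 2)

theorem one_le_areaDensity (F : Base n → ℝ) (x : Base n) : 1 ≤ areaDensity F x :=
  Real.one_le_sqrt.2 (by nlinarith [sq_nonneg ‖∇ F x‖])

theorem norm_gradient (F : Base n → ℝ) (x : Base n) : ‖∇ F x‖ = ‖fderiv ℝ F x‖ := by
  rw [gradient, LinearIsometryEquiv.norm_map]

theorem areaDensity_le (F : Base n → ℝ) (x : Base n) :
    areaDensity F x ≤ 1 + ∑ i, |fderiv ℝ F x (EuclideanSpace.single i 1)| := by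
  have h1 : areaDensity F x ≤ 1 + ‖∇ F x‖ := by
    rw [areaDensity, Real.sqrt_le_left (by positivity)]
    nlinarith [norm_nonneg (∇ F x)]
  refine h1.trans ?_
  rw [norm_gradient]
  gcongr
  refine ContinuousLinearMap.opNorm_le_bound _ (by positivity) fun v => ?_
  have hv : v = ∑ i, v i • EuclideanSpace.single i (1 : ℝ) := by
    simpa using ((EuclideanSpace.basisFun (Fin n) ℝ).sum_repr v).symm
  conv_lhs => rw [hv]
  rw [map_sum, Finset.sum_mul]
  refine (norm_sum_le _ _).trans (Finset.sum_le_sum fun i _ => ?_)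
  rw [map_smul, norm_smul, mul_comm]
  gcongr
  · exact le_rfl
  · exact PiLp.norm_apply_le v i

theorem continuous_areaDensity {F : Base n → ℝ} (hF : ContDiff ℝ 1 F) :
    Continuous (areaDensity F) := by
  have h1 : Continuous fun x => ‖∇ F x‖ := by
    simp only [norm_gradient]
    exact (hF.continuous_fderiv one_ne_zero).norm
  unfold areaDensity
  fun_prop

/-- Since W ≤ 1 + Σ|∂_iF|, the gradient bound controls everything except the constant 1, and the
base points under a unit ball lie in a unit ball of ℝ^n. -/
theorem exists_area_unit_ball_le (n : ℕ) {s : ℝ} (hs0 : 0 < s) (hs1 : s < 1) :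
    ∃ A : ℝ≥0∞, A ≠ ⊤ ∧ ∀ F : Base n → ℝ, ContDiff ℝ 2 F →
      SatisfiesNonlocalMinimalEquation s (subgraph F) → ∀ p : Space n,
      ∫⁻ x in {x | graphPoint F x ∈ ball p 1}, ENNReal.ofReal (areaDensity F x) ≤ A := by
  obtain ⟨C, hC, hgrad⟩ := exists_lintegral_fderiv_le n hs0 hs1
  refine ⟨volume (ball (0 : Base n) 1) + ∑ _i : Fin n, ENNReal.ofReal C,
    ENNReal.add_ne_top.2 ⟨measure_ball_lt_top.ne, by simp [ENNReal.mul_eq_top]⟩,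
    fun F hF hmin p => ?_⟩
  have hm : ∀ i : Fin n, Measurable fun x =>
      ENNReal.ofReal |fderiv ℝ F x (EuclideanSpace.single i 1)| := fun i =>
    (measurable_fderiv_apply_const ℝ F _).abs.ennreal_ofReal
  calc ∫⁻ x in {x | graphPoint F x ∈ ball p 1}, ENNReal.ofReal (areaDensity F x)
      ≤ ∫⁻ x in {x | graphPoint F x ∈ ball p 1},
          (1 + ∑ i, ENNReal.ofReal |fderiv ℝ F x (EuclideanSpace.single i 1)|) := by
        refine lintegral_mono fun x => (ENNReal.ofReal_le_ofReal (areaDensity_le F x)).trans ?_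
        rw [ENNReal.ofReal_add zero_le_one (by positivity), ENNReal.ofReal_one,
          ENNReal.ofReal_sum_of_nonneg fun i _ => abs_nonneg _]
    _ = volume {x | graphPoint F x ∈ ball p 1} + ∑ i, ∫⁻ x in {x | graphPoint F x ∈ ball p 1},
          ENNReal.ofReal |fderiv ℝ F x (EuclideanSpace.single i 1)| := by
        rw [lintegral_add_left measurable_const, lintegral_finsetSum _ fun i _ => hm i]
        simp
    _ ≤ _ := by
        refine add_le_add ?_ (Finset.sum_le_sum fun i _ => ?_)
        · refine le_trans (measure_mono fun x hx => ?_)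
            (Measure.addHaar_ball_center volume p.fst 1).le
          have hx' : dist (graphPoint F x) p < 1 := hx
          rw [dist_eq_norm] at hx'
          rw [mem_ball, dist_eq_norm]
          exact (norm_fst_le (graphPoint F x - p)).trans_lt hx'
        · exact hgrad F hF hmin p _ (by simp)

/-- The area of an entire `s`-minimal graph has tempered growth, uniformly in the base point. -/
theorem exists_weighted_area_le (n : ℕ) {s : ℝ} (hs0 : 0 < s) (hs1 : s < 1) :
    ∃ A : ℝ≥0∞, A ≠ ⊤ ∧ ∀ F : Base n → ℝ, ContDiff ℝ 2 F →
      SatisfiesNonlocalMinimalEquation s (subgraph F) → ∀ p : Space n,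
      ∫⁻ x, ENNReal.ofReal (areaDensity F x) *
        ENNReal.ofReal ((1 + ‖graphPoint F x - p‖) ^ (-((n : ℝ) + 1 + s))) ≤ A := by
  obtain ⟨A, hA, hball⟩ := exists_area_unit_ball_le n hs0 hs1
  have hn : (0 : ℝ) ≤ n := n.cast_nonneg
  have hint : Integrable fun w : Space n => (1 + ‖w‖) ^ (-((n : ℝ) + 1 + s)) :=
    integrable_one_add_norm (by rw [finrank_space]; push_cast; linarith)
  set V : ℝ≥0∞ := volume (ball (0 : Space n) 1) with hV
  have hV0 : V ≠ 0 := (measure_ball_pos volume _ one_pos).ne'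
  have hVt : V ≠ ⊤ := measure_ball_lt_top.ne
  set c : ℝ≥0∞ := ENNReal.ofReal ((2 : ℝ) ^ (-((n : ℝ) + 1 + s))) with hc
  have hc0 : c ≠ 0 := by rw [hc, Ne, ENNReal.ofReal_eq_zero, not_le]; positivity
  set J : ℝ≥0∞ := ∫⁻ w : Space n, ENNReal.ofReal ((1 + ‖w‖) ^ (-((n : ℝ) + 1 + s))) with hJ
  have hJt : J ≠ ⊤ := hint.lintegral_lt_top.ne
  refine ⟨(c * V)⁻¹ * (A * J), ENNReal.mul_ne_top (by simp [hc0, hV0])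
    (ENNReal.mul_ne_top hA hJt), fun F hF hmin p => ?_⟩
  have hgm : Measurable (graphPoint F) := (continuous_graphPoint hF.continuous).measurable
  have hWm : Measurable fun x => ENNReal.ofReal (areaDensity F x) :=
    (continuous_areaDensity (hF.of_le one_le_two)).measurable.ennreal_ofReal
  have hρm : Measurable fun w : Space n => ENNReal.ofReal ((1 + ‖w - p‖) ^ (-((n : ℝ) + 1 + s))) :=
    (((measurable_id.sub_const p).norm.const_add 1).pow_const _).ennreal_ofReal
  set T : Set (Base n × Space n) := {q | dist (graphPoint F q.1) q.2 < 1}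
  have hT : ∀ x w, (x, w) ∈ T ↔ dist (graphPoint F x) w < 1 := fun x w => Iff.rfl
  set Φ : Base n × Space n → ℝ≥0∞ := fun q => T.indicator 1 q *
      (ENNReal.ofReal (areaDensity F q.1) *
        ENNReal.ofReal ((1 + ‖q.2 - p‖) ^ (-((n : ℝ) + 1 + s)))) with hΦ
  have hΦm : Measurable Φ := by
    refine (measurable_one.indicator (measurableSet_lt ((hgm.comp _root_.measurable_fst).dist
      _root_.measurable_snd) measurable_const)).mul ((hWm.comp _root_.measurable_fst).mul
        (hρm.comp _root_.measurable_snd))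
  -- Fubini for the pairs (x,w) with w within distance 1 of the graph point over x. Integrated in x
  -- first, the area bound for the unit ball at w applies.
  have hupper : ∫⁻ w, ∫⁻ x, Φ (x, w) ≤ A * J := by
    have h1 : ∀ w, ∫⁻ x, Φ (x, w) ≤
        A * ENNReal.ofReal ((1 + ‖w - p‖) ^ (-((n : ℝ) + 1 + s))) := by
      intro w
      refine le_trans (le_of_eq ?_) (mul_le_mul_left (hball F hF hmin w) _)
      have hset : MeasurableSet {x | graphPoint F x ∈ ball w 1} := hgm measurableSet_ball
      rw [← lintegral_indicator hset,
        ← lintegral_mul_const' _ _ ENNReal.ofReal_ne_top]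
      refine lintegral_congr fun x => ?_
      by_cases h : dist (graphPoint F x) w < 1
      · rw [hΦ, indicator_of_mem (show x ∈ {x | graphPoint F x ∈ ball w 1} from h)]
        dsimp only
        rw [indicator_of_mem ((hT x w).2 h)]
        simp
      · rw [hΦ, indicator_of_notMem (show x ∉ {x | graphPoint F x ∈ ball w 1} from h)]
        dsimp only
        rw [indicator_of_notMem (mt (hT x w).1 h)]
        simp
    refine (lintegral_mono h1).trans ?_
    rw [lintegral_const_mul _ hρm]
    gcongr
    rw [hJ, lintegral_sub_right_eq_self (fun w : Space n =>
      ENNReal.ofReal ((1 + ‖w‖) ^ (-((n : ℝ) + 1 + s)))) p]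
  -- For such pairs 1 + |w − p| is at most twice 1 plus the distance of the graph point to p, whence
  -- `c`; the admissible w fill a unit ball, whence `V`.
  have hlower : c * V * ∫⁻ x, ENNReal.ofReal (areaDensity F x) *
        ENNReal.ofReal ((1 + ‖graphPoint F x - p‖) ^ (-((n : ℝ) + 1 + s))) ≤
      ∫⁻ x, ∫⁻ w, Φ (x, w) := by
    rw [← lintegral_const_mul' _ _ (ENNReal.mul_ne_top (by simp [hc]) hVt)]
    refine lintegral_mono fun x => ?_
    have h2 : ∀ w, (ball (graphPoint F x) 1).indicator (fun _ => c *
        (ENNReal.ofReal (areaDensity F x) *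
          ENNReal.ofReal ((1 + ‖graphPoint F x - p‖) ^ (-((n : ℝ) + 1 + s))))) w ≤ Φ (x, w) := by
      intro w
      by_cases h : w ∈ ball (graphPoint F x) 1
      · have h3 : dist (graphPoint F x) w < 1 := by rw [dist_comm]; exact h
        rw [indicator_of_mem h, hΦ]
        dsimp only
        rw [indicator_of_mem ((hT x w).2 h3), Pi.one_apply,
          one_mul, mul_left_comm]
        gcongr
        rw [hc, ← ENNReal.ofReal_mul (by positivity), ← Real.mul_rpow two_pos.le (by positivity)]
        refine ENNReal.ofReal_le_ofReal (Real.rpow_le_rpow_of_nonpos (by positivity) ?_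
          (by linarith))
        have h4 : ‖w - p‖ ≤ ‖w - graphPoint F x‖ + ‖graphPoint F x - p‖ :=
          norm_sub_le_norm_sub_add_norm_sub _ _ _
        rw [dist_comm, dist_eq_norm] at h3
        linarith [norm_nonneg (graphPoint F x - p)]
      · rw [indicator_of_notMem h]; exact zero_le
    refine le_trans (le_of_eq ?_) (lintegral_mono h2)
    rw [lintegral_indicator_const measurableSet_ball, Measure.addHaar_ball_center, ← hV]
    ring
  rw [lintegral_lintegral_swap (f := fun x w => Φ (x, w)) hΦm.aemeasurable] at hlower
  have h5 := hlower.trans hupper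
  have h6 : c * V ≠ 0 := mul_ne_zero hc0 hV0
  have h7 : c * V ≠ ⊤ := ENNReal.mul_ne_top (by simp [hc]) hVt
  rwa [← ENNReal.div_eq_inv_mul, ENNReal.le_div_iff_mul_le (Or.inl h6) (Or.inl h7), mul_comm]

/-! ### The minimal equation in weak form. -/

theorem integral_sign_sub_mul {κ : ℝ → ℝ} (hκ : Integrable κ) (heven : ∀ τ, κ (-τ) = κ τ) (a : ℝ) :
    ∫ τ, Real.sign (a - τ) * κ τ = 2 * ∫ τ in (0 : ℝ)..a, κ τ := by
  have h1 : ∫ τ, Real.sign (a - τ) * κ τ = (∫ τ in Iic a, κ τ) - ∫ τ in Ioi a, κ τ := by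
    rw [← integral_indicator measurableSet_Iic, ← integral_indicator measurableSet_Ioi,
      ← integral_sub (hκ.indicator measurableSet_Iic) (hκ.indicator measurableSet_Ioi)]
    refine integral_congr_ae ?_
    filter_upwards [compl_mem_ae_iff.2 (measure_singleton a)] with τ hτ
    rcases lt_or_gt_of_ne (show τ ≠ a from hτ) with h | h
    · rw [Real.sign_of_pos (by linarith), indicator_of_mem (show τ ∈ Iic a from h.le),
        indicator_of_notMem (show τ ∉ Ioi a from not_lt.2 h.le)]
      ring
    · rw [Real.sign_of_neg (by linarith), indicator_of_notMem (show τ ∉ Iic a from not_le.2 h),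
        indicator_of_mem (show τ ∈ Ioi a from h)]
      ring
  have h2 : (∫ τ in Iic a, κ τ) - ∫ τ in Iic 0, κ τ = ∫ τ in (0 : ℝ)..a, κ τ :=
    intervalIntegral.integral_Iic_sub_Iic hκ.integrableOn hκ.integrableOn
  have h3 : ∫ τ in Iic (0 : ℝ), κ τ = ∫ τ in Ioi (0 : ℝ), κ τ := by
    have := integral_comp_neg_Iic (0 : ℝ) κ
    rw [neg_zero] at this
    rw [← this]
    simp only [heven]
  have h4 : (∫ τ in Iic a, κ τ) + ∫ τ in Ioi a, κ τ = ∫ τ, κ τ := by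
    rw [← compl_Iic]; exact integral_add_compl measurableSet_Iic hκ
  have h5 : (∫ τ in Iic (0 : ℝ), κ τ) + ∫ τ in Ioi (0 : ℝ), κ τ = ∫ τ, κ τ := by
    rw [← compl_Iic]; exact integral_add_compl measurableSet_Iic hκ
  rw [h1]
  linarith

theorem integrable_truncRadial_fiber {s δ : ℝ} (hs : 0 < s) (hδ : 0 < δ) (z : Base n) :
    Integrable fun τ : ℝ => truncRadial s δ (WithLp.toLp 2 (z, τ) : Space n) := by
  have hn : (0 : ℝ) ≤ n := n.cast_nonneg
  have h1 : Integrable fun τ : ℝ => (δ / (1 + δ)) ^ (-((n : ℝ) + 1 + s)) *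
      (1 + ‖τ‖) ^ (-((n : ℝ) + 1 + s)) :=
    (integrable_one_add_norm (by rw [Module.finrank_self]; push_cast; linarith)).const_mul _
  have hc : Measurable fun τ : ℝ => (WithLp.toLp 2 (z, τ) : Space n) :=
    (by fun_prop : Continuous fun τ : ℝ => (WithLp.toLp 2 (z, τ) : Space n)).measurable
  refine h1.mono' ((measurable_truncRadial s δ).comp hc).aestronglyMeasurable
    (ae_of_all _ fun τ => ?_)
  rw [Real.norm_of_nonneg (truncRadial_nonneg _ _ _)]
  by_cases h : (WithLp.toLp 2 (z, τ) : Space n) ∈ (ball (0 : Space n) δ)ᶜ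
  · rw [truncRadial, indicator_of_mem h, ← Real.mul_rpow (by positivity) (by positivity)]
    have h2 : δ ≤ ‖(WithLp.toLp 2 (z, τ) : Space n)‖ := by simpa using h
    have h3 : ‖τ‖ ≤ ‖(WithLp.toLp 2 (z, τ) : Space n)‖ := abs_snd_le (WithLp.toLp 2 (z, τ) : Space n)
    refine Real.rpow_le_rpow_of_nonpos (by positivity) ?_ (by linarith)
    rw [div_mul_eq_mul_div, div_le_iff₀ (by positivity)]
    nlinarith
  · rw [truncRadial, indicator_of_notMem h]
    positivity

/-- The integral of the truncated kernel over a vertical line. -/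
def fiberMass (s δ : ℝ) (z : Base n) : ℝ := ∫ τ : ℝ, truncRadial s δ (WithLp.toLp 2 (z, τ) : Space n)

theorem integrable_fiberMass {s δ : ℝ} (hs : 0 < s) (hδ : 0 < δ) :
    Integrable (fiberMass s δ : Base n → ℝ) := by
  have h1 := (measurePreserving_toLp.integrable_comp_emb measurableEmbedding_toLp).2
    (integrable_truncRadial (n := n) hs hδ)
  rw [Measure.volume_eq_prod] at h1
  exact h1.integral_prod_left

/-- The primitive of the truncated kernel along a vertical line. -/
def truncPrimitive (s δ a : ℝ) (z : Base n) : ℝ :=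
  ∫ τ in (0 : ℝ)..a, truncRadial s δ (WithLp.toLp 2 (z, τ) : Space n)

/-- The primitive of the kernel along a vertical line. -/
def primitive (s a : ℝ) (z : Base n) : ℝ :=
  ∫ τ in (0 : ℝ)..a, radial s (WithLp.toLp 2 (z, τ) : Space n)

theorem truncRadial_toLp_neg (s δ : ℝ) (z : Base n) (τ : ℝ) :
    truncRadial s δ (WithLp.toLp 2 (z, -τ) : Space n) = truncRadial s δ (WithLp.toLp 2 (z, τ)) := by
  have : ‖(WithLp.toLp 2 (z, -τ) : Space n)‖ = ‖(WithLp.toLp 2 (z, τ) : Space n)‖ := by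
    rw [← sq_eq_sq₀ (norm_nonneg _) (norm_nonneg _), WithLp.prod_norm_sq_eq_of_L2,
      WithLp.prod_norm_sq_eq_of_L2]
    change ‖z‖ ^ 2 + ‖-τ‖ ^ 2 = ‖z‖ ^ 2 + ‖τ‖ ^ 2
    rw [norm_neg]
  simp only [truncRadial, indicator, mem_compl_iff, mem_ball_zero_iff, radial, this]

theorem truncPrimitive_neg_neg (s δ a : ℝ) (z : Base n) :
    truncPrimitive s δ (-a) (-z) = -truncPrimitive s δ a z := by
  have h := intervalIntegral.integral_comp_neg (a := 0) (b := a)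
    (fun τ : ℝ => truncRadial s δ (WithLp.toLp 2 (-z, τ) : Space n))
  rw [neg_zero] at h
  rw [truncPrimitive, intervalIntegral.integral_symm, ← h, truncPrimitive]
  congr 1
  refine intervalIntegral.integral_congr fun τ _ => ?_
  exact truncRadial_neg s δ (WithLp.toLp 2 (z, τ))

/-- Integration along vertical lines trades the sign for a primitive of the kernel evaluated at
F(x+z) − F(x), an expression that, with the untruncated kernel and z ≠ 0, can be differentiated in
x. -/
theorem truncatedCurvature_eq_integral_truncPrimitive {s δ : ℝ} (hs : 0 < s) (hδ : 0 < δ)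
    {F : Base n → ℝ} (hF : Measurable F) (x : Base n) :
    truncatedCurvature s F δ x = 2 * ∫ z, truncPrimitive s δ (F (x + z) - F x) z := by
  have hint : Integrable fun z : Space n =>
      Real.sign (F (x + z.fst) - F x - z.snd) * truncRadial s δ z := by
    refine (integrable_truncRadial hs hδ).mono' ?_ (ae_of_all _ fun z => ?_)
    · exact ((measurable_sign.comp (((hF.comp (measurable_fst.const_add x)).sub_const _).sub
        measurable_snd)).mul (measurable_truncRadial s δ)).aestronglyMeasurable
    · rw [norm_mul, Real.norm_of_nonneg (truncRadial_nonneg _ _ _)]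
      exact mul_le_of_le_one_left (truncRadial_nonneg _ _ _) (abs_sign_le_one _)
  rw [truncatedCurvature_eq, integral_space hint, ← integral_const_mul]
  refine integral_congr_ae (ae_of_all _ fun z => ?_)
  exact integral_sign_sub_mul (integrable_truncRadial_fiber hs hδ z)
    (fun τ => truncRadial_toLp_neg s δ z τ) (F (x + z) - F x)

theorem abs_truncPrimitive_le_fiberMass {s δ : ℝ} (hs : 0 < s) (hδ : 0 < δ) (a : ℝ) (z : Base n) :
    |truncPrimitive s δ a z| ≤ fiberMass s δ z := by
  have h1 := integrable_truncRadial_fiber hs hδ z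
  rw [truncPrimitive, fiberMass, ← Real.norm_eq_abs]
  refine (intervalIntegral.norm_integral_le_integral_norm_uIoc).trans ?_
  simp only [Real.norm_of_nonneg (truncRadial_nonneg _ _ _)]
  exact setIntegral_le_integral h1 (ae_of_all _ fun τ => truncRadial_nonneg _ _ _)

theorem norm_le_norm_toLp (z : Base n) (τ : ℝ) : ‖z‖ ≤ ‖(WithLp.toLp 2 (z, τ) : Space n)‖ :=
  norm_fst_le (WithLp.toLp 2 (z, τ) : Space n)

theorem truncPrimitive_eq_primitive {s δ : ℝ} {z : Base n} (h : δ ≤ ‖z‖) (a : ℝ) :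
    truncPrimitive s δ a z = primitive s a z := by
  refine intervalIntegral.integral_congr fun τ _ => ?_
  have : (WithLp.toLp 2 (z, τ) : Space n) ∈ (ball (0 : Space n) δ)ᶜ := by
    simpa using h.trans (norm_le_norm_toLp z τ)
  simp only [truncRadial, indicator_of_mem this]

theorem abs_truncPrimitive_le {s δ : ℝ} (hs : 0 < s) (a : ℝ) {z : Base n} (hz : z ≠ 0) :
    |truncPrimitive s δ a z| ≤ ‖z‖ ^ (-((n : ℝ) + 1 + s)) * |a| := by
  have := intervalIntegral.norm_integral_le_of_norm_le_const (a := 0) (b := a)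
    (f := fun τ : ℝ => truncRadial s δ (WithLp.toLp 2 (z, τ) : Space n))
    (C := ‖z‖ ^ (-((n : ℝ) + 1 + s))) fun τ _ => by
      rw [Real.norm_of_nonneg (truncRadial_nonneg _ _ _)]
      exact (truncRadial_le _ _ _).trans
        (radial_le_of_norm_le hs (norm_pos_iff.2 hz) (norm_le_norm_toLp z τ))
  rwa [sub_zero] at this

theorem measurable_intervalIntegral {α : Type*} [MeasurableSpace α] {f : α → ℝ → ℝ}
    (hf : Measurable (Function.uncurry f)) {a : α → ℝ} (ha : Measurable a) :
    Measurable fun x => ∫ τ in (0 : ℝ)..a x, f x τ := by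
  have h1 : ∀ S : Set (α × ℝ), MeasurableSet S →
      Measurable fun x => ∫ τ, S.indicator (Function.uncurry f) (x, τ) := fun S hS =>
    ((hf.indicator hS).stronglyMeasurable.integral_prod_right').measurable
  have hS1 : MeasurableSet {q : α × ℝ | 0 < q.2 ∧ q.2 ≤ a q.1} :=
    (measurableSet_lt measurable_const _root_.measurable_snd).inter
      (measurableSet_le _root_.measurable_snd (ha.comp _root_.measurable_fst))
  have hS2 : MeasurableSet {q : α × ℝ | a q.1 < q.2 ∧ q.2 ≤ 0} :=
    (measurableSet_lt (ha.comp _root_.measurable_fst) _root_.measurable_snd).inter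
      (measurableSet_le _root_.measurable_snd measurable_const)
  have : (fun x => ∫ τ in (0 : ℝ)..a x, f x τ) = fun x =>
      (∫ τ, indicator {q : α × ℝ | 0 < q.2 ∧ q.2 ≤ a q.1} (Function.uncurry f) (x, τ)) -
        ∫ τ, indicator {q : α × ℝ | a q.1 < q.2 ∧ q.2 ≤ 0} (Function.uncurry f) (x, τ) := by
    funext x
    rw [intervalIntegral, ← integral_indicator measurableSet_Ioc,
      ← integral_indicator measurableSet_Ioc]
    rfl
  rw [this]
  exact (h1 _ hS1).sub (h1 _ hS2)

theorem measurable_truncPrimitive (s δ : ℝ) {F : Base n → ℝ} (hF : Measurable F) :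
    Measurable fun q : Base n × Base n => truncPrimitive s δ (F q.2 - F q.1) (q.2 - q.1) := by
  refine measurable_intervalIntegral (f := fun (q : Base n × Base n) τ =>
    truncRadial s δ (WithLp.toLp 2 (q.2 - q.1, τ) : Space n)) ?_
    ((hF.comp _root_.measurable_snd).sub (hF.comp _root_.measurable_fst))
  refine (measurable_truncRadial s δ).comp (Continuous.measurable ?_)
  fun_prop

/-- The mass of the kernel at unit distance and beyond, and its integrable part close to `0`. -/
def kernelWeight (s : ℝ) (z : Base n) : ℝ :=
  (ball (0 : Base n) 1).indicator (fun z => ‖z‖ ^ (1 - s - n)) z + fiberMass s 1 z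

theorem fiberMass_nonneg (s δ : ℝ) (z : Base n) : 0 ≤ fiberMass s δ z :=
  integral_nonneg fun _ => truncRadial_nonneg _ _ _

theorem integrableOn_near_weight {s : ℝ} (hs1 : s < 1) :
    IntegrableOn (fun z : Base n => ‖z‖ ^ (1 - s - n)) (ball 0 1) :=
  integrableOn_ball_norm_rpow (E := Base n) volume (α := 1 - s - n)
    (by rw [finrank_euclideanSpace_fin]; linarith) 1

theorem integrable_kernelWeight {s : ℝ} (hs0 : 0 < s) (hs1 : s < 1) :
    Integrable (kernelWeight s : Base n → ℝ) :=
  ((integrable_indicator_iff measurableSet_ball).2 (integrableOn_near_weight hs1)).add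
    (integrable_fiberMass hs0 one_pos)

theorem exists_test_lipschitz {ψ : Base n → ℝ} (hψ : ContDiff ℝ 1 ψ) (hc : HasCompactSupport ψ) :
    ∃ C R : ℝ, 0 ≤ C ∧ 0 ≤ R ∧ (∀ x, R < ‖x‖ → ψ x = 0) ∧ (∀ x, |ψ x| ≤ C) ∧
      ∀ x y, |ψ x - ψ y| ≤ C * ‖y - x‖ := by
  obtain ⟨C₁, hC₁⟩ := (hψ.continuous_fderiv one_ne_zero).bounded_above_of_compact_support
    (hc.fderiv (𝕜 := ℝ))
  obtain ⟨C₂, hC₂⟩ := hψ.continuous.bounded_above_of_compact_support hc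
  obtain ⟨R, hR⟩ := hc.isCompact.isBounded.exists_norm_le
  have hC20 : 0 ≤ C₂ := (norm_nonneg _).trans (hC₂ 0)
  refine ⟨max C₁ C₂, max R 0, le_max_of_le_right hC20, le_max_right _ _, fun x hx => ?_,
    fun x => (hC₂ x).trans (le_max_right _ _), fun x y => ?_⟩
  · by_contra h
    exact absurd (hR x (subset_tsupport _ h)) (not_le.2 ((le_max_left _ _).trans_lt hx))
  · rw [norm_sub_rev]
    exact convex_univ.norm_image_sub_le_of_norm_fderiv_le (𝕜 := ℝ) (f := ψ)
      (fun z _ => hψ.differentiable one_ne_zero z) (fun z _ => (hC₁ z).trans (le_max_left _ _))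
      (mem_univ _) (mem_univ _)

/-- Near the diagonal the difference of ψ and the height difference each give one power of |y−x|,
leaving |y−x|^(1−s−n). At base distance at least 1 a truncation at δ ≤ 1 has no effect, so the fibre
mass truncated at 1 dominates for every δ. No area bound enters here. -/
theorem exists_truncPrimitive_dominated {s : ℝ} (hs0 : 0 < s) {F : Base n → ℝ}
    (hF : ContDiff ℝ 1 F) {ψ : Base n → ℝ} (hψ : ContDiff ℝ 1 ψ) (hc : HasCompactSupport ψ) :
    ∃ C R : ℝ, ∀ δ ∈ Ioc (0 : ℝ) 1, ∀ x y : Base n,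
      |(ψ x - ψ y) * truncPrimitive s δ (F y - F x) (y - x)| ≤
        C * ((closedBall 0 R).indicator 1 x * kernelWeight s (y - x) +
          (closedBall 0 R).indicator 1 y * kernelWeight s (x - y)) := by
  obtain ⟨C₁, R, hC₁, hR0, hsupp, hbd, hlip⟩ := exists_test_lipschitz hψ hc
  obtain ⟨C₂, hC₂, hFlip⟩ := exists_lipschitz_bound hF (R + 1)
  have hw0 : ∀ z : Base n, 0 ≤ kernelWeight s z := fun z =>
    add_nonneg (indicator_nonneg (fun z _ => by positivity) z) (fiberMass_nonneg _ _ _)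
  have hfib : ∀ z : Base n, fiberMass s 1 (-z) = fiberMass s 1 z := fun z => by
    unfold fiberMass
    rw [← integral_neg_eq_self]
    exact integral_congr_ae (ae_of_all _ fun τ => truncRadial_neg s 1 (WithLp.toLp 2 (z, τ)))
  have hweven : ∀ x y : Base n, kernelWeight s (x - y) = kernelWeight s (y - x) := fun x y => by
    rw [← neg_sub, kernelWeight, kernelWeight, hfib]
    simp [indicator, norm_sub_rev x y]
  refine ⟨C₁ * C₂ + 2 * C₁, R + 1, fun δ hδ x y => ?_⟩
  rw [hweven x y, ← add_mul]
  by_cases hxy : ‖x‖ ≤ R ∨ ‖y‖ ≤ R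
  swap
  · rw [not_or, not_le, not_le] at hxy
    rw [hsupp x hxy.1, hsupp y hxy.2, sub_self, zero_mul, abs_zero]
    have h1 : ∀ x : Base n, (0 : ℝ) ≤ (closedBall (0 : Base n) (R + 1)).indicator 1 x := fun x =>
      indicator_nonneg (fun _ _ => zero_le_one) x
    exact mul_nonneg (by positivity) (mul_nonneg (add_nonneg (h1 x) (h1 y)) (hw0 _))
  have hone : (1 : ℝ) ≤ (closedBall (0 : Base n) (R + 1)).indicator 1 x +
      (closedBall (0 : Base n) (R + 1)).indicator 1 y := by
    have h1 : ∀ x : Base n, (0 : ℝ) ≤ (closedBall (0 : Base n) (R + 1)).indicator 1 x := fun x =>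
      indicator_nonneg (fun _ _ => zero_le_one) x
    have h2 : ∀ x : Base n, ‖x‖ ≤ R → (closedBall (0 : Base n) (R + 1)).indicator (1 : Base n → ℝ) x = 1 :=
      fun x hx => indicator_of_mem (by simpa using hx.trans (by linarith)) _
    rcases hxy with h | h
    · rw [h2 x h]; linarith [h1 y]
    · rw [h2 y h]; linarith [h1 x]
  have hmain : |(ψ x - ψ y) * truncPrimitive s δ (F y - F x) (y - x)| ≤
      (C₁ * C₂ + 2 * C₁) * kernelWeight s (y - x) := by
    rw [abs_mul]
    by_cases hz : ‖y - x‖ < 1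
    · rcases eq_or_ne (y - x) 0 with h0 | h0
      · rw [sub_eq_zero.1 h0, sub_self, abs_zero, zero_mul]
        exact mul_nonneg (by positivity) (hw0 _)
      have hz0 := norm_pos_iff.2 h0
      have hxR : ‖x‖ ≤ R + 1 ∧ ‖y‖ ≤ R + 1 := by
        have h1 : ‖x‖ ≤ ‖y‖ + ‖y - x‖ := by
          rw [norm_sub_rev]; simpa using norm_add_le y (x - y)
        have h2 : ‖y‖ ≤ ‖x‖ + ‖y - x‖ := by simpa using norm_add_le x (y - x)
        rcases hxy with h | h <;> constructor <;> linarith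
      have h1 := abs_truncPrimitive_le (δ := δ) hs0 (F y - F x) h0
      have h2 : |F y - F x| ≤ C₂ * ‖y - x‖ := hFlip x y hxR.1 hxR.2
      have h3 : ‖y - x‖ ^ (1 - s - n) = ‖y - x‖ ^ (-((n : ℝ) + 1 + s)) * ‖y - x‖ ^ 2 := by
        rw [← Real.rpow_natCast, ← Real.rpow_add hz0]
        congr 1; push_cast; ring
      calc |ψ x - ψ y| * |truncPrimitive s δ (F y - F x) (y - x)|
          ≤ (C₁ * ‖y - x‖) * (‖y - x‖ ^ (-((n : ℝ) + 1 + s)) * (C₂ * ‖y - x‖)) := by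
            gcongr
            · exact hlip x y
            · exact h1.trans (by gcongr)
        _ = C₁ * C₂ * ‖y - x‖ ^ (1 - s - n) := by rw [h3]; ring
        _ ≤ (C₁ * C₂ + 2 * C₁) * kernelWeight s (y - x) := by
            gcongr
            · linarith
            · rw [kernelWeight, indicator_of_mem (by simpa using hz)]
              linarith [fiberMass_nonneg s 1 (y - x)]
    · rw [not_lt] at hz
      have h1 := abs_truncPrimitive_le_fiberMass hs0 one_pos (F y - F x) (y - x)
      rw [truncPrimitive_eq_primitive hz, ← truncPrimitive_eq_primitive (hδ.2.trans hz)] at h1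
      calc |ψ x - ψ y| * |truncPrimitive s δ (F y - F x) (y - x)|
          ≤ (C₁ + C₁) * fiberMass s 1 (y - x) := by
            exact mul_le_mul ((abs_sub _ _).trans (add_le_add (hbd x) (hbd y))) h1 (abs_nonneg _)
              (by linarith)
        _ ≤ (C₁ * C₂ + 2 * C₁) * kernelWeight s (y - x) := by
            refine mul_le_mul (by nlinarith [mul_nonneg hC₁ hC₂]) ?_ (fiberMass_nonneg _ _ _)
              (by positivity)
            rw [kernelWeight, indicator_of_notMem (by simpa using hz), zero_add]
  refine hmain.trans ?_
  gcongr
  exact le_mul_of_one_le_left (hw0 _) hone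

/-- The primitive is odd under exchange of the two points, so the factor 2 of the curvature splits
symmetrically into ψ(x) − ψ(y). -/
theorem integral_mul_truncatedCurvature_eq {s δ : ℝ} (hs : 0 < s) (hδ : 0 < δ) {F : Base n → ℝ}
    (hF : Measurable F) {ψ : Base n → ℝ} (hψ : Integrable ψ) :
    ∫ x, ψ x * truncatedCurvature s F δ x = ∫ q : Base n × Base n,
      (ψ q.1 - ψ q.2) * truncPrimitive s δ (F q.2 - F q.1) (q.2 - q.1)
        ∂(volume.prod volume) := by
  have hdom : Integrable (fun q : Base n × Base n => ‖ψ q.1‖ * fiberMass s δ (q.2 - q.1))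
      (volume.prod volume) := integrable_mul_comp_sub hψ.norm (integrable_fiberMass hs hδ)
  have hI : Integrable (fun q : Base n × Base n => ψ q.1 *
      truncPrimitive s δ (F q.2 - F q.1) (q.2 - q.1)) (volume.prod volume) := by
    refine hdom.mono' (hψ.aestronglyMeasurable.comp_fst.mul
      (measurable_truncPrimitive s δ hF).aestronglyMeasurable) (ae_of_all _ fun q => ?_)
    rw [norm_mul]
    gcongr
    exact abs_truncPrimitive_le_fiberMass hs hδ _ _
  have hanti : ∀ x y : Base n, truncPrimitive s δ (F x - F y) (x - y) =
      -truncPrimitive s δ (F y - F x) (y - x) := fun x y => by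
    rw [← truncPrimitive_neg_neg, neg_sub, neg_sub]
  have hI2 : Integrable (fun q : Base n × Base n => ψ q.2 *
      truncPrimitive s δ (F q.2 - F q.1) (q.2 - q.1)) (volume.prod volume) := by
    refine hI.swap.neg.congr (ae_of_all _ fun q => ?_)
    simp only [Pi.neg_apply, Function.comp_apply, Prod.fst_swap, Prod.snd_swap, hanti q.1 q.2]
    ring
  have hE2 : ∫ q : Base n × Base n, ψ q.2 * truncPrimitive s δ (F q.2 - F q.1) (q.2 - q.1)
      ∂(volume.prod volume) = -∫ q : Base n × Base n, ψ q.1 *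
        truncPrimitive s δ (F q.2 - F q.1) (q.2 - q.1) ∂(volume.prod volume) := by
    rw [← integral_prod_swap, ← integral_neg]
    refine integral_congr_ae (ae_of_all _ fun q => ?_)
    simp only [Prod.fst_swap, Prod.snd_swap, hanti q.1 q.2]
    ring
  simp only [sub_mul]
  rw [integral_sub hI hI2, hE2, integral_prod _ hI, sub_neg_eq_add, ← two_mul, ← integral_const_mul]
  refine integral_congr_ae (ae_of_all _ fun x => ?_)
  dsimp only
  rw [truncatedCurvature_eq_integral_truncPrimitive hs hδ hF, integral_const_mul,
    ← integral_add_left_eq_self (fun y => truncPrimitive s δ (F y - F x) (y - x)) x]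
  simp only [add_sub_cancel_left]
  ring

/-- The weak form of the nonlocal minimal surface equation. -/
theorem weak_minimal_equation {s : ℝ} (hs0 : 0 < s) (hs1 : s < 1) {F : Base n → ℝ}
    (hF : ContDiff ℝ 2 F) (hmin : SatisfiesNonlocalMinimalEquation s (subgraph F))
    {ψ : Base n → ℝ} (hψ : ContDiff ℝ 1 ψ) (hc : HasCompactSupport ψ) :
    Integrable (fun q : Base n × Base n => (ψ q.1 - ψ q.2) *
      primitive s (F q.2 - F q.1) (q.2 - q.1)) (volume.prod volume) ∧
    ∫ q : Base n × Base n, (ψ q.1 - ψ q.2) * primitive s (F q.2 - F q.1) (q.2 - q.1)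
      ∂(volume.prod volume) = 0 := by
  have hF1 : ContDiff ℝ 1 F := hF.of_le one_le_two
  obtain ⟨C, R, hdom⟩ := exists_truncPrimitive_dominated hs0 hF1 hψ hc
  have hψi : Integrable ψ := hψ.continuous.integrable_of_hasCompactSupport hc
  have hB : Integrable ((closedBall (0 : Base n) R).indicator (1 : Base n → ℝ)) :=
    (integrable_indicator_iff measurableSet_closedBall).2
      (integrableOn_const measure_closedBall_lt_top.ne)
  have hD1 : Integrable (fun q : Base n × Base n =>
      (closedBall (0 : Base n) R).indicator (1 : Base n → ℝ) q.1 * kernelWeight s (q.2 - q.1))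
      (volume.prod volume) := integrable_mul_comp_sub hB (integrable_kernelWeight hs0 hs1)
  have hD := (hD1.add hD1.swap).const_mul C
  have hmeasδ : ∀ δ, AEStronglyMeasurable (fun q : Base n × Base n => (ψ q.1 - ψ q.2) *
      truncPrimitive s δ (F q.2 - F q.1) (q.2 - q.1)) (volume.prod volume) := fun δ =>
    (((hψ.continuous.measurable.comp _root_.measurable_fst).sub
      (hψ.continuous.measurable.comp _root_.measurable_snd)).mul
        (measurable_truncPrimitive s δ hF.continuous.measurable)).aestronglyMeasurable
  have hlimpt : ∀ q : Base n × Base n, Tendsto (fun δ => (ψ q.1 - ψ q.2) *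
      truncPrimitive s δ (F q.2 - F q.1) (q.2 - q.1)) (𝓝[>] 0)
      (𝓝 ((ψ q.1 - ψ q.2) * primitive s (F q.2 - F q.1) (q.2 - q.1))) := by
    intro q
    rcases eq_or_ne q.1 q.2 with h | h
    · simp [h]
    · refine tendsto_const_nhds.congr' ?_
      have : ∀ᶠ δ : ℝ in 𝓝[>] 0, δ < ‖q.2 - q.1‖ :=
        nhdsWithin_le_nhds (Iio_mem_nhds (norm_pos_iff.2 (sub_ne_zero.2 h.symm)))
      filter_upwards [this] with δ hδ
      rw [truncPrimitive_eq_primitive hδ.le]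
  have hev : ∀ᶠ δ : ℝ in 𝓝[>] 0, δ ∈ Ioc (0 : ℝ) 1 := Ioc_mem_nhdsGT one_pos
  have hlim : Tendsto (fun δ => ∫ q : Base n × Base n, (ψ q.1 - ψ q.2) *
      truncPrimitive s δ (F q.2 - F q.1) (q.2 - q.1) ∂(volume.prod volume)) (𝓝[>] 0)
      (𝓝 (∫ q : Base n × Base n, (ψ q.1 - ψ q.2) * primitive s (F q.2 - F q.1) (q.2 - q.1)
        ∂(volume.prod volume))) := by
    refine tendsto_integral_filter_of_dominated_convergence _
      (Eventually.of_forall hmeasδ) ?_ hD (ae_of_all _ hlimpt)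
    filter_upwards [hev] with δ hδ
    exact ae_of_all _ fun q => hdom δ hδ q.1 q.2
  constructor
  · obtain ⟨δ, hδ0, hδ⟩ : ∃ δ : ℕ → ℝ, (∀ k, δ k ∈ Ioc (0 : ℝ) 1) ∧ Tendsto δ atTop (𝓝[>] 0) := by
      refine ⟨fun k => 1 / ((k : ℝ) + 1), fun k => ⟨by positivity, ?_⟩,
        tendsto_nhdsWithin_iff.2 ⟨tendsto_one_div_add_atTop_nhds_zero_nat,
          Eventually.of_forall fun k => by rw [mem_Ioi]; positivity⟩⟩
      rw [div_le_one (by positivity)]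
      have : (0 : ℝ) ≤ k := k.cast_nonneg
      linarith
    refine hD.mono' (aestronglyMeasurable_of_tendsto_ae atTop (fun k => hmeasδ (δ k))
      (ae_of_all _ fun q => (hlimpt q).comp hδ)) (ae_of_all _ fun q => ?_)
    exact le_of_tendsto ((hlimpt q).comp hδ).norm
      (Eventually.of_forall fun k => hdom (δ k) (hδ0 k) q.1 q.2)
  -- The same truncated integrals, read as curvatures tested with ψ, tend to 0 by dominated
  -- convergence on the support of ψ.
  · refine tendsto_nhds_unique hlim ?_
    obtain ⟨C₁, R₁, hC₁, hR₁, hsupp, hbd, -⟩ := exists_test_lipschitz hψ hc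
    obtain ⟨M, hM⟩ := exists_truncatedCurvature_bound hs0 hs1 hF R₁
    have h1 : Tendsto (fun δ => ∫ x, ψ x * truncatedCurvature s F δ x) (𝓝[>] 0)
        (𝓝 (∫ x, ψ x * (0 : ℝ))) := by
      refine tendsto_integral_filter_of_dominated_convergence (fun x => ‖ψ x‖ * M) ?_ ?_
        (hψi.norm.mul_const M) ?_
      · exact Eventually.of_forall fun δ => hψi.aestronglyMeasurable.mul
          (measurable_truncatedCurvature s hF.continuous.measurable δ).aestronglyMeasurable
      · filter_upwards [hev] with δ hδ
        refine ae_of_all _ fun x => ?_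
        rw [norm_mul]
        by_cases hx : ‖x‖ ≤ R₁
        · gcongr
          exact hM x hx δ hδ
        · rw [hsupp x (not_le.1 hx)]; simp
      · exact ae_of_all _ fun x => (tendsto_truncatedCurvature hF.continuous hmin x).const_mul _
    simp only [mul_zero, integral_zero] at h1
    refine h1.congr' ?_
    filter_upwards [hev] with δ hδ
    exact integral_mul_truncatedCurvature_eq hs0 hδ.1 hF.continuous.measurable hψi

/-! ### The kernel on the graph and its dominating weights. -/

theorem measurable_pair_left {α β γ : Type*} [MeasurableSpace α] [MeasurableSpace β]
    [MeasurableSpace γ] {f : α → β → γ} (hf : Measurable fun q : α × β => f q.1 q.2) (x : α) :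
    Measurable (f x) :=
  hf.comp (measurable_const.prodMk measurable_id : Measurable fun y : β => (x, y))

/-- The kernel between two points of the graph. -/
def graphKernel (s : ℝ) (F : Base n → ℝ) (x y : Base n) : ℝ :=
  radial s (graphPoint F y - graphPoint F x)

theorem graphKernel_nonneg (s : ℝ) (F : Base n → ℝ) (x y : Base n) : 0 ≤ graphKernel s F x y :=
  radial_nonneg _ _

theorem graphKernel_comm (s : ℝ) (F : Base n → ℝ) (x y : Base n) :
    graphKernel s F x y = graphKernel s F y x := by
  rw [graphKernel, graphKernel, ← radial_neg, neg_sub]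

theorem norm_sub_le_norm_graphPoint_sub (F : Base n → ℝ) (x y : Base n) :
    ‖y - x‖ ≤ ‖graphPoint F y - graphPoint F x‖ :=
  norm_fst_le (graphPoint F y - graphPoint F x)

theorem graphKernel_le {s : ℝ} (hs : 0 < s) (F : Base n → ℝ) {x y : Base n} (hxy : y - x ≠ 0) :
    graphKernel s F x y ≤ ‖y - x‖ ^ (-((n : ℝ) + 1 + s)) :=
  radial_le_of_norm_le hs (norm_pos_iff.2 hxy) (norm_sub_le_norm_graphPoint_sub F x y)

theorem measurable_graphKernel (s : ℝ) {F : Base n → ℝ} (hF : Continuous F) :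
    Measurable fun q : Base n × Base n => graphKernel s F q.1 q.2 :=
  (measurable_radial s).comp ((((continuous_graphPoint hF).measurable.comp
    _root_.measurable_snd)).sub ((continuous_graphPoint hF).measurable.comp _root_.measurable_fst))

/-- The area density with the weight which the kernel has away from its pole. -/
def farWeight (s : ℝ) (F : Base n → ℝ) (x y : Base n) : ℝ :=
  areaDensity F y * (1 + ‖graphPoint F y - graphPoint F x‖) ^ (-((n : ℝ) + 1 + s))

theorem areaDensity_pos (F : Base n → ℝ) (x : Base n) : 0 < areaDensity F x :=
  one_pos.trans_le (one_le_areaDensity F x)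

theorem farWeight_nonneg (s : ℝ) (F : Base n → ℝ) (x y : Base n) : 0 ≤ farWeight s F x y := by
  have := (areaDensity_pos F y).le
  unfold farWeight
  positivity

theorem measurable_farWeight (s : ℝ) {F : Base n → ℝ} (hF : ContDiff ℝ 1 F) :
    Measurable fun q : Base n × Base n => farWeight s F q.1 q.2 :=
  ((continuous_areaDensity hF).measurable.comp _root_.measurable_snd).mul
    ((((((continuous_graphPoint hF.continuous).measurable.comp _root_.measurable_snd)).sub
      ((continuous_graphPoint hF.continuous).measurable.comp
        _root_.measurable_fst)).norm.const_add 1).pow_const _)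

theorem exists_farWeight_bound {s : ℝ} (hs0 : 0 < s) (hs1 : s < 1) {F : Base n → ℝ}
    (hF : ContDiff ℝ 2 F) (hmin : SatisfiesNonlocalMinimalEquation s (subgraph F)) :
    ∃ A : ℝ, 0 ≤ A ∧ ∀ x, Integrable (farWeight s F x) ∧ ∫ y, farWeight s F x y ≤ A := by
  obtain ⟨A, hA, h⟩ := exists_weighted_area_le n hs0 hs1
  have hF1 : ContDiff ℝ 1 F := hF.of_le one_le_two
  refine ⟨A.toReal, ENNReal.toReal_nonneg, fun x => ?_⟩
  have hm : Measurable (farWeight s F x) := measurable_pair_left (measurable_farWeight s hF1) x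
  have h1 : ∫⁻ y, ENNReal.ofReal (farWeight s F x y) ≤ A := by
    refine le_trans (le_of_eq (lintegral_congr fun y => ?_)) (h F hF hmin (graphPoint F x))
    rw [farWeight, ENNReal.ofReal_mul (areaDensity_pos F y).le]
  constructor
  · refine ⟨hm.aestronglyMeasurable, ?_⟩
    rw [hasFiniteIntegral_iff_ofReal (ae_of_all _ (farWeight_nonneg s F x))]
    exact h1.trans_lt hA.lt_top
  · rw [integral_eq_lintegral_of_nonneg_ae (ae_of_all _ (farWeight_nonneg s F x))
      hm.aestronglyMeasurable]
    exact ENNReal.toReal_mono hA h1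

/-- The integrable singularity at the origin that remains after two cancellations. -/
def nearWeight (s : ℝ) (z : Base n) : ℝ :=
  (ball (0 : Base n) 1).indicator (fun z => ‖z‖ ^ (1 - s - n)) z

theorem nearWeight_nonneg (s : ℝ) (z : Base n) : 0 ≤ nearWeight s z :=
  indicator_nonneg (fun z _ => by positivity) z

theorem integrable_nearWeight {s : ℝ} (hs1 : s < 1) : Integrable (nearWeight s : Base n → ℝ) :=
  (integrable_indicator_iff measurableSet_ball).2 (integrableOn_near_weight hs1)

theorem rpow_mul_sq {r : ℝ} (hr : 0 < r) (n : ℕ) (s : ℝ) :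
    r ^ (-((n : ℝ) + 1 + s)) * r ^ 2 = r ^ (1 - s - n) := by
  rw [← Real.rpow_natCast r 2, ← Real.rpow_add hr]
  congr 1; push_cast; ring

theorem rpow_neg_le_of_one_le {r q : ℝ} (hr : 1 ≤ r) (hq : 0 ≤ q) :
    r ^ (-q) ≤ 2 ^ q * (1 + r) ^ (-q) := by
  have h : r ^ (-q) ≤ ((1 + r) / 2) ^ (-q) :=
    Real.rpow_le_rpow_of_nonpos (by linarith) (by linarith) (by linarith)
  refine h.trans (le_of_eq ?_)
  rw [Real.div_rpow (by linarith) (by norm_num), Real.rpow_neg (by norm_num : (0 : ℝ) ≤ 2),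
    div_inv_eq_mul, mul_comm]

theorem areaDensity_mul_graphKernel_le {s : ℝ} (hs0 : 0 < s) (F : Base n → ℝ) {x y : Base n}
    (h : 1 ≤ ‖y - x‖) :
    areaDensity F y * graphKernel s F x y ≤ 2 ^ ((n : ℝ) + 1 + s) * farWeight s F x y := by
  have hn : (0 : ℝ) ≤ n := n.cast_nonneg
  rw [farWeight, mul_left_comm]
  exact mul_le_mul_of_nonneg_left (rpow_neg_le_of_one_le
    (h.trans (norm_sub_le_norm_graphPoint_sub F x y)) (by linarith)) (areaDensity_pos F y).le

theorem exists_areaDensity_bound {F : Base n → ℝ} (hF : ContDiff ℝ 1 F) (R : ℝ) :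
    ∃ C, 0 ≤ C ∧ ∀ x, ‖x‖ ≤ R → areaDensity F x ≤ C := by
  obtain ⟨C, hC⟩ := (isCompact_closedBall (0 : Base n) R).exists_bound_of_continuousOn
    (continuous_areaDensity hF).continuousOn
  refine ⟨max C 0, le_max_right _ _, fun x hx => ?_⟩
  exact ((le_abs_self _).trans (hC x (by simpa using hx))).trans (le_max_left _ _)

/-- Within base distance 1 the area density is bounded and the quadratic factor leaves
|y−x|^(1−s−n). Farther away W may be arbitrarily large, and only the tempered area weight is
available. -/
theorem exists_kernel_dominated {s : ℝ} (hs0 : 0 < s) {F : Base n → ℝ} (hF : ContDiff ℝ 1 F)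
    (R : ℝ) : ∃ C, 0 ≤ C ∧ ∀ x y, ‖x‖ ≤ R →
      min 1 (‖y - x‖ ^ 2) * (areaDensity F y * graphKernel s F x y) ≤
        C * (nearWeight s (y - x) + farWeight s F x y) := by
  obtain ⟨C, hC, hW⟩ := exists_areaDensity_bound hF (R + 1)
  refine ⟨C + 2 ^ ((n : ℝ) + 1 + s), by positivity, fun x y hx => ?_⟩
  have hW0 := (areaDensity_pos F y).le
  have hK0 := graphKernel_nonneg s F x y
  have hN := nearWeight_nonneg s (y - x)
  have hf := farWeight_nonneg s F x y
  have h2 : (0 : ℝ) ≤ 2 ^ ((n : ℝ) + 1 + s) := by positivity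
  by_cases hz : ‖y - x‖ < 1
  · rcases eq_or_ne (y - x) 0 with h0 | h0
    · rw [h0, norm_zero, zero_pow two_ne_zero, min_eq_right zero_le_one, zero_mul, ← h0]
      positivity
    have hy : ‖y‖ ≤ R + 1 := by
      have h2 : ‖y‖ ≤ ‖x‖ + ‖y - x‖ := by simpa using norm_add_le x (y - x)
      linarith
    have hK := graphKernel_le hs0 F h0
    have h3 := rpow_mul_sq (norm_pos_iff.2 h0) n s
    calc min 1 (‖y - x‖ ^ 2) * (areaDensity F y * graphKernel s F x y)
        ≤ ‖y - x‖ ^ 2 * (C * ‖y - x‖ ^ (-((n : ℝ) + 1 + s))) :=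
          mul_le_mul (min_le_right _ _) (mul_le_mul (hW y hy) hK hK0 hC) (by positivity)
            (by positivity)
      _ = C * nearWeight s (y - x) := by
          rw [nearWeight, indicator_of_mem (by simpa using hz), ← h3]; ring
      _ ≤ _ := by nlinarith
  · rw [not_lt] at hz
    have h1 := areaDensity_mul_graphKernel_le hs0 F hz
    calc min 1 (‖y - x‖ ^ 2) * (areaDensity F y * graphKernel s F x y)
        ≤ 1 * (2 ^ ((n : ℝ) + 1 + s) * farWeight s F x y) :=
          mul_le_mul (min_le_left _ _) h1 (by positivity) zero_le_one
      _ ≤ _ := by nlinarith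

theorem integrable_min_mul_graphKernel {s : ℝ} (hs0 : 0 < s) (hs1 : s < 1) {F : Base n → ℝ}
    (hF : ContDiff ℝ 2 F) (hmin : SatisfiesNonlocalMinimalEquation s (subgraph F)) (x : Base n) :
    Integrable fun y => min 1 (‖y - x‖ ^ 2) * (areaDensity F y * graphKernel s F x y) := by
  have hF1 : ContDiff ℝ 1 F := hF.of_le one_le_two
  obtain ⟨C, hC, h⟩ := exists_kernel_dominated hs0 hF1 ‖x‖
  obtain ⟨A, hA, hfar⟩ := exists_farWeight_bound hs0 hs1 hF hmin
  refine ((((integrable_nearWeight hs1).comp_sub_right x).add (hfar x).1).const_mul C).mono' ?_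
    (ae_of_all _ fun y => ?_)
  · refine Measurable.aestronglyMeasurable ?_
    refine (measurable_const.min ((measurable_id.sub_const x).norm.pow_const 2)).mul
      ((continuous_areaDensity hF1).measurable.mul ?_)
    exact measurable_pair_left (measurable_graphKernel s hF.continuous) x
  · have h1 := (areaDensity_pos F y).le
    have h2 := graphKernel_nonneg s F x y
    rw [Real.norm_of_nonneg (by positivity)]
    exact h x y le_rfl

/-- The symmetric dominating function for the double integrals over the graph. -/
def pairWeight (s : ℝ) (F : Base n → ℝ) (x y : Base n) : ℝ :=
  min 1 (‖y - x‖ ^ 2) * (areaDensity F x * areaDensity F y * graphKernel s F x y)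

theorem pairWeight_nonneg (s : ℝ) (F : Base n → ℝ) (x y : Base n) : 0 ≤ pairWeight s F x y := by
  have h1 := (areaDensity_pos F y).le
  have h2 := (areaDensity_pos F x).le
  have h3 := graphKernel_nonneg s F x y
  unfold pairWeight
  positivity

theorem pairWeight_comm (s : ℝ) (F : Base n → ℝ) (x y : Base n) :
    pairWeight s F x y = pairWeight s F y x := by
  rw [pairWeight, pairWeight, graphKernel_comm, norm_sub_rev, mul_comm (areaDensity F x)]

theorem measurable_pairWeight (s : ℝ) {F : Base n → ℝ} (hF : ContDiff ℝ 1 F) :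
    Measurable fun q : Base n × Base n => pairWeight s F q.1 q.2 :=
  (measurable_const.min ((_root_.measurable_snd.sub _root_.measurable_fst).norm.pow_const 2)).mul
    ((((continuous_areaDensity hF).measurable.comp _root_.measurable_fst).mul
      ((continuous_areaDensity hF).measurable.comp _root_.measurable_snd)).mul
        (measurable_graphKernel s hF.continuous))

theorem integrable_indicator_mul_pairWeight {s : ℝ} (hs0 : 0 < s) (hs1 : s < 1) {F : Base n → ℝ}
    (hF : ContDiff ℝ 2 F) (hmin : SatisfiesNonlocalMinimalEquation s (subgraph F)) (R : ℝ) :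
    Integrable (fun q : Base n × Base n =>
      (closedBall (0 : Base n) R).indicator (1 : Base n → ℝ) q.1 * pairWeight s F q.1 q.2)
      (volume.prod volume) := by
  have hF1 : ContDiff ℝ 1 F := hF.of_le one_le_two
  obtain ⟨C, hC, h⟩ := exists_kernel_dominated hs0 hF1 R
  obtain ⟨D, hD, hW⟩ := exists_areaDensity_bound hF1 R
  obtain ⟨A, hA, hfar⟩ := exists_farWeight_bound hs0 hs1 hF hmin
  have hBm : Measurable ((closedBall (0 : Base n) R).indicator (1 : Base n → ℝ)) :=
    measurable_one.indicator measurableSet_closedBall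
  have hB : Integrable ((closedBall (0 : Base n) R).indicator (1 : Base n → ℝ)) :=
    (integrable_indicator_iff measurableSet_closedBall).2
      (integrableOn_const measure_closedBall_lt_top.ne)
  have hB0 : ∀ x, 0 ≤ (closedBall (0 : Base n) R).indicator (1 : Base n → ℝ) x := fun x =>
    indicator_nonneg (fun _ _ => zero_le_one) x
  have h1 : Integrable (fun q : Base n × Base n =>
      (closedBall (0 : Base n) R).indicator (1 : Base n → ℝ) q.1 * nearWeight s (q.2 - q.1))
      (volume.prod volume) := integrable_mul_comp_sub hB (integrable_nearWeight hs1)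
  have hm2 : AEStronglyMeasurable (fun q : Base n × Base n =>
      (closedBall (0 : Base n) R).indicator (1 : Base n → ℝ) q.1 * farWeight s F q.1 q.2)
      (volume.prod volume) :=
    ((hBm.comp _root_.measurable_fst).mul (measurable_farWeight s hF1)).aestronglyMeasurable
  have h2 : Integrable (fun q : Base n × Base n =>
      (closedBall (0 : Base n) R).indicator (1 : Base n → ℝ) q.1 * farWeight s F q.1 q.2)
      (volume.prod volume) := by
    rw [integrable_prod_iff hm2]
    refine ⟨ae_of_all _ fun x => (hfar x).1.const_mul
      ((closedBall (0 : Base n) R).indicator (1 : Base n → ℝ) x), ?_⟩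
    refine (hB.mul_const A).mono' hm2.norm.integral_prod_right' (ae_of_all _ fun x => ?_)
    have h3 : ∀ y, ‖(closedBall (0 : Base n) R).indicator (1 : Base n → ℝ) x * farWeight s F x y‖ =
        (closedBall (0 : Base n) R).indicator (1 : Base n → ℝ) x * farWeight s F x y := fun y =>
      Real.norm_of_nonneg (mul_nonneg (hB0 x) (farWeight_nonneg s F x y))
    simp only [h3]
    rw [integral_const_mul, Real.norm_of_nonneg
      (mul_nonneg (hB0 x) (integral_nonneg (farWeight_nonneg s F x)))]
    exact mul_le_mul_of_nonneg_left (hfar x).2 (hB0 x)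
  refine ((h1.add h2).const_mul (D * C)).mono'
    ((hBm.comp _root_.measurable_fst).mul (measurable_pairWeight s hF1)).aestronglyMeasurable
    (ae_of_all _ fun q => ?_)
  rw [Real.norm_of_nonneg (mul_nonneg (hB0 _) (pairWeight_nonneg _ _ _ _))]
  simp only [Pi.add_apply]
  by_cases hq : q.1 ∈ closedBall (0 : Base n) R
  · rw [indicator_of_mem hq, Pi.one_apply, one_mul, one_mul, one_mul]
    have hx : ‖q.1‖ ≤ R := by simpa using hq
    have h3 := h q.1 q.2 hx
    have h4 := (areaDensity_pos F q.1).le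
    have h5 := (areaDensity_pos F q.2).le
    have h6 := graphKernel_nonneg s F q.1 q.2
    calc pairWeight s F q.1 q.2 = areaDensity F q.1 *
          (min 1 (‖q.2 - q.1‖ ^ 2) * (areaDensity F q.2 * graphKernel s F q.1 q.2)) := by
          rw [pairWeight]; ring
      _ ≤ D * (C * (nearWeight s (q.2 - q.1) + farWeight s F q.1 q.2)) :=
          mul_le_mul (hW _ hx) h3 (by positivity) hD
      _ = _ := by ring
  · rw [indicator_of_notMem hq]
    simp

/-- A common criterion for the double integrals on the graph. The weight is known to be integrable
when its first point is confined to a ball; its symmetry supplies the pairs with the second point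
there. -/
theorem integrable_of_abs_le_pairWeight {s : ℝ} (hs0 : 0 < s) (hs1 : s < 1) {F : Base n → ℝ}
    (hF : ContDiff ℝ 2 F) (hmin : SatisfiesNonlocalMinimalEquation s (subgraph F))
    {f : Base n × Base n → ℝ} (hf : Measurable f) {C R : ℝ}
    (hzero : ∀ x y, R < ‖x‖ → R < ‖y‖ → f (x, y) = 0)
    (hle : ∀ x y, ‖x‖ ≤ R ∨ ‖y‖ ≤ R → |f (x, y)| ≤ C * pairWeight s F x y) :
    Integrable f (volume.prod volume) := by
  have h1 := integrable_indicator_mul_pairWeight hs0 hs1 hF hmin R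
  refine ((h1.add h1.swap).const_mul |C|).mono' hf.aestronglyMeasurable
    (ae_of_all _ fun ⟨x, y⟩ => ?_)
  simp only [Pi.add_apply, Function.comp_apply, Prod.swap_prod_mk, Real.norm_eq_abs]
  rw [pairWeight_comm s F y x, ← add_mul]
  have hB0 : ∀ x, 0 ≤ (closedBall (0 : Base n) R).indicator (1 : Base n → ℝ) x := fun x =>
    indicator_nonneg (fun _ _ => zero_le_one) x
  have hp := pairWeight_nonneg s F x y
  by_cases hxy : ‖x‖ ≤ R ∨ ‖y‖ ≤ R
  · have h2 : ∀ x : Base n, ‖x‖ ≤ R →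
        (closedBall (0 : Base n) R).indicator (1 : Base n → ℝ) x = 1 :=
      fun x hx => indicator_of_mem (by simpa using hx) _
    have hone : 1 ≤ (closedBall (0 : Base n) R).indicator (1 : Base n → ℝ) x +
        (closedBall (0 : Base n) R).indicator (1 : Base n → ℝ) y := by
      rcases hxy with h | h
      · rw [h2 x h]; linarith [hB0 y]
      · rw [h2 y h]; linarith [hB0 x]
    calc |f (x, y)| ≤ C * pairWeight s F x y := hle x y hxy
      _ ≤ |C| * pairWeight s F x y := mul_le_mul_of_nonneg_right (le_abs_self C) hp
      _ ≤ _ := mul_le_mul_of_nonneg_left (le_mul_of_one_le_left hp hone) (abs_nonneg C)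
  · rw [not_or, not_le, not_le] at hxy
    rw [hzero x y hxy.1 hxy.2, abs_zero]
    exact mul_nonneg (abs_nonneg C) (mul_nonneg (add_nonneg (hB0 _) (hB0 _)) hp)

theorem min_one_mul_min_one {t : ℝ} (ht : 0 ≤ t) : min 1 t * min 1 t = min 1 (t ^ 2) := by
  rcases le_total t 1 with h | h
  · rw [min_eq_right h, min_eq_right (by nlinarith)]; ring
  · rw [min_eq_left h, min_eq_left (by nlinarith)]; ring

theorem exists_test_min_bound {ψ : Base n → ℝ} (hψ : ContDiff ℝ 1 ψ) (hc : HasCompactSupport ψ) :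
    ∃ C R : ℝ, 0 ≤ C ∧ 0 ≤ R ∧ (∀ x, R < ‖x‖ → ψ x = 0) ∧ (∀ x, |ψ x| ≤ C) ∧
      ∀ x y, |ψ x - ψ y| ≤ C * min 1 ‖y - x‖ := by
  obtain ⟨C, R, hC, hR, hsupp, hbd, hlip⟩ := exists_test_lipschitz hψ hc
  refine ⟨2 * C, R, by positivity, hR, hsupp, fun x => (hbd x).trans (by linarith), fun x y => ?_⟩
  rcases le_total ‖y - x‖ 1 with h | h
  · rw [min_eq_right h]
    exact (hlip x y).trans (mul_le_mul_of_nonneg_right (by linarith) (norm_nonneg _))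
  · rw [min_eq_left h]
    linarith [abs_sub (ψ x) (ψ y), hbd x, hbd y]

theorem norm_fderiv_le_areaDensity (F : Base n → ℝ) (x : Base n) :
    ‖fderiv ℝ F x‖ ≤ areaDensity F x := by
  rw [← norm_gradient]
  exact Real.le_sqrt_of_sq_le (by linarith)

/-- Far from the diagonal the difference is at most W(x) + W(y) ≤ 2W(x)W(y), because W ≥ 1. The
product form matches `pairWeight`, so no bound on ∇F at infinity is required. -/
theorem exists_fderiv_sub_bound {F : Base n → ℝ} (hF : ContDiff ℝ 2 F) (R : ℝ) :
    ∃ C, 0 ≤ C ∧ ∀ x y, ‖x‖ ≤ R ∨ ‖y‖ ≤ R → ‖fderiv ℝ F y - fderiv ℝ F x‖ ≤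
      C * min 1 ‖y - x‖ * (areaDensity F x * areaDensity F y) := by
  obtain ⟨C, hC, h⟩ := exists_lipschitz_bound (hF.fderiv_right (m := 1) (by norm_num)) (R + 1)
  refine ⟨C + 2, by positivity, fun x y hxy => ?_⟩
  have hx := one_le_areaDensity F x
  have hy := one_le_areaDensity F y
  have hxy1 : 1 ≤ areaDensity F x * areaDensity F y := one_le_mul_of_one_le_of_one_le hx hy
  rcases lt_or_ge ‖y - x‖ 1 with hz | hz
  · have h1 : ‖x‖ ≤ ‖y‖ + ‖y - x‖ := by
      rw [norm_sub_rev]; simpa using norm_add_le y (x - y)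
    have h2 : ‖y‖ ≤ ‖x‖ + ‖y - x‖ := by simpa using norm_add_le x (y - x)
    have h3 := h x y (by rcases hxy with h | h <;> linarith) (by rcases hxy with h | h <;> linarith)
    rw [min_eq_right hz.le]
    calc ‖fderiv ℝ F y - fderiv ℝ F x‖ ≤ C * ‖y - x‖ := h3
      _ ≤ (C + 2) * ‖y - x‖ := mul_le_mul_of_nonneg_right (by linarith) (norm_nonneg _)
      _ ≤ _ := le_mul_of_one_le_right (by positivity) hxy1
  · rw [min_eq_left hz]
    have h1 := norm_sub_le (fderiv ℝ F y) (fderiv ℝ F x)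
    have h2 := norm_fderiv_le_areaDensity F x
    have h3 := norm_fderiv_le_areaDensity F y
    nlinarith

/-! ### The linearized equation for the derivatives of F. -/

theorem hasDerivAt_primitive {s : ℝ} {z : Base n} (hz : z ≠ 0) (a : ℝ) :
    HasDerivAt (fun a => primitive s a z) (radial s (WithLp.toLp 2 (z, a) : Space n)) a := by
  have hc : Continuous fun τ : ℝ => radial s (WithLp.toLp 2 (z, τ) : Space n) := by
    have h1 : Continuous fun τ : ℝ => (WithLp.toLp 2 (z, τ) : Space n) := by fun_prop
    exact h1.norm.rpow_const fun τ =>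
      Or.inl ((norm_pos_iff.2 hz).trans_le (norm_le_norm_toLp z τ)).ne'
  exact intervalIntegral.integral_hasDerivAt_right (hc.intervalIntegrable _ _)
    (hc.stronglyMeasurableAtFilter _ _) hc.continuousAt

theorem graphKernel_add (s : ℝ) (F : Base n → ℝ) (x z : Base n) :
    graphKernel s F x (x + z) = radial s (WithLp.toLp 2 (z, F (x + z) - F x) : Space n) := by
  have : graphPoint F (x + z) - graphPoint F x = WithLp.toLp 2 (z, F (x + z) - F x) := by
    rw [graphPoint, graphPoint, ← WithLp.toLp_sub, Prod.mk_sub_mk, add_sub_cancel_left]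
  rw [graphKernel, this]

theorem hasFDerivAt_comp_add {E : Type*} [NormedAddCommGroup E] [NormedSpace ℝ E] {f : E → ℝ}
    (hf : Differentiable ℝ f) (z x : E) :
    HasFDerivAt (fun x => f (x + z)) (fderiv ℝ f (x + z)) x :=
  (hasFDerivAt_comp_add_right z).2 (hf (x + z)).hasFDerivAt

theorem continuous_graphKernel_add (s : ℝ) {F : Base n → ℝ} (hF : Continuous F) {z : Base n}
    (hz : z ≠ 0) : Continuous fun x => graphKernel s F x (x + z) := by
  have h1 : Continuous fun x => graphPoint F (x + z) - graphPoint F x :=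
    ((continuous_graphPoint hF).comp (continuous_id.add continuous_const)).sub
      (continuous_graphPoint hF)
  refine h1.norm.rpow_const fun x => Or.inl ?_
  have := norm_sub_le_norm_graphPoint_sub F x (x + z)
  rw [add_sub_cancel_left] at this
  exact ((norm_pos_iff.2 hz).trans_le this).ne'

/-- Integration by parts in x at a fixed nonzero z, where the kernel is regular and the difference
of ψ has compact support. Differentiating the primitive in its upper limit reproduces the kernel
between the two graph points. -/
theorem integral_fderiv_sub_mul_primitive {s : ℝ} {F : Base n → ℝ} (hF : ContDiff ℝ 1 F)
    {ψ : Base n → ℝ} (hψ : ContDiff ℝ 1 ψ) (hc : HasCompactSupport ψ) (e : Base n) {z : Base n}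
    (hz : z ≠ 0) :
    ∫ x, (fderiv ℝ ψ x e - fderiv ℝ ψ (x + z) e) * primitive s (F (x + z) - F x) z =
      -∫ x, (ψ x - ψ (x + z)) * (fderiv ℝ F (x + z) e - fderiv ℝ F x e) *
        graphKernel s F x (x + z) := by
  have hdψ := hψ.differentiable one_ne_zero
  have hdF := hF.differentiable one_ne_zero
  have hA : ∀ x, HasFDerivAt (fun x => ψ x - ψ (x + z)) (fderiv ℝ ψ x - fderiv ℝ ψ (x + z)) x :=
    fun x => (hdψ x).hasFDerivAt.sub (hasFDerivAt_comp_add hdψ z x)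
  have hB : ∀ x, HasFDerivAt (fun x => primitive s (F (x + z) - F x) z)
      (graphKernel s F x (x + z) • (fderiv ℝ F (x + z) - fderiv ℝ F x)) x := fun x => by
    rw [graphKernel_add]
    exact (hasDerivAt_primitive hz _).comp_hasFDerivAt x
      ((hasFDerivAt_comp_add hdF z x).sub (hdF x).hasFDerivAt)
  have hsum : Continuous fun x : Base n => x + z := continuous_id.add continuous_const
  have hcB : Continuous fun x => primitive s (F (x + z) - F x) z :=
    continuous_iff_continuousAt.2 fun x => (hB x).continuousAt
  have hcA : Continuous fun x => ψ x - ψ (x + z) := hψ.continuous.sub (hψ.continuous.comp hsum)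
  have hsA : HasCompactSupport fun x => ψ x - ψ (x + z) :=
    hc.sub (hc.comp_homeomorph (Homeomorph.addRight z))
  have hcdF : Continuous fun x => fderiv ℝ F x e :=
    (hF.continuous_fderiv one_ne_zero).clm_apply continuous_const
  have hcdψ : Continuous fun x => fderiv ℝ ψ x e :=
    (hψ.continuous_fderiv one_ne_zero).clm_apply continuous_const
  have hsdψ : HasCompactSupport fun x => fderiv ℝ ψ x e := hc.fderiv_apply (𝕜 := ℝ) e
  have hcK := continuous_graphKernel_add s hF.continuous hz
  have h := integral_mul_fderiv_eq_neg_fderiv_mul_of_integrable (μ := (volume : Measure (Base n)))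
    (f := fun x => primitive s (F (x + z) - F x) z) (g := fun x => ψ x - ψ (x + z)) (v := e)
    ?_ ?_ ?_ (fun x _ => (hB x).differentiableAt) (fun x _ => (hA x).differentiableAt)
  · have h1 : ∀ x, fderiv ℝ (fun x => ψ x - ψ (x + z)) x e =
        fderiv ℝ ψ x e - fderiv ℝ ψ (x + z) e := fun x => by rw [(hA x).fderiv]; rfl
    have h2 : ∀ x, fderiv ℝ (fun x => primitive s (F (x + z) - F x) z) x e =
        graphKernel s F x (x + z) * (fderiv ℝ F (x + z) e - fderiv ℝ F x e) := fun x => by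
      rw [(hB x).fderiv]; rfl
    simp only [h1, h2] at h
    calc _ = ∫ x, primitive s (F (x + z) - F x) z * (fderiv ℝ ψ x e - fderiv ℝ ψ (x + z) e) :=
          integral_congr_ae (ae_of_all _ fun x => mul_comm _ _)
      _ = _ := by
          rw [h]
          congr 1
          exact integral_congr_ae (ae_of_all _ fun x => by ring)
  · refine Continuous.integrable_of_hasCompactSupport ?_ hsA.mul_left
    refine Continuous.mul ?_ hcA
    have : (fun x => fderiv ℝ (fun x => primitive s (F (x + z) - F x) z) x e) = fun x =>
        graphKernel s F x (x + z) * (fderiv ℝ F (x + z) e - fderiv ℝ F x e) := by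
      funext x; rw [(hB x).fderiv]; rfl
    rw [this]
    exact hcK.mul ((hcdF.comp hsum).sub hcdF)
  · have : (fun x => fderiv ℝ (fun x => ψ x - ψ (x + z)) x e) = fun x =>
        fderiv ℝ ψ x e - fderiv ℝ ψ (x + z) e := by
      funext x; rw [(hA x).fderiv]; rfl
    refine Continuous.integrable_of_hasCompactSupport (hcB.mul ?_) (HasCompactSupport.mul_left ?_)
    · rw [this]
      exact hcdψ.sub (hcdψ.comp hsum)
    · rw [this]
      exact hsdψ.sub (hsdψ.comp_homeomorph (Homeomorph.addRight z))
  · exact (hcB.mul hcA).integrable_of_hasCompactSupport hsA.mul_left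

/-- The derivatives of `F` solve the fractional Jacobi equation in the weak sense. -/
theorem weak_jacobi_equation {s : ℝ} (hs0 : 0 < s) (hs1 : s < 1) {F : Base n → ℝ}
    (hF : ContDiff ℝ 2 F) (hmin : SatisfiesNonlocalMinimalEquation s (subgraph F))
    {ψ : Base n → ℝ} (hψ : ContDiff ℝ 2 ψ) (hc : HasCompactSupport ψ) (e : Base n) :
    Integrable (fun q : Base n × Base n => (ψ q.1 - ψ q.2) *
      (fderiv ℝ F q.2 e - fderiv ℝ F q.1 e) * graphKernel s F q.1 q.2) (volume.prod volume) ∧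
    ∫ q : Base n × Base n, (ψ q.1 - ψ q.2) * (fderiv ℝ F q.2 e - fderiv ℝ F q.1 e) *
      graphKernel s F q.1 q.2 ∂(volume.prod volume) = 0 := by
  have hF1 : ContDiff ℝ 1 F := hF.of_le one_le_two
  have hψ1 : ContDiff ℝ 1 ψ := hψ.of_le one_le_two
  have hmF : Measurable fun x => fderiv ℝ F x e :=
    ((hF1.continuous_fderiv one_ne_zero).clm_apply continuous_const).measurable
  have hint : Integrable (fun q : Base n × Base n => (ψ q.1 - ψ q.2) *
      (fderiv ℝ F q.2 e - fderiv ℝ F q.1 e) * graphKernel s F q.1 q.2) (volume.prod volume) := by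
    obtain ⟨C, R, hC, hR, hsupp, -, hψb⟩ := exists_test_min_bound hψ1 hc
    obtain ⟨D, hD, hFb⟩ := exists_fderiv_sub_bound hF R
    refine integrable_of_abs_le_pairWeight hs0 hs1 hF hmin (C := C * D * ‖e‖) (R := R) ?_ ?_ ?_
    · exact (((hψ.continuous.measurable.comp _root_.measurable_fst).sub
        (hψ.continuous.measurable.comp _root_.measurable_snd)).mul
          ((hmF.comp _root_.measurable_snd).sub (hmF.comp _root_.measurable_fst))).mul
            (measurable_graphKernel s hF.continuous)
    · intro x y hx hy
      simp [hsupp x hx, hsupp y hy]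
    · intro x y hxy
      have h1 := hψb x y
      have h2 : |fderiv ℝ F y e - fderiv ℝ F x e| ≤
          D * min 1 ‖y - x‖ * (areaDensity F x * areaDensity F y) * ‖e‖ := by
        have := (fderiv ℝ F y - fderiv ℝ F x).le_opNorm e
        exact this.trans (mul_le_mul_of_nonneg_right (hFb x y hxy) (norm_nonneg e))
      have hK := graphKernel_nonneg s F x y
      have hm : 0 ≤ min 1 ‖y - x‖ := le_min zero_le_one (norm_nonneg _)
      dsimp only
      rw [abs_mul, abs_mul, abs_of_nonneg hK, pairWeight, ← min_one_mul_min_one (norm_nonneg _)]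
      calc _ ≤ C * min 1 ‖y - x‖ *
            (D * min 1 ‖y - x‖ * (areaDensity F x * areaDensity F y) * ‖e‖) *
              graphKernel s F x y :=
            mul_le_mul_of_nonneg_right
              (mul_le_mul h1 h2 (abs_nonneg _) (by positivity)) hK
        _ = _ := by ring
  refine ⟨hint, ?_⟩
  obtain ⟨hi, h0⟩ := weak_minimal_equation hs0 hs1 hF hmin (ψ := fun x => fderiv ℝ ψ x e)
    ((hψ.fderiv_right (m := 1) (by norm_num)).clm_apply contDiff_const) (hc.fderiv_apply (𝕜 := ℝ) e)
  -- In the variables x and z = y − x the outer integral is over z, and the integration by parts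
  -- acts on the inner one.
  rw [← integrable_prod_shear_iff] at hint hi
  rw [← integral_prod_shear] at h0 ⊢
  rw [integral_prod_symm _ hi] at h0
  rw [integral_prod_symm _ hint, ← neg_eq_zero, ← h0, ← integral_neg]
  refine integral_congr_ae (ae_of_all _ fun z => ?_)
  simp only [add_sub_cancel_left]
  -- The point z = 0 cannot be discarded as a null set, since for n = 0 it is the whole space; both
  -- integrands vanish there.
  rcases eq_or_ne z 0 with rfl | hz
  · simp
  · exact (integral_fderiv_sub_mul_primitive hF1 hψ1 hc e hz).symm

/-! ### Principal values over approximately symmetric balls. -/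

theorem abs_rpow_neg_sub_le {q t a b : ℝ} (hq : 0 ≤ q) (ht : 0 < t) (ha : t ≤ a) (hb : t ≤ b) :
    |a ^ (-q) - b ^ (-q)| ≤ q * t ^ (-q - 1) * |a - b| := by
  refine (convex_Ici t).norm_image_sub_le_of_norm_deriv_le (𝕜 := ℝ) (f := fun r : ℝ => r ^ (-q))
    (fun r hr => ?_) (fun r hr => ?_) hb ha
  · exact Real.differentiableAt_rpow_const_of_ne _ (ht.trans_le hr).ne'
  · have hr0 : 0 < r := ht.trans_le hr
    rw [(Real.hasDerivAt_rpow_const (Or.inl hr0.ne')).deriv, norm_mul, norm_neg,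
      Real.norm_of_nonneg hq, Real.norm_of_nonneg (by positivity)]
    exact mul_le_mul_of_nonneg_left (Real.rpow_le_rpow_of_nonpos ht hr (by linarith)) hq

/-- The error made by linearizing numerator and kernel is integrable. -/
theorem abs_linearization_error_le {s C : ℝ} (hs : 0 < s) (hC : 0 ≤ C) {z : Base n}
    {a l ρ π : ℝ} (hρ : ‖z‖ ≤ ρ) (hπ : ‖z‖ ≤ π) (hρπ : |ρ - π| ≤ C * ‖z‖ ^ 2)
    (hl : |l| ≤ C * ‖z‖) (hal : |a - l| ≤ C * ‖z‖ ^ 2) :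
    |a * ρ ^ (-((n : ℝ) + 1 + s)) - l * π ^ (-((n : ℝ) + 1 + s))| ≤
      (C + C * ((n : ℝ) + 1 + s) * C) * ‖z‖ ^ (1 - s - n) := by
  have hn : (0 : ℝ) ≤ n := n.cast_nonneg
  rcases eq_or_ne z 0 with rfl | hz
  · have h1 : l = 0 := by simpa using hl
    have h2 : a = 0 := by simpa [h1] using hal
    rw [h1, h2, zero_mul, zero_mul, sub_zero, abs_zero]
    positivity
  have hz0 := norm_pos_iff.2 hz
  have h1 := rpow_mul_sq hz0 n s
  have h2 := abs_rpow_neg_sub_le (q := (n : ℝ) + 1 + s) (by linarith) hz0 hρ hπ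
  have h3 : ρ ^ (-((n : ℝ) + 1 + s)) ≤ ‖z‖ ^ (-((n : ℝ) + 1 + s)) :=
    Real.rpow_le_rpow_of_nonpos hz0 hρ (by linarith)
  have h4 : 0 ≤ ρ ^ (-((n : ℝ) + 1 + s)) := Real.rpow_nonneg (hz0.le.trans hρ) _
  have h5 : ‖z‖ ^ (-((n : ℝ) + 1 + s) - 1) * ‖z‖ = ‖z‖ ^ (-((n : ℝ) + 1 + s)) := by
    rw [Real.rpow_sub_one hz0.ne', div_mul_cancel₀ _ hz0.ne']
  calc |a * ρ ^ (-((n : ℝ) + 1 + s)) - l * π ^ (-((n : ℝ) + 1 + s))|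
      = |(a - l) * ρ ^ (-((n : ℝ) + 1 + s)) +
          l * (ρ ^ (-((n : ℝ) + 1 + s)) - π ^ (-((n : ℝ) + 1 + s)))| := by congr 1; ring
    _ ≤ |a - l| * ρ ^ (-((n : ℝ) + 1 + s)) +
          |l| * |ρ ^ (-((n : ℝ) + 1 + s)) - π ^ (-((n : ℝ) + 1 + s))| := by
        refine (abs_add_le _ _).trans (le_of_eq ?_)
        rw [abs_mul, abs_mul, abs_of_nonneg h4]
    _ ≤ (C * ‖z‖ ^ 2) * ‖z‖ ^ (-((n : ℝ) + 1 + s)) + (C * ‖z‖) *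
          (((n : ℝ) + 1 + s) * ‖z‖ ^ (-((n : ℝ) + 1 + s) - 1) * (C * ‖z‖ ^ 2)) := by
        refine add_le_add (mul_le_mul hal h3 h4 (by positivity))
          (mul_le_mul hl (h2.trans ?_) (abs_nonneg _) (by positivity))
        exact mul_le_mul_of_nonneg_left hρπ (by positivity)
    _ = C * (‖z‖ ^ (-((n : ℝ) + 1 + s)) * ‖z‖ ^ 2) + C * ((n : ℝ) + 1 + s) * C *
          ((‖z‖ ^ (-((n : ℝ) + 1 + s) - 1) * ‖z‖) * ‖z‖ ^ 2) := by ring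
    _ = _ := by rw [h5, h1]; ring

theorem integral_eq_zero_of_odd {f : Base n → ℝ} (hf : ∀ z, f (-z) = -f z) : ∫ z, f z = 0 := by
  have h := integral_neg_eq_self f (volume : Measure (Base n))
  simp only [hf, integral_neg] at h
  linarith

theorem indicator_odd {S : Set (Base n)} (hS : ∀ z, -z ∈ S ↔ z ∈ S) {f : Base n → ℝ}
    (hf : ∀ z, f (-z) = -f z) (z : Base n) : S.indicator f (-z) = -S.indicator f z := by
  by_cases h : z ∈ S
  · rw [indicator_of_mem h, indicator_of_mem ((hS z).2 h), hf]
  · rw [indicator_of_notMem h, indicator_of_notMem (mt (hS z).1 h), neg_zero]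

/-- The domain {δ ≤ ρ} is not symmetric, but {δ ≤ p} is, and over it the odd integrand has integral
zero. Within the unit ball the two domains differ only in the shell |p − δ| ≤ Cδ², of volume
O(δ^(n+1)), where the integrand is O(δ·δ^(−(n+1+s))). The product is O(δ^(1−s)). -/
theorem exists_odd_truncation_bound (n : ℕ) {s C : ℝ} (hs : 0 < s) (hC : 0 ≤ C) :
    ∃ M, 0 ≤ M ∧ ∀ (p : Seminorm ℝ (Base n)) (ρ : Base n → ℝ) (l : Base n →L[ℝ] ℝ), Continuous p →
      Measurable ρ → (∀ z, ‖z‖ ≤ p z) → (∀ z, ‖z‖ ≤ ρ z) →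
      (∀ z, ‖z‖ ≤ 1 → |ρ z - p z| ≤ C * ‖z‖ ^ 2) → (∀ z, |l z| ≤ C * ‖z‖) →
      ∀ δ ∈ Ioc 0 (1 / (2 * C + 2)),
        IntegrableOn (fun z => l z * p z ^ (-((n : ℝ) + 1 + s))) (ball 0 1 ∩ {z | δ ≤ ρ z}) ∧
        |∫ z in ball 0 1 ∩ {z | δ ≤ ρ z}, l z * p z ^ (-((n : ℝ) + 1 + s))| ≤ M * δ ^ (1 - s) := by
  have hn : (0 : ℝ) ≤ n := n.cast_nonneg
  set v : ℝ := (volume (ball (0 : Base n) 1)).toReal with hv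
  have hv0 : 0 ≤ v := ENNReal.toReal_nonneg
  refine ⟨C * 2 ^ ((n : ℝ) + 1 + s) * (2 * C * n * 2 ^ (n - 1) * v), by positivity, ?_⟩
  intro p ρ l hp hρm hpz hρz hρp hl δ hδ
  obtain ⟨hδ0, hδ1⟩ := hδ
  rw [le_div_iff₀ (by positivity)] at hδ1
  have hCδ : C * δ ≤ 1 / 2 := by nlinarith
  have hCδ0 : 0 ≤ C * δ := by positivity
  have hδle : δ ≤ 1 / 2 := by nlinarith
  set g : Base n → ℝ := fun z => l z * p z ^ (-((n : ℝ) + 1 + s)) with hg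
  set D : Set (Base n) := ball 0 1 ∩ {z | δ ≤ ρ z} with hD
  set D₀ : Set (Base n) := ball 0 1 ∩ {z | δ ≤ p z} with hD0
  have hmemD : ∀ z, z ∈ D ↔ ‖z‖ < 1 ∧ δ ≤ ρ z := fun z => by
    rw [hD, mem_inter_iff, mem_ball_zero_iff]; rfl
  have hmemD0 : ∀ z, z ∈ D₀ ↔ ‖z‖ < 1 ∧ δ ≤ p z := fun z => by
    rw [hD0, mem_inter_iff, mem_ball_zero_iff]; rfl
  have hDm : MeasurableSet D := measurableSet_ball.inter (measurableSet_le measurable_const hρm)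
  have hD0m : MeasurableSet D₀ :=
    measurableSet_ball.inter (measurableSet_le measurable_const hp.measurable)
  have hgm : Measurable g := l.continuous.measurable.mul (hp.measurable.pow_const _)
  have hgodd : ∀ z, g (-z) = -g z := fun z => by
    simp only [hg, map_neg, map_neg_eq_map, neg_mul]
  have hgb : ∀ z, δ / 2 ≤ p z → |g z| ≤ C * ‖z‖ * (δ / 2) ^ (-((n : ℝ) + 1 + s)) := fun z hz => by
    rw [hg, abs_mul, abs_of_nonneg (Real.rpow_nonneg (apply_nonneg p z) _)]
    exact mul_le_mul (hl z) (Real.rpow_le_rpow_of_nonpos (by positivity) hz (by linarith))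
      (Real.rpow_nonneg (apply_nonneg p z) _) (by positivity)
  have hlow : ∀ z ∈ D, δ / 2 ≤ p z := fun z hz => by
    obtain ⟨h1, h2⟩ := (hmemD z).1 hz
    rcases le_total (δ / 2) ‖z‖ with h | h
    · exact h.trans (hpz z)
    · have h3 := (abs_le.1 (hρp z h1.le)).2
      have h4 : C * ‖z‖ ^ 2 ≤ C * (δ / 2) ^ 2 := by gcongr
      nlinarith
  have hint : ∀ A : Set (Base n), A ⊆ ball 0 1 → MeasurableSet A → (∀ z ∈ A, δ / 2 ≤ p z) →
      IntegrableOn g A := fun A hA hAm hAl => by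
    refine Measure.integrableOn_of_bounded (M := C * (δ / 2) ^ (-((n : ℝ) + 1 + s)))
      ((measure_mono hA).trans_lt measure_ball_lt_top).ne hgm.aestronglyMeasurable ?_
    refine (ae_restrict_iff' hAm).2 (ae_of_all _ fun z hz => (hgb z (hAl z hz)).trans ?_)
    have h1 : ‖z‖ < 1 := by simpa using hA hz
    have h2 : 0 ≤ (δ / 2) ^ (-((n : ℝ) + 1 + s)) := by positivity
    nlinarith [mul_nonneg hC h2]
  have hID := hint D inter_subset_left hDm hlow
  have hID0 := hint D₀ inter_subset_left hD0m fun z hz => by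
    linarith [((hmemD0 z).1 hz).2]
  refine ⟨hID, ?_⟩
  set S : Set (Base n) := p.ball 0 (δ + C * δ ^ 2) \ p.ball 0 (δ - C * δ ^ 2) with hS
  have hmemS : ∀ z, z ∈ S ↔ p z < δ + C * δ ^ 2 ∧ δ - C * δ ^ 2 ≤ p z := fun z => by
    rw [hS, Set.mem_sdiff, p.mem_ball_zero, p.mem_ball_zero, not_lt]
  have hSm : MeasurableSet S := by
    have : S = {z | p z < δ + C * δ ^ 2} ∩ {z | δ - C * δ ^ 2 ≤ p z} := by
      ext z; exact hmemS z
    rw [this]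
    exact (measurableSet_lt hp.measurable measurable_const).inter
      (measurableSet_le measurable_const hp.measurable)
  set κ : ℝ := C * δ * (δ / 2) ^ (-((n : ℝ) + 1 + s)) with hκ
  have hκ0 : 0 ≤ κ := by positivity
  have hCδ2 : C * δ ^ 2 ≤ δ / 2 := by nlinarith
  have hCδ20 : 0 ≤ C * δ ^ 2 := by positivity
  have hSκ : ∀ z, z ∈ S → ‖z‖ ≤ δ → |g z| ≤ S.indicator (fun _ => κ) z := fun z hz hz' => by
    rw [indicator_of_mem hz]
    refine (hgb z (by linarith [((hmemS z).1 hz).2])).trans ?_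
    rw [hκ]
    gcongr
  have hkey : ∀ z, ‖D.indicator g z - D₀.indicator g z‖ ≤ S.indicator (fun _ => κ) z := by
    intro z
    have hnn : 0 ≤ S.indicator (fun _ => κ) z := indicator_nonneg (fun _ _ => hκ0) z
    by_cases h1 : z ∈ D <;> by_cases h2 : z ∈ D₀
    · rw [indicator_of_mem h1, indicator_of_mem h2, sub_self, norm_zero]
      exact hnn
    · rw [indicator_of_mem h1, indicator_of_notMem h2, sub_zero]
      obtain ⟨h3, h4⟩ := (hmemD z).1 h1
      have h5 : p z < δ := by
        by_contra h; exact h2 ((hmemD0 z).2 ⟨h3, not_lt.1 h⟩)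
      have h6 : ‖z‖ ≤ δ := (hpz z).trans h5.le
      have h7 := (abs_le.1 (hρp z h3.le)).2
      have h8 : C * ‖z‖ ^ 2 ≤ C * δ ^ 2 := by gcongr
      exact hSκ z ((hmemS z).2 ⟨by linarith, by linarith⟩) h6
    · rw [indicator_of_notMem h1, indicator_of_mem h2, zero_sub, norm_neg]
      obtain ⟨h3, h4⟩ := (hmemD0 z).1 h2
      have h5 : ρ z < δ := by
        by_contra h; exact h1 ((hmemD z).2 ⟨h3, not_lt.1 h⟩)
      have h6 : ‖z‖ ≤ δ := (hρz z).trans h5.le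
      have h7 := (abs_le.1 (hρp z h3.le)).1
      have h8 : C * ‖z‖ ^ 2 ≤ C * δ ^ 2 := by gcongr
      exact hSκ z ((hmemS z).2 ⟨by linarith, by linarith⟩) h6
    · rw [indicator_of_notMem h1, indicator_of_notMem h2, sub_self, norm_zero]
      exact hnn
  have hvol := measure_seminorm_shell_le volume p hpz (a := δ - C * δ ^ 2) (b := δ + C * δ ^ 2)
    (by linarith) (by linarith)
  rw [finrank_euclideanSpace_fin] at hvol
  have hSreal : volume.real S ≤ (2 * C * n * 2 ^ (n - 1) * v) * δ ^ (n + 1) := by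
    have h1 : volume.real S ≤ (δ + C * δ ^ 2 - (δ - C * δ ^ 2)) * n *
        (δ + C * δ ^ 2) ^ (n - 1) * v := by
      have h2 := ENNReal.toReal_mono (ENNReal.mul_ne_top ENNReal.ofReal_ne_top
        measure_ball_lt_top.ne) hvol
      have h3 : 0 ≤ δ + C * δ ^ 2 - (δ - C * δ ^ 2) := by linarith
      rwa [ENNReal.toReal_mul, ENNReal.toReal_ofReal (by positivity)] at h2
    refine h1.trans ?_
    -- The exponent n − 1 is a truncated subtraction; for n = 0 the factor n makes both sides zero.
    rcases Nat.eq_zero_or_pos n with h0 | h0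
    · subst h0; simp
    · have h3 : (δ + C * δ ^ 2) ^ (n - 1) ≤ (2 * δ) ^ (n - 1) := by
        gcongr; linarith
      calc (δ + C * δ ^ 2 - (δ - C * δ ^ 2)) * n * (δ + C * δ ^ 2) ^ (n - 1) * v
          = 2 * C * n * v * δ ^ 2 * (δ + C * δ ^ 2) ^ (n - 1) := by ring
        _ ≤ 2 * C * n * v * δ ^ 2 * (2 * δ) ^ (n - 1) := by gcongr
        _ = (2 * C * n * 2 ^ (n - 1) * v) * δ ^ (n + 1) := by
            have h4 : n + 1 = 2 + (n - 1) := by omega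
            rw [mul_pow, h4, pow_add]
            ring
  have hSfin : volume S ≠ ⊤ := (hvol.trans_lt (ENNReal.mul_lt_top ENNReal.ofReal_lt_top
    measure_ball_lt_top)).ne
  have h0 : ∫ z in D₀, g z = 0 := by
    rw [← integral_indicator hD0m]
    refine integral_eq_zero_of_odd (indicator_odd (fun z => ?_) hgodd)
    rw [hmemD0, hmemD0, norm_neg, map_neg_eq_map]
  have h1 : ∫ z in D, g z = ∫ z, (D.indicator g z - D₀.indicator g z) := by
    rw [integral_sub ((integrable_indicator_iff hDm).2 hID) ((integrable_indicator_iff hD0m).2 hID0),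
      integral_indicator hDm, integral_indicator hD0m, h0, sub_zero]
  have h2 : |∫ z in D, g z| ≤ ∫ z, S.indicator (fun _ => κ) z := by
    rw [h1]
    exact norm_integral_le_of_norm_le ((integrable_indicator_iff hSm).2 (integrableOn_const hSfin))
      (ae_of_all _ hkey)
  refine h2.trans ?_
  rw [integral_indicator hSm, setIntegral_const, smul_eq_mul]
  have h3 : δ * δ ^ (-((n : ℝ) + 1 + s)) * δ ^ (n + 1) = δ ^ (1 - s) := by
    rw [← Real.rpow_natCast, ← Real.rpow_one_add' hδ0.le (by linarith), ← Real.rpow_add hδ0]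
    congr 1; push_cast; ring
  calc volume.real S * κ ≤ (2 * C * n * 2 ^ (n - 1) * v) * δ ^ (n + 1) * κ :=
        mul_le_mul_of_nonneg_right hSreal hκ0
    _ = C * 2 ^ ((n : ℝ) + 1 + s) * (2 * C * n * 2 ^ (n - 1) * v) *
        (δ * δ ^ (-((n : ℝ) + 1 + s)) * δ ^ (n + 1)) := by
        rw [hκ, Real.div_rpow hδ0.le (by norm_num), Real.rpow_neg (by norm_num : (0 : ℝ) ≤ 2),
          div_inv_eq_mul]
        ring
    _ = _ := by rw [h3]

/-- A principal value over the balls of an approximately symmetric distance exists, and its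
truncations are bounded. -/
theorem exists_principal_value (n : ℕ) {s C : ℝ} (hs0 : 0 < s) (hs1 : s < 1) (hC : 0 ≤ C) :
    ∃ M, ∀ (p : Seminorm ℝ (Base n)) (ρ a : Base n → ℝ) (l : Base n →L[ℝ] ℝ), Continuous p →
      Measurable ρ → Measurable a → (∀ z, ‖z‖ ≤ p z) → (∀ z, ‖z‖ ≤ ρ z) →
      (∀ z, ‖z‖ ≤ 1 → |ρ z - p z| ≤ C * ‖z‖ ^ 2) → (∀ z, |l z| ≤ C * ‖z‖) →
      (∀ z, ‖z‖ ≤ 1 → |a z - l z| ≤ C * ‖z‖ ^ 2) →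
      (∃ L, Tendsto (fun δ => ∫ z in ball 0 1 ∩ {z | δ ≤ ρ z}, a z * ρ z ^ (-((n : ℝ) + 1 + s)))
        (𝓝[>] 0) (𝓝 L)) ∧
      ∀ δ ∈ Ioc 0 (1 / (2 * C + 2)),
        IntegrableOn (fun z => a z * ρ z ^ (-((n : ℝ) + 1 + s))) (ball 0 1 ∩ {z | δ ≤ ρ z}) ∧
        |∫ z in ball 0 1 ∩ {z | δ ≤ ρ z}, a z * ρ z ^ (-((n : ℝ) + 1 + s))| ≤ M := by
  obtain ⟨M, hM0, hM⟩ := exists_odd_truncation_bound n hs0 hC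
  have hn : (0 : ℝ) ≤ n := n.cast_nonneg
  set q : ℝ := (n : ℝ) + 1 + s with hq
  set B : ℝ := C + C * q * C with hB
  have hB0 : 0 ≤ B := by positivity
  refine ⟨(∫ z : Base n, B * nearWeight s z) + M, ?_⟩
  intro p ρ a l hp hρm ham hpz hρz hρp hl hal
  have hwi : Integrable fun z : Base n => B * nearWeight s z := (integrable_nearWeight hs1).const_mul B
  -- `r` is the integrand minus its odd linear model. It is absolutely integrable on the unit ball,
  -- so its truncated integrals converge, and the model contributes only O(δ^(1−s)).
  set r : Base n → ℝ := fun z => a z * ρ z ^ (-q) - l z * p z ^ (-q) with hr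
  have hrm : Measurable r := (ham.mul (hρm.pow_const _)).sub
    (l.continuous.measurable.mul (hp.measurable.pow_const _))
  have hDm : ∀ δ, MeasurableSet (ball (0 : Base n) 1 ∩ {z | δ ≤ ρ z}) := fun δ =>
    measurableSet_ball.inter (measurableSet_le measurable_const hρm)
  have hmem : ∀ δ z, z ∈ ball (0 : Base n) 1 ∩ {z | δ ≤ ρ z} ↔ ‖z‖ < 1 ∧ δ ≤ ρ z := fun δ z => by
    rw [mem_inter_iff, mem_ball_zero_iff]; rfl
  have hrb : ∀ A : Set (Base n), A ⊆ ball 0 1 → ∀ z, ‖A.indicator r z‖ ≤ B * nearWeight s z := by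
    intro A hA z
    by_cases hz : z ∈ A
    · have h1 : ‖z‖ < 1 := by simpa using hA hz
      rw [indicator_of_mem hz, nearWeight, indicator_of_mem (by simpa using h1)]
      exact abs_linearization_error_le hs0 hC (hρz z) (hpz z) (hρp z h1.le) (hl z) (hal z h1.le)
    · rw [indicator_of_notMem hz, norm_zero]
      exact mul_nonneg hB0 (nearWeight_nonneg s z)
  have hri : ∀ A : Set (Base n), A ⊆ ball 0 1 → MeasurableSet A → IntegrableOn r A := by
    intro A hA hAm
    rw [← integrable_indicator_iff hAm]
    exact hwi.mono' (hrm.indicator hAm).aestronglyMeasurable (ae_of_all _ (hrb A hA))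
  have hsplit : ∀ z, a z * ρ z ^ (-q) = r z + l z * p z ^ (-q) := fun z => by rw [hr]; ring
  have hmain : ∀ δ ∈ Ioc 0 (1 / (2 * C + 2)),
      IntegrableOn (fun z => a z * ρ z ^ (-q)) (ball 0 1 ∩ {z | δ ≤ ρ z}) ∧
      |(∫ z in ball 0 1 ∩ {z | δ ≤ ρ z}, a z * ρ z ^ (-q)) -
        ∫ z in ball 0 1 ∩ {z | δ ≤ ρ z}, r z| ≤ M * δ ^ (1 - s) := by
    intro δ hδ
    obtain ⟨h1, h2⟩ := hM p ρ l hp hρm hpz hρz hρp hl δ hδ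
    have h3 := hri _ inter_subset_left (hDm δ)
    simp only [hsplit]
    refine ⟨h3.add h1, ?_⟩
    rw [integral_add h3 h1, add_sub_cancel_left]
    exact h2
  have hev : ∀ᶠ δ : ℝ in 𝓝[>] 0, δ ∈ Ioc (0 : ℝ) (1 / (2 * C + 2)) :=
    Ioc_mem_nhdsGT (by positivity)
  constructor
  · refine ⟨∫ z in ball 0 1, r z, ?_⟩
    have h1 : Tendsto (fun δ => ∫ z in ball 0 1 ∩ {z | δ ≤ ρ z}, r z) (𝓝[>] 0)
        (𝓝 (∫ z in ball 0 1, r z)) := by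
      simp only [← integral_indicator (hDm _), ← integral_indicator
        (measurableSet_ball : MeasurableSet (ball (0 : Base n) 1))]
      refine tendsto_integral_filter_of_dominated_convergence (fun z => B * nearWeight s z)
        (Eventually.of_forall fun δ => (hrm.indicator (hDm δ)).aestronglyMeasurable)
        (Eventually.of_forall fun δ => ae_of_all _ (hrb _ inter_subset_left)) hwi
        (ae_of_all _ fun z => ?_)
      refine tendsto_const_nhds.congr' ?_
      rcases eq_or_ne z 0 with rfl | hz
      · have h1 : l 0 = 0 := map_zero l
        have h2 : a 0 = 0 := by simpa [h1] using hal 0 (by simp)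
        have h3 : r 0 = 0 := by simp [hr, h1, h2]
        refine Eventually.of_forall fun δ => ?_
        simp only [indicator, h3, ite_self]
      · have h1 : ∀ᶠ δ : ℝ in 𝓝[>] 0, δ < ‖z‖ :=
          nhdsWithin_le_nhds (Iio_mem_nhds (norm_pos_iff.2 hz))
        filter_upwards [h1] with δ hδ
        by_cases h2 : ‖z‖ < 1
        · rw [indicator_of_mem (by simpa using h2),
            indicator_of_mem ((hmem δ z).2 ⟨h2, hδ.le.trans (hρz z)⟩)]
        · rw [indicator_of_notMem (by simpa using h2),
            indicator_of_notMem fun h => h2 ((hmem δ z).1 h).1]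
    have h2 : Tendsto (fun δ : ℝ => M * δ ^ (1 - s)) (𝓝[>] 0) (𝓝 0) := by
      have h3 : Tendsto (fun δ : ℝ => M * δ ^ (1 - s)) (𝓝 0) (𝓝 (M * (0 : ℝ) ^ (1 - s))) :=
        ((Real.continuousAt_rpow_const 0 (1 - s) (Or.inr (by linarith))).tendsto).const_mul M
      rw [Real.zero_rpow (by linarith), mul_zero] at h3
      exact h3.mono_left nhdsWithin_le_nhds
    have h4 : Tendsto (fun δ => (∫ z in ball 0 1 ∩ {z | δ ≤ ρ z}, a z * ρ z ^ (-q)) -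
        ∫ z in ball 0 1 ∩ {z | δ ≤ ρ z}, r z) (𝓝[>] 0) (𝓝 0) := squeeze_zero_norm' (hev.mono fun δ hδ => (hmain δ hδ).2) h2
    simpa using h4.add h1
  · intro δ hδ
    refine ⟨(hmain δ hδ).1, ?_⟩
    have h1 := (hmain δ hδ).2
    have h2 : |∫ z in ball 0 1 ∩ {z | δ ≤ ρ z}, r z| ≤ ∫ z : Base n, B * nearWeight s z := by
      rw [← integral_indicator (hDm δ)]
      exact norm_integral_le_of_norm_le hwi (ae_of_all _ (hrb _ inter_subset_left))
    have h3 : M * δ ^ (1 - s) ≤ M := by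
      refine mul_le_of_le_one_right hM0 (Real.rpow_le_one hδ.1.le (hδ.2.trans ?_) (by linarith))
      rw [div_le_one (by positivity)]
      linarith
    have h4 := abs_sub_abs_le_abs_sub (∫ z in ball 0 1 ∩ {z | δ ≤ ρ z}, a z * ρ z ^ (-q))
      (∫ z in ball 0 1 ∩ {z | δ ≤ ρ z}, r z)
    linarith

section

variable {E : Type*} [NormedAddCommGroup E] [NormedSpace ℝ E]

/-- The length of the tangent vector of a graph which lies over a given vector. -/
def tangentSeminorm (l : E →L[ℝ] ℝ) : Seminorm ℝ E :=
  (normSeminorm ℝ (WithLp 2 (E × ℝ))).comp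
    ((WithLp.linearEquiv 2 ℝ (E × ℝ)).symm.toLinearMap ∘ₗ (LinearMap.id.prod l.toLinearMap))

theorem tangentSeminorm_apply (l : E →L[ℝ] ℝ) (z : E) :
    tangentSeminorm l z = ‖(WithLp.toLp 2 (z, l z) : WithLp 2 (E × ℝ))‖ := rfl

theorem continuous_tangentSeminorm (l : E →L[ℝ] ℝ) : Continuous (tangentSeminorm l) := by
  have h : Continuous fun z => (WithLp.toLp 2 (z, l z) : WithLp 2 (E × ℝ)) := by fun_prop
  exact h.norm

theorem contDiff_gradient {E : Type*} [NormedAddCommGroup E] [InnerProductSpace ℝ E]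
    [CompleteSpace E] {f : E → ℝ} (hf : ContDiff ℝ 2 f) : ContDiff ℝ 1 (∇ f) :=
  (InnerProductSpace.toDual ℝ E).symm.contDiff.comp (hf.fderiv_right (m := 1) (by norm_num))

end

theorem abs_norm_toLp_sub_le (z : Base n) (a b : ℝ) :
    |‖(WithLp.toLp 2 (z, a) : Space n)‖ - ‖(WithLp.toLp 2 (z, b) : Space n)‖| ≤ |a - b| := by
  refine (abs_norm_sub_norm_le _ _).trans ?_
  rw [← WithLp.toLp_sub, Prod.mk_sub_mk, sub_self]
  refine (norm_le_norm_fst_add _).trans (le_of_eq ?_)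
  change ‖(0 : Base n)‖ + |a - b| = _
  rw [norm_zero, zero_add]

theorem contDiff_areaDensity {F : Base n → ℝ} (hF : ContDiff ℝ 2 F) :
    ContDiff ℝ 1 (areaDensity F) :=
  (contDiff_const.add ((contDiff_gradient hF).norm_sq ℝ)).sqrt fun x => by positivity

/-! ### The truncated difference integral in the global chart. -/

theorem graphPoint_add_sub (F : Base n → ℝ) (x z : Base n) :
    graphPoint F (x + z) - graphPoint F x = WithLp.toLp 2 (z, F (x + z) - F x) := by
  rw [graphPoint, graphPoint, ← WithLp.toLp_sub, Prod.mk_sub_mk, add_sub_cancel_left]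

/-- The truncated difference integral over the graph, in the global chart. -/
def graphTruncation (s : ℝ) (F u : Base n → ℝ) (x : Base n) (δ : ℝ) : ℝ :=
  ∫ y in {y | δ ≤ ‖graphPoint F y - graphPoint F x‖},
    (u y - u x) * (areaDensity F y * graphKernel s F x y)

theorem measurableSet_far {F : Base n → ℝ} (hF : Continuous F) (x : Base n) (δ : ℝ) :
    MeasurableSet {y | δ ≤ ‖graphPoint F y - graphPoint F x‖} :=
  measurableSet_le measurable_const
    (((continuous_graphPoint hF).sub continuous_const).norm.measurable)

/-- F is Lipschitz on bounded sets, so points δ apart on the graph have base points a definite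
distance apart. This makes truncated integrands comparable with the weights that carry the factor
min(1,|y−x|²). -/
theorem exists_one_le_mul_min {F : Base n → ℝ} (hF : ContDiff ℝ 1 F) (R : ℝ) {δ : ℝ} (hδ : 0 < δ) :
    ∃ c, 0 ≤ c ∧ ∀ x y : Base n, ‖x‖ ≤ R ∨ ‖y‖ ≤ R → δ ≤ ‖graphPoint F y - graphPoint F x‖ →
      1 ≤ c * min 1 (‖y - x‖ ^ 2) := by
  obtain ⟨C, hC, h⟩ := exists_lipschitz_bound hF (R + 1)
  refine ⟨1 + ((1 + C) / δ) ^ 2, by positivity, fun x y hxy hle => ?_⟩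
  rcases lt_or_ge ‖y - x‖ 1 with hz | hz
  · have h1 : ‖x‖ ≤ ‖y‖ + ‖y - x‖ := by
      rw [norm_sub_rev]; simpa using norm_add_le y (x - y)
    have h2 : ‖y‖ ≤ ‖x‖ + ‖y - x‖ := by simpa using norm_add_le x (y - x)
    have h3 := h x y (by rcases hxy with h | h <;> linarith) (by rcases hxy with h | h <;> linarith)
    have h4 : ‖graphPoint F y - graphPoint F x‖ ≤ ‖y - x‖ + |F y - F x| :=
      norm_le_norm_fst_add (graphPoint F y - graphPoint F x)
    rw [Real.norm_eq_abs] at h3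
    have h5 : δ ≤ (1 + C) * ‖y - x‖ := by linarith
    have h6 : 1 ≤ (1 + C) / δ * ‖y - x‖ := by
      rw [div_mul_eq_mul_div, one_le_div hδ]
      exact h5
    rw [min_eq_right (by nlinarith [norm_nonneg (y - x)])]
    nlinarith [norm_nonneg (y - x), sq_nonneg ‖y - x‖]
  · rw [min_eq_left (by nlinarith), mul_one]
    nlinarith [sq_nonneg ((1 + C) / δ)]

theorem integrableOn_graphTruncation {s : ℝ} (hs0 : 0 < s) (hs1 : s < 1) {F : Base n → ℝ}
    (hF : ContDiff ℝ 2 F) (hmin : SatisfiesNonlocalMinimalEquation s (subgraph F))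
    {u : Base n → ℝ} (hu : Continuous u) (hc : HasCompactSupport u) (x : Base n) {δ : ℝ}
    (hδ : 0 < δ) :
    IntegrableOn (fun y => (u y - u x) * (areaDensity F y * graphKernel s F x y))
      {y | δ ≤ ‖graphPoint F y - graphPoint F x‖} := by
  have hF1 : ContDiff ℝ 1 F := hF.of_le one_le_two
  obtain ⟨c, hc0, h⟩ := exists_one_le_mul_min hF1 ‖x‖ hδ
  obtain ⟨C, hC⟩ := hu.bounded_above_of_compact_support hc
  have hC0 : 0 ≤ C := (norm_nonneg _).trans (hC 0)
  have hm := measurableSet_far hF.continuous x δ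
  rw [← integrable_indicator_iff hm]
  refine ((integrable_min_mul_graphKernel hs0 hs1 hF hmin x).const_mul (2 * C * c)).mono' ?_
    (ae_of_all _ fun y => ?_)
  · exact (((hu.measurable.sub_const _).mul ((continuous_areaDensity hF1).measurable.mul
      (measurable_pair_left (measurable_graphKernel s hF.continuous) x))).indicator
        hm).aestronglyMeasurable
  · have h1 := (areaDensity_pos F y).le
    have h2 := graphKernel_nonneg s F x y
    have h3 : 0 ≤ min 1 (‖y - x‖ ^ 2) := by positivity
    by_cases hy : y ∈ {y | δ ≤ ‖graphPoint F y - graphPoint F x‖}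
    · rw [indicator_of_mem hy, norm_mul, Real.norm_of_nonneg (mul_nonneg h1 h2)]
      have h4 : ‖u y - u x‖ ≤ 2 * C := (norm_sub_le _ _).trans (by linarith [hC x, hC y])
      calc ‖u y - u x‖ * (areaDensity F y * graphKernel s F x y)
          ≤ (2 * C) * (areaDensity F y * graphKernel s F x y) :=
            mul_le_mul_of_nonneg_right h4 (mul_nonneg h1 h2)
        _ ≤ (2 * C) * (areaDensity F y * graphKernel s F x y) * (c * min 1 (‖y - x‖ ^ 2)) :=
            le_mul_of_one_le_right (by positivity) (h x y (Or.inl le_rfl) hy)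
        _ = _ := by ring
    · rw [indicator_of_notMem hy, norm_zero]
      positivity

theorem graphTruncation_eq {s : ℝ} (hs0 : 0 < s) (hs1 : s < 1) {F : Base n → ℝ}
    (hF : ContDiff ℝ 2 F) (hmin : SatisfiesNonlocalMinimalEquation s (subgraph F))
    {u : Base n → ℝ} (hu : Continuous u) (hc : HasCompactSupport u) (x : Base n) {δ : ℝ}
    (hδ : δ ∈ Ioc (0 : ℝ) 1) :
    graphTruncation s F u x δ =
      (∫ z in ball 0 1 ∩ {z | δ ≤ ‖graphPoint F (x + z) - graphPoint F x‖},
        (u (x + z) - u x) * areaDensity F (x + z) *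
          ‖graphPoint F (x + z) - graphPoint F x‖ ^ (-((n : ℝ) + 1 + s))) +
      ∫ y in (ball x 1)ᶜ, (u y - u x) * (areaDensity F y * graphKernel s F x y) := by
  set A : Set (Base n) := {y | δ ≤ ‖graphPoint F y - graphPoint F x‖} with hA
  have hmem : ∀ y, y ∈ A ↔ δ ≤ ‖graphPoint F y - graphPoint F x‖ := fun _ => Iff.rfl
  have hAm : MeasurableSet A := measurableSet_far hF.continuous x δ
  have hI := integrableOn_graphTruncation hs0 hs1 hF hmin hu hc x hδ.1
  have h1 := integral_inter_add_sdiff (measurableSet_ball : MeasurableSet (ball x 1)) hI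
  have h2 : A \ ball x 1 = (ball x 1)ᶜ := by
    ext y
    rw [Set.mem_sdiff, mem_compl_iff, and_iff_right_iff_imp, hmem]
    intro hy
    rw [mem_ball, not_lt, dist_eq_norm] at hy
    exact hδ.2.trans (hy.trans (norm_sub_le_norm_graphPoint_sub F x y))
  rw [graphTruncation, ← h1, h2]
  congr 1
  have hm2 : MeasurableSet (ball (0 : Base n) 1 ∩
      {z | δ ≤ ‖graphPoint F (x + z) - graphPoint F x‖}) :=
    measurableSet_ball.inter ((measurable_const_add x) hAm)
  rw [← integral_indicator (hAm.inter measurableSet_ball), ← integral_indicator hm2,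
    ← integral_add_left_eq_self _ x]
  refine integral_congr_ae (ae_of_all _ fun z => ?_)
  have h3 : x + z ∈ A ∩ ball x 1 ↔ z ∈ ball (0 : Base n) 1 ∩
      {z | δ ≤ ‖graphPoint F (x + z) - graphPoint F x‖} := by
    rw [mem_inter_iff, mem_inter_iff, mem_ball, dist_eq_norm, add_sub_cancel_left,
      mem_ball_zero_iff, and_comm]
    rfl
  dsimp only
  by_cases hz : x + z ∈ A ∩ ball x 1
  · rw [indicator_of_mem hz, indicator_of_mem (h3.1 hz), graphKernel, radial, mul_assoc]
  · rw [indicator_of_notMem hz, indicator_of_notMem (mt h3.2 hz)]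

/-- The truncated difference integrals converge, and are bounded uniformly on balls. -/
theorem exists_graphTruncation_bound {s : ℝ} (hs0 : 0 < s) (hs1 : s < 1) {F : Base n → ℝ}
    (hF : ContDiff ℝ 2 F) (hmin : SatisfiesNonlocalMinimalEquation s (subgraph F))
    {u : Base n → ℝ} (hu : ContDiff ℝ 2 u) (hc : HasCompactSupport u) (R : ℝ) :
    ∃ M δ₀ : ℝ, 0 < δ₀ ∧ ∀ x, ‖x‖ ≤ R →
      (∃ L, Tendsto (graphTruncation s F u x) (𝓝[>] 0) (𝓝 L)) ∧
      ∀ δ ∈ Ioc 0 δ₀, |graphTruncation s F u x δ| ≤ M := by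
  have hF1 : ContDiff ℝ 1 F := hF.of_le one_le_two
  have hu1 : ContDiff ℝ 1 u := hu.of_le one_le_two
  obtain ⟨C₀, hC₀, hF2⟩ := exists_taylor_bound hF R
  obtain ⟨C₁, hC₁, hu2⟩ := exists_taylor_bound hu R
  obtain ⟨C₂, hC₂, hW⟩ := exists_areaDensity_bound hF1 (R + 1)
  obtain ⟨C₃, hdu⟩ := (hu.continuous_fderiv two_ne_zero).bounded_above_of_compact_support
    (hc.fderiv (𝕜 := ℝ))
  obtain ⟨C₄, hC₄, hWl⟩ := exists_lipschitz_bound (contDiff_areaDensity hF) (R + 1)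
  obtain ⟨C₅, hu0⟩ := hu.continuous.bounded_above_of_compact_support hc
  obtain ⟨A, hA, hfar⟩ := exists_farWeight_bound hs0 hs1 hF hmin
  have hC₃ : 0 ≤ C₃ := (norm_nonneg _).trans (hdu 0)
  have hC₅ : 0 ≤ C₅ := (norm_nonneg _).trans (hu0 0)
  set C := C₀ + C₁ * C₂ + C₃ * C₄ + C₂ * C₃ with hC
  have hC0 : 0 ≤ C := by positivity
  obtain ⟨M, hM⟩ := exists_principal_value n hs0 hs1 hC0
  refine ⟨M + 2 * C₅ * 2 ^ ((n : ℝ) + 1 + s) * A, 1 / (2 * C + 2), by positivity, fun x hx => ?_⟩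
  have hδ1 : 1 / (2 * C + 2) ≤ 1 := by
    rw [div_le_one (by positivity)]; linarith
  have hPm : Measurable fun z => ‖graphPoint F (x + z) - graphPoint F x‖ :=
    (((continuous_graphPoint hF.continuous).comp (continuous_const.add continuous_id)).sub
      continuous_const).norm.measurable
  have ham : Measurable fun z => (u (x + z) - u x) * areaDensity F (x + z) :=
    ((hu.continuous.comp (continuous_const.add continuous_id)).sub continuous_const).measurable.mul
      ((continuous_areaDensity hF1).comp (continuous_const.add continuous_id)).measurable
  -- The distance along the graph is linearized by the length of the tangent vector over z, and the
  -- numerator (u(x+z) − u(x))W(x+z) by W(x)·du(x). The constant `C` does not depend on x in the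
  -- ball of radius R, hence neither do the resulting bounds.
  obtain ⟨hlim, hbd⟩ := hM (tangentSeminorm (fderiv ℝ F x))
    (fun z => ‖graphPoint F (x + z) - graphPoint F x‖)
    (fun z => (u (x + z) - u x) * areaDensity F (x + z)) (areaDensity F x • fderiv ℝ u x)
    (continuous_tangentSeminorm _) hPm ham (fun z => norm_le_norm_toLp z _)
    (fun z => by rw [graphPoint_add_sub]; exact norm_le_norm_toLp z _)
    (fun z hz => by
      rw [graphPoint_add_sub, tangentSeminorm_apply]
      refine (abs_norm_toLp_sub_le z _ _).trans ((hF2 x z hx hz).trans ?_)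
      gcongr
      rw [hC]
      linarith [mul_nonneg hC₁ hC₂, mul_nonneg hC₃ hC₄, mul_nonneg hC₂ hC₃])
    (fun z => by
      change |areaDensity F x * fderiv ℝ u x z| ≤ _
      rw [abs_mul, abs_of_pos (areaDensity_pos F x)]
      have h1 : |fderiv ℝ u x z| ≤ C₃ * ‖z‖ := (fderiv ℝ u x).le_of_opNorm_le (hdu x) z
      calc areaDensity F x * |fderiv ℝ u x z| ≤ C₂ * (C₃ * ‖z‖) :=
            mul_le_mul (hW x (by linarith)) h1 (abs_nonneg _) hC₂
        _ = C₂ * C₃ * ‖z‖ := by ring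
        _ ≤ C * ‖z‖ := by
          gcongr
          rw [hC]
          linarith [mul_nonneg hC₁ hC₂, mul_nonneg hC₃ hC₄])
    (fun z hz => by
      change |(u (x + z) - u x) * areaDensity F (x + z) - areaDensity F x * fderiv ℝ u x z| ≤ _
      have hxz : ‖x + z‖ ≤ R + 1 := (norm_add_le x z).trans (by linarith)
      have h1 : |fderiv ℝ u x z| ≤ C₃ * ‖z‖ := (fderiv ℝ u x).le_of_opNorm_le (hdu x) z
      have h2 : |u (x + z) - u x - fderiv ℝ u x z| ≤ C₁ * ‖z‖ ^ 2 := hu2 x z hx hz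
      have h3 : |areaDensity F (x + z) - areaDensity F x| ≤ C₄ * ‖z‖ := by
        have := hWl x (x + z) (by linarith) hxz
        rwa [add_sub_cancel_left] at this
      calc |(u (x + z) - u x) * areaDensity F (x + z) - areaDensity F x * fderiv ℝ u x z|
          = |(u (x + z) - u x - fderiv ℝ u x z) * areaDensity F (x + z) +
              fderiv ℝ u x z * (areaDensity F (x + z) - areaDensity F x)| := by congr 1; ring
        _ ≤ |u (x + z) - u x - fderiv ℝ u x z| * areaDensity F (x + z) +
              |fderiv ℝ u x z| * |areaDensity F (x + z) - areaDensity F x| := by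
            refine (abs_add_le _ _).trans (le_of_eq ?_)
            rw [abs_mul, abs_mul, abs_of_pos (areaDensity_pos F (x + z))]
        _ ≤ (C₁ * ‖z‖ ^ 2) * C₂ + (C₃ * ‖z‖) * (C₄ * ‖z‖) := by
            refine add_le_add (mul_le_mul h2 (hW _ hxz) (areaDensity_pos F _).le (by positivity))
              (mul_le_mul h1 h3 (abs_nonneg _) (by positivity))
        _ = (C₁ * C₂ + C₃ * C₄) * ‖z‖ ^ 2 := by ring
        _ ≤ C * ‖z‖ ^ 2 := by
            gcongr
            rw [hC]
            linarith [mul_nonneg hC₂ hC₃])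
  have heq := fun δ (hδ : δ ∈ Ioc (0 : ℝ) 1) =>
    graphTruncation_eq hs0 hs1 hF hmin hu.continuous hc x hδ
  constructor
  · obtain ⟨L, hL⟩ := hlim
    refine ⟨L + ∫ y in (ball x 1)ᶜ, (u y - u x) * (areaDensity F y * graphKernel s F x y), ?_⟩
    refine (hL.add_const _).congr' ?_
    filter_upwards [Ioc_mem_nhdsGT one_pos] with δ hδ
    exact (heq δ hδ).symm
  · intro δ hδ
    rw [heq δ ⟨hδ.1, hδ.2.trans hδ1⟩]
    refine (abs_add_le _ _).trans (add_le_add (hbd δ hδ).2 ?_)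
    have h1 : |∫ y in (ball x 1)ᶜ, (u y - u x) * (areaDensity F y * graphKernel s F x y)| ≤
        ∫ y in (ball x 1)ᶜ, 2 * C₅ * 2 ^ ((n : ℝ) + 1 + s) * farWeight s F x y := by
      rw [← Real.norm_eq_abs]
      refine norm_integral_le_of_norm_le ((hfar x).1.const_mul
        (2 * C₅ * 2 ^ ((n : ℝ) + 1 + s))).integrableOn
        ((ae_restrict_iff' measurableSet_ball.compl).2 (ae_of_all _ fun y hy => ?_))
      have hy1 : 1 ≤ ‖y - x‖ := by simpa [dist_eq_norm] using hy
      have h2 := areaDensity_mul_graphKernel_le hs0 F hy1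
      have h3 : ‖u y - u x‖ ≤ 2 * C₅ := (norm_sub_le _ _).trans (by linarith [hu0 x, hu0 y])
      have h4 : 0 ≤ areaDensity F y * graphKernel s F x y :=
        mul_nonneg (areaDensity_pos F y).le (graphKernel_nonneg s F x y)
      rw [norm_mul, Real.norm_of_nonneg h4, mul_assoc (2 * C₅)]
      exact mul_le_mul h3 h2 h4 (by positivity)
    refine h1.trans ?_
    have h5 : ∀ y, 0 ≤ 2 * C₅ * 2 ^ ((n : ℝ) + 1 + s) * farWeight s F x y := fun y =>
      mul_nonneg (by positivity) (farWeight_nonneg s F x y)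
    refine (setIntegral_le_integral ((hfar x).1.const_mul _) (ae_of_all _ h5)).trans ?_
    rw [integral_const_mul]
    exact mul_le_mul_of_nonneg_left (hfar x).2 (by positivity)

/-! ### The zeroth order coefficient. -/

/-- The defect of the normals at two points of the graph, times both area densities. -/
def normalGap (F : Base n → ℝ) (x y : Base n) : ℝ :=
  areaDensity F x * areaDensity F y - 1 - inner ℝ (∇ F x) (∇ F y)

theorem areaDensity_sq (F : Base n → ℝ) (x : Base n) : areaDensity F x ^ 2 = 1 + ‖∇ F x‖ ^ 2 :=
  Real.sq_sqrt (by positivity)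

theorem normalGap_comm (F : Base n → ℝ) (x y : Base n) : normalGap F x y = normalGap F y x := by
  rw [normalGap, normalGap, mul_comm, real_inner_comm]

/-- Cauchy–Schwarz for the vectors (1, ∇F(x)) and (1, ∇F(y)), whose lengths are W(x) and W(y). -/
theorem abs_one_add_inner_gradient_le (F : Base n → ℝ) (x y : Base n) :
    |1 + inner ℝ (∇ F x) (∇ F y)| ≤ areaDensity F x * areaDensity F y := by
  have h1 := abs_real_inner_le_norm (∇ F x) (∇ F y)
  have h2 : |1 + inner ℝ (∇ F x) (∇ F y)| ≤ 1 + ‖∇ F x‖ * ‖∇ F y‖ :=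
    (abs_add_le _ _).trans (by rw [abs_one]; linarith)
  refine h2.trans (le_of_sq_le_sq ?_
    (mul_pos (areaDensity_pos F x) (areaDensity_pos F y)).le)
  rw [mul_pow, areaDensity_sq, areaDensity_sq]
  nlinarith [sq_nonneg (‖∇ F x‖ - ‖∇ F y‖)]

theorem normalGap_nonneg (F : Base n → ℝ) (x y : Base n) : 0 ≤ normalGap F x y := by
  have := le_of_abs_le (abs_one_add_inner_gradient_le F x y)
  rw [normalGap]
  linarith

theorem normalGap_le_two_mul (F : Base n → ℝ) (x y : Base n) :
    normalGap F x y ≤ 2 * (areaDensity F x * areaDensity F y) := by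
  have := neg_le_of_abs_le (abs_one_add_inner_gradient_le F x y)
  rw [normalGap]
  linarith

/-- The gap equals ½|∇F(y) − ∇F(x)|² − ½(W(x) − W(y))². It is thus quadratic near the diagonal, so
the zeroth order integral converges absolutely there. -/
theorem normalGap_le_norm_sq (F : Base n → ℝ) (x y : Base n) :
    normalGap F x y ≤ ‖∇ F y - ∇ F x‖ ^ 2 := by
  have h1 : ‖∇ F y - ∇ F x‖ ^ 2 =
      ‖∇ F y‖ ^ 2 - 2 * inner ℝ (∇ F x) (∇ F y) + ‖∇ F x‖ ^ 2 := by
    rw [norm_sub_sq_real, real_inner_comm]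
  have h2 := areaDensity_sq F x
  have h3 := areaDensity_sq F y
  rw [normalGap]
  nlinarith [sq_nonneg (areaDensity F x - areaDensity F y), sq_nonneg ‖∇ F y - ∇ F x‖]

theorem exists_normalGap_bound {F : Base n → ℝ} (hF : ContDiff ℝ 2 F) (R : ℝ) :
    ∃ C, 0 ≤ C ∧ ∀ x y, ‖x‖ ≤ R ∨ ‖y‖ ≤ R →
      normalGap F x y ≤ C * (min 1 (‖y - x‖ ^ 2) * (areaDensity F x * areaDensity F y)) := by
  obtain ⟨C, hC, h⟩ := exists_lipschitz_bound (contDiff_gradient hF) (R + 1)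
  refine ⟨C ^ 2 + 2, by positivity, fun x y hxy => ?_⟩
  have hxy1 : 1 ≤ areaDensity F x * areaDensity F y :=
    one_le_mul_of_one_le_of_one_le (one_le_areaDensity F x) (one_le_areaDensity F y)
  rcases lt_or_ge ‖y - x‖ 1 with hz | hz
  · have h1 : ‖x‖ ≤ ‖y‖ + ‖y - x‖ := by
      rw [norm_sub_rev]; simpa using norm_add_le y (x - y)
    have h2 : ‖y‖ ≤ ‖x‖ + ‖y - x‖ := by simpa using norm_add_le x (y - x)
    have h3 := h x y (by rcases hxy with h | h <;> linarith) (by rcases hxy with h | h <;> linarith)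
    rw [min_eq_right (by nlinarith [norm_nonneg (y - x)])]
    calc normalGap F x y ≤ ‖∇ F y - ∇ F x‖ ^ 2 := normalGap_le_norm_sq F x y
      _ ≤ (C * ‖y - x‖) ^ 2 := by gcongr
      _ ≤ (C ^ 2 + 2) * ‖y - x‖ ^ 2 := by nlinarith [sq_nonneg ‖y - x‖]
      _ ≤ (C ^ 2 + 2) * (‖y - x‖ ^ 2 * (areaDensity F x * areaDensity F y)) := by
        gcongr
        exact le_mul_of_one_le_right (by positivity) hxy1
  · rw [min_eq_left (by nlinarith), one_mul]
    refine (normalGap_le_two_mul F x y).trans ?_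
    gcongr
    nlinarith [sq_nonneg C]

theorem measurable_normalGap {F : Base n → ℝ} (hF : ContDiff ℝ 2 F) :
    Measurable fun q : Base n × Base n => normalGap F q.1 q.2 := by
  have h1 := continuous_areaDensity (hF.of_le one_le_two)
  have h2 := (contDiff_gradient hF).continuous
  exact ((((h1.comp continuous_fst).mul (h1.comp continuous_snd)).sub continuous_const).sub
    ((h2.comp continuous_fst).inner (h2.comp continuous_snd))).measurable

theorem integrable_normalGap_mul_graphKernel {s : ℝ} (hs0 : 0 < s) (hs1 : s < 1) {F : Base n → ℝ}
    (hF : ContDiff ℝ 2 F) (hmin : SatisfiesNonlocalMinimalEquation s (subgraph F)) (x : Base n) :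
    Integrable fun y => normalGap F x y * graphKernel s F x y := by
  obtain ⟨C, hC, h⟩ := exists_normalGap_bound hF ‖x‖
  refine ((integrable_min_mul_graphKernel hs0 hs1 hF hmin x).const_mul
    (C * areaDensity F x)).mono' ?_ (ae_of_all _ fun y => ?_)
  · exact ((measurable_pair_left (measurable_normalGap hF) x).mul
      (measurable_pair_left (measurable_graphKernel s hF.continuous) x)).aestronglyMeasurable
  · have hK := graphKernel_nonneg s F x y
    rw [Real.norm_of_nonneg (mul_nonneg (normalGap_nonneg F x y) hK)]
    refine (mul_le_mul_of_nonneg_right (h x y (Or.inl le_rfl)) hK).trans (le_of_eq ?_)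
    ring

/-- The zeroth order coefficient of the Jacobi operator, times the area density. -/
def totalGap (s : ℝ) (F : Base n → ℝ) (x : Base n) : ℝ :=
  ∫ y, normalGap F x y * graphKernel s F x y

/-! ### Symmetrized double integrals on the graph. -/

/-- The pairs of points whose images in the graph have distance at least `δ`. -/
def farPairs (F : Base n → ℝ) (δ : ℝ) : Set (Base n × Base n) :=
  {q | δ ≤ ‖graphPoint F q.2 - graphPoint F q.1‖}

theorem measurableSet_farPairs {F : Base n → ℝ} (hF : Continuous F) (δ : ℝ) :
    MeasurableSet (farPairs F δ) := by
  have h := continuous_graphPoint hF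
  exact measurableSet_le measurable_const
    ((h.comp continuous_snd).sub (h.comp continuous_fst)).norm.measurable

theorem mem_farPairs_swap (F : Base n → ℝ) (δ : ℝ) (x y : Base n) :
    (y, x) ∈ farPairs F δ ↔ (x, y) ∈ farPairs F δ := by
  change δ ≤ ‖graphPoint F x - graphPoint F y‖ ↔ δ ≤ ‖graphPoint F y - graphPoint F x‖
  rw [norm_sub_rev]

theorem graphTruncation_eq_integral_indicator (s : ℝ) {F : Base n → ℝ} (hF : Continuous F)
    (u : Base n → ℝ) (x : Base n) (δ : ℝ) :
    graphTruncation s F u x δ = ∫ y, (farPairs F δ).indicator (fun q : Base n × Base n =>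
      (u q.2 - u q.1) * (areaDensity F q.2 * graphKernel s F q.1 q.2)) (x, y) := by
  rw [graphTruncation, ← integral_indicator (measurableSet_far hF x δ)]
  rfl

section

variable {s : ℝ} {F u : Base n → ℝ}

theorem measurable_difference (hF : ContDiff ℝ 1 F) (hu : Continuous u) :
    Measurable fun q : Base n × Base n =>
      (u q.2 - u q.1) * (areaDensity F q.2 * graphKernel s F q.1 q.2) :=
  ((hu.measurable.comp _root_.measurable_snd).sub (hu.measurable.comp _root_.measurable_fst)).mul
    (((continuous_areaDensity hF).measurable.comp _root_.measurable_snd).mul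
      (measurable_graphKernel s hF.continuous))

theorem stronglyMeasurable_graphTruncation (hF : ContDiff ℝ 1 F) (hu : Continuous u) (δ : ℝ) :
    StronglyMeasurable fun x => graphTruncation s F u x δ := by
  simp only [graphTruncation_eq_integral_indicator s hF.continuous]
  exact ((measurable_difference hF hu).indicator
    (measurableSet_farPairs hF.continuous δ)).stronglyMeasurable.integral_prod_right'

theorem integrable_difference_sq (hs0 : 0 < s) (hs1 : s < 1) (hF : ContDiff ℝ 2 F)
    (hmin : SatisfiesNonlocalMinimalEquation s (subgraph F)) (hu : ContDiff ℝ 1 u)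
    (hc : HasCompactSupport u) :
    Integrable (fun q : Base n × Base n => (u q.1 - u q.2) ^ 2 *
      (areaDensity F q.1 * areaDensity F q.2 * graphKernel s F q.1 q.2)) (volume.prod volume) := by
  have hF1 : ContDiff ℝ 1 F := hF.of_le one_le_two
  obtain ⟨C, R, hC, -, hsupp, -, hub⟩ := exists_test_min_bound hu hc
  have hW := (continuous_areaDensity hF1).measurable
  refine integrable_of_abs_le_pairWeight hs0 hs1 hF hmin (C := C ^ 2) (R := R) ?_ ?_ ?_
  · exact (((hu.continuous.measurable.comp _root_.measurable_fst).sub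
      (hu.continuous.measurable.comp _root_.measurable_snd)).pow_const 2).mul
        (((hW.comp _root_.measurable_fst).mul (hW.comp _root_.measurable_snd)).mul
          (measurable_graphKernel s hF.continuous))
  · intro x y hx hy
    simp [hsupp x hx, hsupp y hy]
  · intro x y _
    have h1 := (areaDensity_pos F x).le
    have h2 := (areaDensity_pos F y).le
    have h3 := graphKernel_nonneg s F x y
    have h4 : (u x - u y) ^ 2 ≤ C ^ 2 * min 1 (‖y - x‖ ^ 2) := by
      rw [← sq_abs, ← min_one_mul_min_one (norm_nonneg _), ← sq (min 1 ‖y - x‖), ← mul_pow]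
      gcongr
      exact hub x y
    dsimp only
    rw [abs_of_nonneg (by positivity), pairWeight]
    refine (mul_le_mul_of_nonneg_right h4 (mul_nonneg (mul_nonneg h1 h2) h3)).trans (le_of_eq ?_)
    ring

/-- At fixed δ the integrand is absolutely integrable on pairs, and the truncation is symmetric in
the two points. Adding the copy with x and y exchanged turns (u(y) − u(x))u(x) into −(u(x) − u(y))².
-/
theorem integral_graphTruncation_mul (hs0 : 0 < s) (hs1 : s < 1) (hF : ContDiff ℝ 2 F)
    (hmin : SatisfiesNonlocalMinimalEquation s (subgraph F)) (hu : ContDiff ℝ 1 u)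
    (hc : HasCompactSupport u) {δ : ℝ} (hδ : 0 < δ) :
    ∫ x, graphTruncation s F u x δ * (u x * areaDensity F x) = -(1 / 2) *
      ∫ q, (farPairs F δ).indicator (fun q : Base n × Base n => (u q.1 - u q.2) ^ 2 *
        (areaDensity F q.1 * areaDensity F q.2 * graphKernel s F q.1 q.2)) q
          ∂(volume.prod volume) := by
  have hF1 : ContDiff ℝ 1 F := hF.of_le one_le_two
  obtain ⟨C, R, hC, -, hsupp, hub, -⟩ := exists_test_min_bound hu hc
  obtain ⟨c, hc0, hmin1⟩ := exists_one_le_mul_min hF1 R hδ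
  have hTm := measurableSet_farPairs hF.continuous δ
  have hW := (continuous_areaDensity hF1).measurable
  set T := farPairs F δ with hT
  set g : Base n × Base n → ℝ := fun q => T.indicator (fun q : Base n × Base n =>
    (u q.2 - u q.1) * (areaDensity F q.2 * graphKernel s F q.1 q.2)) q *
      (u q.1 * areaDensity F q.1) with hg
  have hgm : Measurable g := ((measurable_difference hF1 hu.continuous).indicator hTm).mul
    ((hu.continuous.measurable.comp _root_.measurable_fst).mul (hW.comp _root_.measurable_fst))
  have hgi : Integrable g (volume.prod volume) := by
    refine integrable_of_abs_le_pairWeight hs0 hs1 hF hmin (C := 2 * C * C * c) (R := R) hgm ?_ ?_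
    · intro x y hx _
      simp only [hg, hsupp x hx, zero_mul, mul_zero]
    · intro x y hxy
      have h1 := (areaDensity_pos F x).le
      have h2 := (areaDensity_pos F y).le
      have h3 := graphKernel_nonneg s F x y
      have hp := pairWeight_nonneg s F x y
      by_cases hq : (x, y) ∈ T
      · have h4 : |u y - u x| ≤ 2 * C := (abs_sub _ _).trans (by linarith [hub x, hub y])
        have h5 := hmin1 x y hxy hq
        simp only [hg, indicator_of_mem hq]
        rw [abs_mul, abs_mul, abs_of_nonneg (mul_nonneg h2 h3), abs_mul, abs_of_nonneg h1]
        calc |u y - u x| * (areaDensity F y * graphKernel s F x y) * (|u x| * areaDensity F x)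
            = |u y - u x| * |u x| * (areaDensity F x * areaDensity F y * graphKernel s F x y) := by
              ring
          _ ≤ 2 * C * C * (areaDensity F x * areaDensity F y * graphKernel s F x y) :=
              mul_le_mul_of_nonneg_right
                (mul_le_mul h4 (hub x) (abs_nonneg _) (by positivity)) (by positivity)
          _ ≤ 2 * C * C * (areaDensity F x * areaDensity F y * graphKernel s F x y) *
              (c * min 1 (‖y - x‖ ^ 2)) := le_mul_of_one_le_right (by positivity) h5
          _ = _ := by rw [pairWeight]; ring
      · simp only [hg, indicator_of_notMem hq, zero_mul, abs_zero]
        positivity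
  have h1 : ∫ x, graphTruncation s F u x δ * (u x * areaDensity F x) =
      ∫ q, g q ∂(volume.prod volume) := by
    rw [integral_prod _ hgi]
    refine integral_congr_ae (ae_of_all _ fun x => ?_)
    simp only [hg]
    rw [integral_mul_const, graphTruncation_eq_integral_indicator s hF.continuous]
  have h2 : ∫ q, g q.swap ∂(volume.prod volume) = ∫ q, g q ∂(volume.prod volume) :=
    integral_prod_swap g
  have h3 : ∫ q, (g q + g q.swap) ∂(volume.prod volume) =
      ∫ q, g q ∂(volume.prod volume) + ∫ q, g q.swap ∂(volume.prod volume) :=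
    integral_add hgi hgi.swap
  have h4 : ∀ q : Base n × Base n, g q + g q.swap = -T.indicator (fun q : Base n × Base n =>
      (u q.1 - u q.2) ^ 2 *
        (areaDensity F q.1 * areaDensity F q.2 * graphKernel s F q.1 q.2)) q := by
    rintro ⟨x, y⟩
    have h5 : (y, x) ∈ T ↔ (x, y) ∈ T := mem_farPairs_swap F δ x y
    simp only [hg, Prod.swap_prod_mk]
    by_cases hq : (x, y) ∈ T
    · rw [indicator_of_mem hq, indicator_of_mem (h5.2 hq), indicator_of_mem hq,
        graphKernel_comm s F y x]
      ring
    · rw [indicator_of_notMem hq, indicator_of_notMem (mt h5.1 hq), indicator_of_notMem hq]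
      ring
  simp only [h4, integral_neg] at h3
  rw [h1]
  linarith

theorem tendsto_integral_farPairs (hs0 : 0 < s) (hs1 : s < 1) (hF : ContDiff ℝ 2 F)
    (hmin : SatisfiesNonlocalMinimalEquation s (subgraph F)) (hu : ContDiff ℝ 1 u)
    (hc : HasCompactSupport u) :
    Tendsto (fun δ => ∫ q, (farPairs F δ).indicator (fun q : Base n × Base n => (u q.1 - u q.2) ^ 2 *
        (areaDensity F q.1 * areaDensity F q.2 * graphKernel s F q.1 q.2)) q
          ∂(volume.prod volume)) (𝓝[>] 0)
      (𝓝 (∫ q : Base n × Base n, (u q.1 - u q.2) ^ 2 *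
        (areaDensity F q.1 * areaDensity F q.2 * graphKernel s F q.1 q.2)
          ∂(volume.prod volume))) := by
  have hi := integrable_difference_sq hs0 hs1 hF hmin hu hc
  refine tendsto_integral_filter_of_dominated_convergence _
    (Eventually.of_forall fun δ =>
      hi.aestronglyMeasurable.indicator (measurableSet_farPairs hF.continuous δ))
    (Eventually.of_forall fun δ => ae_of_all _ fun q => norm_indicator_le_norm_self _ q) hi.norm
    (ae_of_all _ fun ⟨x, y⟩ => ?_)
  refine tendsto_const_nhds.congr' ?_
  rcases eq_or_ne (y - x) 0 with h | h
  · rw [sub_eq_zero] at h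
    refine Eventually.of_forall fun δ => ?_
    simp [indicator, h]
  · have h1 : ∀ᶠ δ : ℝ in 𝓝[>] 0, δ < ‖y - x‖ :=
      nhdsWithin_le_nhds (Iio_mem_nhds (norm_pos_iff.2 h))
    filter_upwards [h1] with δ hδ
    rw [indicator_of_mem]
    exact hδ.le.trans (norm_sub_le_norm_graphPoint_sub F x y)

end

/-! ### The ground state identity and stability in the chart. -/

section

variable {s : ℝ} {F u : Base n → ℝ}

theorem integrable_mul_normalGap (hs0 : 0 < s) (hs1 : s < 1) (hF : ContDiff ℝ 2 F)
    (hmin : SatisfiesNonlocalMinimalEquation s (subgraph F)) (hu : ContDiff ℝ 1 u)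
    (hc : HasCompactSupport u) :
    Integrable (fun q : Base n × Base n => u q.1 ^ 2 * (normalGap F q.1 q.2 *
      graphKernel s F q.1 q.2)) (volume.prod volume) := by
  obtain ⟨C, R, hC, -, hsupp, hub, -⟩ := exists_test_min_bound hu hc
  obtain ⟨D, hD, h⟩ := exists_normalGap_bound hF R
  refine integrable_of_abs_le_pairWeight hs0 hs1 hF hmin (C := C ^ 2 * D) (R := R) ?_ ?_ ?_
  · exact ((hu.continuous.measurable.comp _root_.measurable_fst).pow_const 2).mul
      ((measurable_normalGap hF).mul (measurable_graphKernel s hF.continuous))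
  · intro x y hx _
    simp [hsupp x hx]
  · intro x y hxy
    have h1 := normalGap_nonneg F x y
    have h3 := graphKernel_nonneg s F x y
    have h4 : u x ^ 2 ≤ C ^ 2 := by
      rw [← sq_abs]
      exact pow_le_pow_left₀ (abs_nonneg _) (hub x) 2
    dsimp only
    rw [abs_of_nonneg (by positivity), pairWeight]
    calc u x ^ 2 * (normalGap F x y * graphKernel s F x y)
        ≤ C ^ 2 * (D * (min 1 (‖y - x‖ ^ 2) * (areaDensity F x * areaDensity F y)) *
            graphKernel s F x y) :=
          mul_le_mul h4 (mul_le_mul_of_nonneg_right (h x y hxy) h3) (by positivity) (by positivity)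
      _ = _ := by ring

theorem gradient_apply_eq (F : Base n → ℝ) (x : Base n) (i : Fin n) :
    ∇ F x i = fderiv ℝ F x (EuclideanSpace.single i 1) := by
  rw [← InnerProductSpace.toDual_symm_apply (𝕜 := ℝ), ← gradient,
    EuclideanSpace.inner_single_right]
  simp

/-- The second variation is a negative square up to terms on which the derivatives of `F` are
tested with the Jacobi equation. -/
theorem second_variation_identity (F u : Base n → ℝ) (x y : Base n) :
    -(1 / 2) * ((u x - u y) ^ 2 * (areaDensity F x * areaDensity F y)) +
      1 / 2 * (u x ^ 2 * normalGap F x y + u y ^ 2 * normalGap F y x) +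
      1 / 2 * ∑ i, (u x ^ 2 * fderiv ℝ F x (EuclideanSpace.single i 1) -
        u y ^ 2 * fderiv ℝ F y (EuclideanSpace.single i 1)) *
          (fderiv ℝ F y (EuclideanSpace.single i 1) - fderiv ℝ F x (EuclideanSpace.single i 1)) =
      -(1 / 2) * (u x * areaDensity F x - u y * areaDensity F y) ^ 2 := by
  have hsum : ∑ i, (u x ^ 2 * fderiv ℝ F x (EuclideanSpace.single i 1) -
        u y ^ 2 * fderiv ℝ F y (EuclideanSpace.single i 1)) *
          (fderiv ℝ F y (EuclideanSpace.single i 1) - fderiv ℝ F x (EuclideanSpace.single i 1)) =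
      inner ℝ (u x ^ 2 • ∇ F x - u y ^ 2 • ∇ F y) (∇ F y - ∇ F x) := by
    rw [PiLp.inner_apply]
    refine Finset.sum_congr rfl fun i _ => ?_
    rw [RCLike.inner_apply, conj_trivial, mul_comm]
    simp only [PiLp.sub_apply, PiLp.smul_apply, smul_eq_mul, gradient_apply_eq]
  rw [hsum, inner_sub_right, inner_sub_left, inner_sub_left, real_inner_smul_left,
    real_inner_smul_left, real_inner_smul_left, real_inner_smul_left, real_inner_self_eq_norm_sq,
    real_inner_self_eq_norm_sq, normalGap_comm F y x, normalGap, real_inner_comm (∇ F x) (∇ F y)]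
  have h1 := areaDensity_sq F x
  have h2 := areaDensity_sq F y
  linear_combination (1 / 2 * u x ^ 2) * h1 + (1 / 2 * u y ^ 2) * h2

theorem integral_combination {α : Type*} [MeasurableSpace α] {μ : Measure α} {a b c d : α → ℝ}
    (ha : Integrable a μ) (hb : Integrable b μ) (hc : Integrable c μ) (hd : Integrable d μ) :
    ∫ q, (-(1 / 2) * a q + (1 / 2 * b q + 1 / 2 * c q) + 1 / 2 * d q) ∂μ =
      -(1 / 2) * ∫ q, a q ∂μ + (1 / 2 * ∫ q, b q ∂μ + 1 / 2 * ∫ q, c q ∂μ) +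
        1 / 2 * ∫ q, d q ∂μ := by
  have hbc : Integrable (fun q => 1 / 2 * b q + 1 / 2 * c q) μ :=
    (hb.const_mul _).add (hc.const_mul _)
  have habc : Integrable (fun q => -(1 / 2) * a q + (1 / 2 * b q + 1 / 2 * c q)) μ :=
    (ha.const_mul _).add hbc
  rw [integral_add habc (hd.const_mul _), integral_add (ha.const_mul _) hbc,
    integral_add (hb.const_mul _) (hc.const_mul _)]
  simp only [integral_const_mul]

/-- Stability, in the global chart. -/
theorem graph_stability (hs0 : 0 < s) (hs1 : s < 1) (hF : ContDiff ℝ 3 F)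
    (hmin : SatisfiesNonlocalMinimalEquation s (subgraph F)) (hu : ContDiff ℝ 2 u)
    (hc : HasCompactSupport u) {L : Base n → ℝ}
    (hL : ∀ x, Tendsto (graphTruncation s F u x) (𝓝[>] 0) (𝓝 (L x))) :
    Integrable (fun x => (areaDensity F x * L x + u x * totalGap s F x) * u x) ∧
      ∫ x, (areaDensity F x * L x + u x * totalGap s F x) * u x ≤ 0 := by
  have hF2 : ContDiff ℝ 2 F := hF.of_le (by norm_num)
  have hF1 : ContDiff ℝ 1 F := hF2.of_le one_le_two
  have hu1 : ContDiff ℝ 1 u := hu.of_le one_le_two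
  obtain ⟨C, R, hC, -, hsupp, hub, -⟩ := exists_test_min_bound hu1 hc
  obtain ⟨M, δ₀, hδ₀, hM⟩ := exists_graphTruncation_bound hs0 hs1 hF2 hmin hu hc R
  have hW := continuous_areaDensity hF1
  have hφ : Integrable fun x => u x * areaDensity F x :=
    (hu.continuous.mul hW).integrable_of_hasCompactSupport hc.mul_right
  have hbd : ∀ δ ∈ Ioc 0 δ₀, ∀ x, ‖graphTruncation s F u x δ * (u x * areaDensity F x)‖ ≤
      M * ‖u x * areaDensity F x‖ := by
    intro δ hδ x
    rw [norm_mul]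
    by_cases hx : ‖x‖ ≤ R
    · exact mul_le_mul_of_nonneg_right ((hM x hx).2 δ hδ) (norm_nonneg _)
    · rw [hsupp x (not_le.1 hx)]; simp
  have hev : ∀ᶠ δ : ℝ in 𝓝[>] 0, δ ∈ Ioc (0 : ℝ) δ₀ := Ioc_mem_nhdsGT hδ₀
  have hmδ : ∀ δ, AEStronglyMeasurable
      (fun x => graphTruncation s F u x δ * (u x * areaDensity F x)) := fun δ =>
    ((stronglyMeasurable_graphTruncation hF1 hu.continuous δ).aestronglyMeasurable).mul
      hφ.aestronglyMeasurable
  have hpt : ∀ x, Tendsto (fun δ => graphTruncation s F u x δ * (u x * areaDensity F x)) (𝓝[>] 0)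
      (𝓝 (L x * (u x * areaDensity F x))) := fun x => (hL x).mul_const _
  -- The bound of `exists_graphTruncation_bound`, uniform over the support of u, allows the
  -- principal value to be taken inside the outer integral.
  have hlim : Tendsto (fun δ => ∫ x, graphTruncation s F u x δ * (u x * areaDensity F x)) (𝓝[>] 0)
      (𝓝 (∫ x, L x * (u x * areaDensity F x))) := by
    refine tendsto_integral_filter_of_dominated_convergence _ (Eventually.of_forall hmδ) ?_
      (hφ.norm.const_mul M) (ae_of_all _ hpt)
    filter_upwards [hev] with δ hδ
    exact ae_of_all _ (hbd δ hδ)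
  have hLi : Integrable fun x => L x * (u x * areaDensity F x) := by
    refine (hφ.norm.const_mul M).mono' (aestronglyMeasurable_of_tendsto_ae (𝓝[>] (0 : ℝ)) hmδ
      (ae_of_all _ hpt)) (ae_of_all _ fun x => ?_)
    exact le_of_tendsto (hpt x).norm (hev.mono fun δ hδ => hbd δ hδ x)
  have hLe : ∫ x, L x * (u x * areaDensity F x) = -(1 / 2) *
      ∫ q : Base n × Base n, (u q.1 - u q.2) ^ 2 *
        (areaDensity F q.1 * areaDensity F q.2 * graphKernel s F q.1 q.2)
          ∂(volume.prod volume) := by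
    refine tendsto_nhds_unique hlim
      (((tendsto_integral_farPairs hs0 hs1 hF2 hmin hu1 hc).const_mul (-(1 / 2))).congr' ?_)
    filter_upwards [hev] with δ hδ
    exact (integral_graphTruncation_mul hs0 hs1 hF2 hmin hu1 hc hδ.1).symm
  have hG := integrable_mul_normalGap hs0 hs1 hF2 hmin hu1 hc
  have hGx : ∀ x, ∫ y, u x ^ 2 * (normalGap F x y * graphKernel s F x y) =
      u x ^ 2 * totalGap s F x := fun x => integral_const_mul _ _
  have hGi : Integrable fun x => u x ^ 2 * totalGap s F x := by
    have := hG.integral_prod_left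
    simpa only [hGx] using this
  have hGe : ∫ x, u x ^ 2 * totalGap s F x = ∫ q : Base n × Base n, u q.1 ^ 2 *
      (normalGap F q.1 q.2 * graphKernel s F q.1 q.2) ∂(volume.prod volume) := by
    rw [integral_prod _ hG]
    simp only [hGx]
  have hGs : ∫ q : Base n × Base n, u q.2 ^ 2 * (normalGap F q.2 q.1 * graphKernel s F q.2 q.1)
      ∂(volume.prod volume) = ∫ q : Base n × Base n, u q.1 ^ 2 *
        (normalGap F q.1 q.2 * graphKernel s F q.1 q.2) ∂(volume.prod volume) :=
    integral_prod_swap (fun q : Base n × Base n => u q.1 ^ 2 *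
      (normalGap F q.1 q.2 * graphKernel s F q.1 q.2))
  have hsplit : ∀ x, (areaDensity F x * L x + u x * totalGap s F x) * u x =
      L x * (u x * areaDensity F x) + u x ^ 2 * totalGap s F x := fun x => by ring
  simp only [hsplit]
  refine ⟨hLi.add hGi, ?_⟩
  rw [integral_add hLi hGi, hLe, hGe]
  -- The test function u²∂_iF must be of class C², which is where the third derivative of F is
  -- spent.
  have hJ : ∀ i : Fin n, _ := fun i => weak_jacobi_equation hs0 hs1 hF2 hmin
    (ψ := fun x => u x ^ 2 * fderiv ℝ F x (EuclideanSpace.single i 1))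
    ((hu.pow 2).mul ((hF.fderiv_right (m := 2) (by norm_num)).clm_apply contDiff_const))
    (by
      have : HasCompactSupport fun x => u x ^ 2 := by
        simp only [sq]; exact hc.mul_left
      exact this.mul_right) (EuclideanSpace.single i 1)
  have hA := integrable_difference_sq hs0 hs1 hF2 hmin hu1 hc
  have hJi := integrable_finsetSum Finset.univ fun i _ => (hJ i).1
  have hJ0 : ∫ q : Base n × Base n, ∑ i,
      (u q.1 ^ 2 * fderiv ℝ F q.1 (EuclideanSpace.single i 1) -
        u q.2 ^ 2 * fderiv ℝ F q.2 (EuclideanSpace.single i 1)) *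
        (fderiv ℝ F q.2 (EuclideanSpace.single i 1) - fderiv ℝ F q.1 (EuclideanSpace.single i 1)) *
          graphKernel s F q.1 q.2 ∂(volume.prod volume) = 0 := by
    rw [integral_finsetSum _ fun i _ => (hJ i).1]
    exact Finset.sum_eq_zero fun i _ => (hJ i).2
  -- Adding the tested Jacobi equations, whose integral is zero, makes the integrand equal to −½
  -- times a square times the kernel. The two gap terms are exchanged by swapping the points and so
  -- have equal integrals.
  have hle : ∫ q : Base n × Base n, (-(1 / 2) * ((u q.1 - u q.2) ^ 2 *
        (areaDensity F q.1 * areaDensity F q.2 * graphKernel s F q.1 q.2)) +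
      (1 / 2 * (u q.1 ^ 2 * (normalGap F q.1 q.2 * graphKernel s F q.1 q.2)) +
        1 / 2 * (u q.2 ^ 2 * (normalGap F q.2 q.1 * graphKernel s F q.2 q.1))) +
      1 / 2 * ∑ i, (u q.1 ^ 2 * fderiv ℝ F q.1 (EuclideanSpace.single i 1) -
        u q.2 ^ 2 * fderiv ℝ F q.2 (EuclideanSpace.single i 1)) *
        (fderiv ℝ F q.2 (EuclideanSpace.single i 1) - fderiv ℝ F q.1 (EuclideanSpace.single i 1)) *
          graphKernel s F q.1 q.2) ∂(volume.prod volume) ≤ 0 := by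
    refine integral_nonpos fun q => ?_
    have h1 := second_variation_identity F u q.1 q.2
    have h2 := graphKernel_nonneg s F q.1 q.2
    rw [← Finset.sum_mul, graphKernel_comm s F q.2 q.1]
    have h3 := mul_nonneg (sq_nonneg (u q.1 * areaDensity F q.1 - u q.2 * areaDensity F q.2)) h2
    have h4 := congrArg (· * graphKernel s F q.1 q.2) h1
    simp only [Pi.zero_apply] at h4 ⊢
    linarith
  have hGsw : Integrable (fun q : Base n × Base n => u q.2 ^ 2 * (normalGap F q.2 q.1 *
      graphKernel s F q.2 q.1)) (volume.prod volume) := hG.swap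
  rw [integral_combination hA hG hGsw hJi, hJ0, hGs] at hle
  linarith

end

/-! ### Transfer between the surface measure and the chart. -/

theorem measurableEmbedding_graphPoint {F : Base n → ℝ} (hF : Continuous F) :
    MeasurableEmbedding (graphPoint F) := by
  have h : Function.LeftInverse (fun x : Space n => x.fst) (graphPoint F) := fun _ => rfl
  exact (h.isClosedEmbedding (by fun_prop) (continuous_graphPoint hF)).measurableEmbedding

section

variable {F : Base n → ℝ} {g : Space n → ℝ} {S : Set (Space n)}

theorem surfaceMeasure_restrict (hF : Continuous F) (hS : MeasurableSet S) :
    (surfaceMeasure F).restrict S = ((volume.restrict (graphPoint F ⁻¹' S)).withDensity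
      fun x => ENNReal.ofReal (areaDensity F x)).map (graphPoint F) := by
  rw [surfaceMeasure, (measurableEmbedding_graphPoint hF).restrict_map,
    restrict_withDensity ((continuous_graphPoint hF).measurable hS)]
  rfl

theorem integrableOn_surfaceMeasure_iff (hF : ContDiff ℝ 1 F) (hS : MeasurableSet S) :
    IntegrableOn g S (surfaceMeasure F) ↔
      IntegrableOn (fun x => areaDensity F x * g (graphPoint F x)) (graphPoint F ⁻¹' S) := by
  rw [IntegrableOn, surfaceMeasure_restrict hF.continuous hS,
    (measurableEmbedding_graphPoint hF.continuous).integrable_map_iff,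
    integrable_withDensity_iff_integrable_smul'
      (continuous_areaDensity hF).measurable.ennreal_ofReal (ae_of_all _ fun _ =>
        ENNReal.ofReal_lt_top)]
  simp only [ENNReal.toReal_ofReal (areaDensity_pos F _).le, smul_eq_mul, Function.comp_apply]
  rfl

theorem setIntegral_surfaceMeasure (hF : ContDiff ℝ 1 F) (hS : MeasurableSet S) :
    ∫ p in S, g p ∂(surfaceMeasure F) =
      ∫ x in graphPoint F ⁻¹' S, areaDensity F x * g (graphPoint F x) := by
  rw [surfaceMeasure_restrict hF.continuous hS,
    (measurableEmbedding_graphPoint hF.continuous).integral_map,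
    integral_withDensity_eq_integral_toReal_smul
      (continuous_areaDensity hF).measurable.ennreal_ofReal (ae_of_all _ fun _ =>
        ENNReal.ofReal_lt_top)]
  simp only [ENNReal.toReal_ofReal (areaDensity_pos F _).le, smul_eq_mul]

theorem integrable_surfaceMeasure_iff (hF : ContDiff ℝ 1 F) :
    Integrable g (surfaceMeasure F) ↔
      Integrable fun x => areaDensity F x * g (graphPoint F x) := by
  rw [← integrableOn_univ, integrableOn_surfaceMeasure_iff hF MeasurableSet.univ, preimage_univ,
    integrableOn_univ]

theorem integral_surfaceMeasure (hF : ContDiff ℝ 1 F) :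
    ∫ p, g p ∂(surfaceMeasure F) = ∫ x, areaDensity F x * g (graphPoint F x) := by
  rw [← setIntegral_univ, setIntegral_surfaceMeasure hF MeasurableSet.univ, preimage_univ,
    setIntegral_univ]

theorem preimage_compl_ball (F : Base n → ℝ) (x : Base n) (δ : ℝ) :
    graphPoint F ⁻¹' (ball (graphPoint F x) δ)ᶜ =
      {y | δ ≤ ‖graphPoint F y - graphPoint F x‖} := by
  ext y
  rw [mem_preimage, mem_compl_iff, mem_ball, not_lt, dist_eq_norm]
  rfl

theorem kernel_graphPoint (s : ℝ) (F : Base n → ℝ) (x y : Base n) :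
    kernel s (graphPoint F y) (graphPoint F x) = graphKernel s F x y :=
  kernel_eq_radial _ _ _

theorem truncatedDifference_graphPoint (hF : ContDiff ℝ 1 F) (s : ℝ) (h : Space n → ℝ) (x : Base n)
    (δ : ℝ) : truncatedDifference (surfaceMeasure F) s h (graphPoint F x) δ =
      graphTruncation s F (fun y => h (graphPoint F y)) x δ := by
  rw [truncatedDifference, setIntegral_surfaceMeasure hF measurableSet_ball.compl,
    preimage_compl_ball, graphTruncation]
  refine integral_congr_ae (ae_of_all _ fun y => ?_)
  dsimp only
  rw [kernel_graphPoint]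
  ring

theorem areaDensity_mul_inner_normal (F : Base n → ℝ) (x y : Base n) :
    areaDensity F x * (areaDensity F y * inner ℝ (normal F (graphPoint F x) -
      normal F (graphPoint F y)) (normal F (graphPoint F x))) = normalGap F x y := by
  have hx := (areaDensity_pos F x).ne'
  have hy := (areaDensity_pos F y).ne'
  have hinner : ∀ x y, inner ℝ (normal F (graphPoint F x)) (normal F (graphPoint F y)) =
      (areaDensity F x)⁻¹ * (areaDensity F y)⁻¹ * (1 + inner ℝ (∇ F x) (∇ F y)) := fun x y => by
    have h1 : inner ℝ (WithLp.toLp 2 (-∇ F x, (1 : ℝ)) : Space n) (WithLp.toLp 2 (-∇ F y, (1 : ℝ))) =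
        1 + inner ℝ (∇ F x) (∇ F y) := by
      rw [WithLp.prod_inner_apply]
      change inner ℝ (-∇ F x) (-∇ F y) + inner ℝ (1 : ℝ) (1 : ℝ) = _
      rw [inner_neg_neg, real_inner_self_eq_norm_sq, norm_one]
      ring
    change inner ℝ ((areaDensity F x)⁻¹ • (WithLp.toLp 2 (-∇ F x, (1 : ℝ)) : Space n))
      ((areaDensity F y)⁻¹ • (WithLp.toLp 2 (-∇ F y, (1 : ℝ)) : Space n)) = _
    rw [real_inner_smul_left, real_inner_smul_right, h1]
    ring
  have h2 := areaDensity_sq F x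
  rw [inner_sub_left, hinner, hinner, real_inner_self_eq_norm_sq, ← h2, real_inner_comm, normalGap]
  field_simp
  ring

theorem areaDensity_mul_normalDefect (s : ℝ) (F : Base n → ℝ) (x y : Base n) :
    areaDensity F y * normalDefect (normal F) s (graphPoint F x) (graphPoint F y) =
      (areaDensity F x)⁻¹ * (normalGap F x y * graphKernel s F x y) := by
  have hx := (areaDensity_pos F x).ne'
  rw [normalDefect, kernel_graphPoint, ← areaDensity_mul_inner_normal]
  field_simp

theorem integral_normalDefect (hF : ContDiff ℝ 1 F) (s : ℝ) (x : Base n) :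
    ∫ p, normalDefect (normal F) s (graphPoint F x) p ∂(surfaceMeasure F) =
      (areaDensity F x)⁻¹ * totalGap s F x := by
  rw [integral_surfaceMeasure hF]
  simp only [areaDensity_mul_normalDefect]
  rw [integral_const_mul, totalGap]

end

end NonlocalMinimal

end

/-! ### Conclusion on the surface. -/

theorem mainTheorem9 (n : ℕ) (s : ℝ) (hs0 : 0 < s) (hs1 : s < 1)
    (F : EuclideanSpace ℝ (Fin n) → ℝ) (hF : ContDiff ℝ ∞ F)
    (hmin : NonlocalMinimal.SatisfiesNonlocalMinimalEquation s (NonlocalMinimal.subgraph F))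
    (h : NonlocalMinimal.Space n → ℝ) (hh : NonlocalMinimal.IsTestFunction F h) :
    (∀ p ∈ frontier (NonlocalMinimal.subgraph F),
      NonlocalMinimal.JacobiConverges (NonlocalMinimal.surfaceMeasure F)
        (NonlocalMinimal.normal F) s h p) ∧
    Integrable (fun p => NonlocalMinimal.jacobi (NonlocalMinimal.surfaceMeasure F)
        (NonlocalMinimal.normal F) s h p * h p) (NonlocalMinimal.surfaceMeasure F) ∧
    0 ≤ -∫ p, NonlocalMinimal.jacobi (NonlocalMinimal.surfaceMeasure F)
        (NonlocalMinimal.normal F) s h p * h p ∂(NonlocalMinimal.surfaceMeasure F) := by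
  have hF3 : ContDiff ℝ 3 F := contDiff_infty.1 hF 3
  have hF2 : ContDiff ℝ 2 F := hF3.of_le (by norm_num)
  have hF1 : ContDiff ℝ 1 F := hF2.of_le one_le_two
  obtain ⟨huS, hc⟩ := hh
  set u : EuclideanSpace ℝ (Fin n) → ℝ := fun x' => h (NonlocalMinimal.graphPoint F x') with hu
  have hu2 : ContDiff ℝ 2 u := contDiff_infty.1 huS 2
  have htrunc : ∀ x, NonlocalMinimal.truncatedDifference (NonlocalMinimal.surfaceMeasure F) s h
      (NonlocalMinimal.graphPoint F x) = NonlocalMinimal.graphTruncation s F u x := fun x =>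
    funext fun δ => NonlocalMinimal.truncatedDifference_graphPoint hF1 s h x δ
  have hlim : ∀ x, ∃ L, Tendsto (NonlocalMinimal.graphTruncation s F u x) (𝓝[>] 0) (𝓝 L) := by
    intro x
    obtain ⟨M, δ₀, -, hM⟩ :=
      NonlocalMinimal.exists_graphTruncation_bound hs0 hs1 hF2 hmin hu2 hc ‖x‖
    exact (hM x le_rfl).1
  choose L hL using hlim
  obtain ⟨hint, hle⟩ := NonlocalMinimal.graph_stability hs0 hs1 hF3 hmin hu2 hc hL
  -- The density W(x) of dσ cancels the factor 1/W(x) that the normal at the base point leaves in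
  -- the zeroth order coefficient.
  have hJ : ∀ x, NonlocalMinimal.areaDensity F x *
      (NonlocalMinimal.jacobi (NonlocalMinimal.surfaceMeasure F) (NonlocalMinimal.normal F) s h
        (NonlocalMinimal.graphPoint F x) * h (NonlocalMinimal.graphPoint F x)) =
      (NonlocalMinimal.areaDensity F x * L x + u x * NonlocalMinimal.totalGap s F x) * u x := by
    intro x
    have hW := (NonlocalMinimal.areaDensity_pos F x).ne'
    rw [NonlocalMinimal.jacobi, htrunc, (hL x).limUnder_eq,
      NonlocalMinimal.integral_normalDefect hF1]
    change NonlocalMinimal.areaDensity F x * ((L x + u x * _) * u x) = _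
    field_simp
  refine ⟨fun p hp => ?_, ?_, ?_⟩
  · rw [NonlocalMinimal.frontier_subgraph hF.continuous] at hp
    obtain ⟨x, rfl⟩ := hp
    refine ⟨fun δ hδ => ?_, ⟨L x, by rw [htrunc]; exact hL x⟩, ?_⟩
    · rw [NonlocalMinimal.integrableOn_surfaceMeasure_iff hF1 measurableSet_ball.compl,
        NonlocalMinimal.preimage_compl_ball]
      refine (NonlocalMinimal.integrableOn_graphTruncation hs0 hs1 hF2 hmin hu2.continuous hc x
        hδ).congr (ae_of_all _ fun y => ?_)
      dsimp only
      rw [NonlocalMinimal.kernel_graphPoint]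
      ring
    · rw [NonlocalMinimal.integrable_surfaceMeasure_iff hF1]
      simp only [NonlocalMinimal.areaDensity_mul_normalDefect]
      exact (NonlocalMinimal.integrable_normalGap_mul_graphKernel hs0 hs1 hF2 hmin x).const_mul _
  · rw [NonlocalMinimal.integrable_surfaceMeasure_iff hF1]
    simpa only [hJ] using hint
  · rw [NonlocalMinimal.integral_surfaceMeasure hF1]
    simp only [hJ]
    linarith
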